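/- **Setting.** Let $\mathfrak g=V_1\oplus\dots\oplus V_m$ be an $n$-dimensional real Lie algebra, $m\le 2$, $V_m\neq 0$, with $[V_1,V_j]=V_{j+1}$ for $1\le j<m$ and $[V_1,V_m]=0$, and suppose that some basis of $\mathfrak g$ has rational structure constants. Identify $\mathfrak g$ with $\mathbb R^n$ through a basis $v_1,\dots,v_n$ adapted to the stratification, $v_i\in V_{\deg i}$. The associated connected and simply connected group $G=(\mathbb R^n,*_G)$ (rational, stratified, of step at most two), in exponential coordinates, has the product $x*_Gy=x+y+\tfrac12[x,y]$, the dilations $D_r(x)=(r^{\deg i}x_i)_i$ and the homogeneous dimension $Q=\sum_i\deg i=\sum_j j\dim V_j$. A *homogeneous quasi-norm* is a continuous function $\|\cdot\|:\mathbb R^n\to[0,\infty)$ with $\|D_rx\|=r\|x\|$ for $r>0$, $\|-x\|=\|x\|$, and $\|x\|=0$ only for $x=0$; put $B(c,R)=\{x:\|(-c)*_Gx\|<R\}$. For $0\le\alpha<1$, a *generalized $\alpha$-covering* is a family $(P_i)_{i\in I}$ of non-empty open connected sets covering $\mathbb R^n$ such that $\sup_i\#\{j:P_i\cap P_j\ne\emptyset\}<\infty$,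 $|P_i|\asymp(1+\|\xi\|^2)^{\alpha Q/2}$ uniformly in $i\in I$ and $\xi\in P_i$, and, for some $K\ge 1$ and all $i$, the infimum of the radii of the balls containing $P_i$ is at most $K$ times the supremum of the radii of the balls contained in $P_i$. A *BAPU* subordinate to it is a family of non-negative functions $\psi_i\in C_c^\infty(\mathbb R^n)$ with $\operatorname{supp}\psi_i\subset P_i$, $\sum_i\psi_i\equiv1$ and $\sup_i\|\mathcal F^{-1}\psi_i\|_{L^1}<\infty$. Let $Z(\mathbb R^n)=\mathcal F(C_c^\infty(\mathbb R^n))$ with the topology transported by the Fourier transform $\mathcal F$, let $Z'(\mathbb R^n)$ be its dual, and define $\mathcal F:Z'\to\mathcal D'$ by $(\mathcal Ff)(\varphi)=f(\mathcal F\varphi)$. Given a homogeneous quasi-norm, a generalized $\alpha$-covering $(P_i)$, a BAPU $(\psi_i)$ subordinate to it and points $\xi_i\in P_i$, the space $M^{s,\alpha}_{p,q}(G)$, for $s\in\mathbb R$ and $1\le p,q\le\infty$, consists of all $f\in Z'(\mathbb R^n)$ with $$\|f\|_{M^{s,\alpha}_{p,q}(G)}=\Big\|\big((1+\|\xi_i\|^2)^{s/2}\,\|\mathcal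 F^{-1}(\psi_i\cdot\mathcal Ff)\|_{L^p}\big)_{i\in I}\Big\|_{\ell^q(I)}<\infty .$$ **Proposition.** Let $1\le p,q<\infty$, $s\in\mathbb R$, $0\le\alpha<1$ and $\frac1p+\frac1{p'}=\frac1q+\frac1{q'}=1$. The dual space of $M^{s,\alpha}_{p,q}(G)$ is identified with $M^{-s,\alpha}_{p',q'}(G)$ by the extension of the sesquilinear pairing $\int\overline f\,g$. Precisely, for any choices (possibly different for the two spaces) of the quasi-norm, the covering, the BAPU and the points $\xi_i$, there is a conjugate-linear bijection $$\Lambda:M^{-s,\alpha}_{p',q'}(G)\to\big(M^{s,\alpha}_{p,q}(G)\big)^*,$$ continuous with continuous inverse, such that every $g\in Z(\mathbb R^n)$ (acting on $Z(\mathbb R^n)$ by $z\mapsto\int gz$) belongs to $M^{s,\alpha}_{p,q}(G)$ and $\Lambda(f)(g)=\overline{f(\overline g)}$ for all $f\in M^{-s,\alpha}_{p',q'}(G)$. -/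

import Mathlib

open MeasureTheory FourierTransform
open scoped ENNReal Distributions SchwartzMap ComplexConjugate

noncomputable section

namespace GenAlphaMod

/-- The space `ℝⁿ` with its Euclidean structure and Lebesgue measure. -/
abbrev E (n : ℕ) : Type := EuclideanSpace ℝ (Fin n)

/-! ### Admissible Lie groups -/

/-- The `j`-th layer `V_j` spanned by the basis vectors of degree `j`. -/
def layer {n : ℕ} {𝔤 : Type*} [LieRing 𝔤] [LieAlgebra ℝ 𝔤]
    (b : Module.Basis (Fin n) ℝ 𝔤) (deg : Fin n → ℕ) (j : ℕ) : Submodule ℝ 𝔤 :=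
  Submodule.span ℝ (b '' {i | deg i = j})

/-- An admissible Lie group of dimension `n`: a rational stratified Lie group of step at most two,
given by its Lie algebra `𝔤` with a stratification `𝔤 = V_1 ⊕ ⋯ ⊕ V_step` and a basis of `𝔤`
adapted to it (each basis vector has a degree, and `V_j` is spanned by those of degree `j`, so that
the sum of the layers is direct). -/
structure AdmissibleLieGroup (n : ℕ) (𝔤 : Type*) [LieRing 𝔤] [LieAlgebra ℝ 𝔤] where
  basis : Module.Basis (Fin n) ℝ 𝔤
  deg : Fin n → ℕ
  step : ℕ
  one_le_deg : ∀ i, 1 ≤ deg i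
  deg_le_step : ∀ i, deg i ≤ step
  /-- The top layer is not zero, so that `step` is indeed the step. -/
  exists_deg_eq_step : ∃ i, deg i = step
  /-- `[V_1, V_j] = V_{j+1}` for `1 ≤ j < step`. -/
  bracket_layer : ∀ j, 1 ≤ j → j < step →
    Submodule.span ℝ {z | ∃ x ∈ layer basis deg 1, ∃ y ∈ layer basis deg j, ⁅x, y⁆ = z} =
      layer basis deg (j + 1)
  /-- `[V_1, V_step] = 0`. -/
  bracket_top : ∀ x ∈ layer basis deg 1, ∀ y ∈ layer basis deg step, ⁅x, y⁆ = 0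
  step_le_two : step ≤ 2
  /-- Some basis of the Lie algebra has rational structure constants. -/
  rational : ∃ X : Module.Basis (Fin n) ℝ 𝔤, ∀ i j k, ∃ c : ℚ, X.repr ⁅X i, X j⁆ k = (c : ℝ)

namespace AdmissibleLieGroup

variable {n : ℕ} {𝔤 : Type*} [LieRing 𝔤] [LieAlgebra ℝ 𝔤] (G : AdmissibleLieGroup n 𝔤)

/-- The identification of the Lie algebra with `ℝⁿ` through the adapted basis. -/
def coord : 𝔤 ≃ₗ[ℝ] E n :=
  G.basis.equivFun.trans (WithLp.linearEquiv 2 ℝ (Fin n → ℝ)).symm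

/-- The group law on `ℝⁿ` in exponential coordinates. Since the step is at most two, the
Baker-Campbell-Hausdorff formula reads `x * y = x + y + [x, y] / 2`. The neutral element is `0` and
the inverse of `x` is `-x`. -/
def mul (x y : E n) : E n :=
  x + y + (1 / 2 : ℝ) • G.coord ⁅G.coord.symm x, G.coord.symm y⁆

/-- The dilations `D_r`, acting on the coordinate of degree `d` as multiplication by `r ^ d`. -/
def dil (r : ℝ) (x : E n) : E n := WithLp.toLp 2 fun i => r ^ G.deg i * x i

/-- The homogeneous dimension `∑ j, j * dim V_j`, that is the sum of all degrees. -/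
def homDim : ℕ := ∑ i, G.deg i

/-- Homogeneous quasi-norms: nonnegative continuous functions that are `1`-homogeneous,
symmetric, and vanish only at the neutral element. -/
structure IsHomQuasiNorm (ν : E n → ℝ) : Prop where
  continuous : Continuous ν
  nonneg : ∀ x, 0 ≤ ν x
  homogeneous : ∀ r : ℝ, 0 < r → ∀ x, ν (G.dil r x) = r * ν x
  symmetric : ∀ x, ν (-x) = ν x
  eq_zero : ∀ x, ν x = 0 → x = 0

/-- The ball of centre `c` and radius `R`: all `x` with `ν (c⁻¹ * x) < R`. -/
def ball (ν : E n → ℝ) (c : E n) (R : ℝ) : Set (E n) := {x | ν (G.mul (-c) x) < R}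

/-- The supremum of the radii of balls contained in `P`. -/
def innerRadius (ν : E n → ℝ) (P : Set (E n)) : ℝ≥0∞ :=
  ⨆ (c : E n) (r : ℝ) (_ : G.ball ν c r ⊆ P), ENNReal.ofReal r

/-- The infimum of the radii of balls containing `P`. -/
def outerRadius (ν : E n → ℝ) (P : Set (E n)) : ℝ≥0∞ :=
  ⨅ (c : E n) (R : ℝ) (_ : P ⊆ G.ball ν c R), ENNReal.ofReal R

end AdmissibleLieGroup

/-! ### Coverings and partitions of unity -/

/-- Admissible coverings of `ℝⁿ` by nonempty sets. -/
structure IsAdmissibleCovering {n : ℕ} {I : Type*} (P : I → Set (E n)) : Prop where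
  nonempty : ∀ i, (P i).Nonempty
  covers : ⋃ i, P i = Set.univ
  admissible : ∃ N : ℕ, ∀ i, {j | (P i ∩ P j).Nonempty}.encard ≤ N

/-- Generalized `α`-coverings for `G`, with respect to the homogeneous quasi-norm `ν`. -/
structure IsAlphaCovering {n : ℕ} {𝔤 : Type*} [LieRing 𝔤] [LieAlgebra ℝ 𝔤]
    (G : AdmissibleLieGroup n 𝔤) (ν : E n → ℝ) (α : ℝ) {I : Type*} (P : I → Set (E n)) : Prop
    extends IsAdmissibleCovering P where
  isOpen : ∀ i, IsOpen (P i)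
  isConnected : ∀ i, IsConnected (P i)
  /-- `|P i| ≍ (1 + ν(ξ)²) ^ (α Q / 2)` for all `ξ ∈ P i`, with constants independent of `i, ξ`. -/
  size : ∃ C : ℝ, 0 < C ∧ ∀ i, ∀ ξ ∈ P i,
    ENNReal.ofReal (C⁻¹ * (1 + ν ξ ^ 2) ^ (α * G.homDim / 2)) ≤ volume (P i) ∧
      volume (P i) ≤ ENNReal.ofReal (C * (1 + ν ξ ^ 2) ^ (α * G.homDim / 2))
  ratio : ∃ K : ℝ, 1 ≤ K ∧
    ∀ i, G.outerRadius ν (P i) ≤ ENNReal.ofReal K * G.innerRadius ν (P i)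

/-- Bounded admissible partitions of unity subordinate to a covering `P`, consisting of smooth
functions of compact support. -/
structure IsBAPU {n : ℕ} {I : Type*} (P : I → Set (E n))
    (ψ : I → 𝓓((⊤ : TopologicalSpace.Opens (E n)), ℝ)) : Prop where
  nonneg : ∀ i ξ, 0 ≤ ψ i ξ
  tsupport_subset : ∀ i, tsupport (ψ i) ⊆ P i
  hasSum_one : ∀ ξ, HasSum (fun i => ψ i ξ) 1
  bounded : ∃ C : ℝ, ∀ i,
    eLpNorm (𝓕⁻ (fun ξ => (ψ i ξ : ℂ))) 1 volume ≤ ENNReal.ofReal C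

/-- The choices made in the definition of the generalized `α`-modulation spaces of `G`: a
homogeneous quasi-norm `ν`, a generalized `α`-covering `P`, a partition of unity `ψ` subordinate
to `P`, and a point `ξ i` in each set `P i`. -/
structure AlphaModData {n : ℕ} {𝔤 : Type*} [LieRing 𝔤] [LieAlgebra ℝ 𝔤]
    (G : AdmissibleLieGroup n 𝔤) (α : ℝ) (I : Type*) where
  ν : E n → ℝ
  isHomQuasiNorm : G.IsHomQuasiNorm ν
  P : I → Set (E n)
  isAlphaCovering : IsAlphaCovering G ν α P
  ψ : I → 𝓓((⊤ : TopologicalSpace.Opens (E n)), ℝ)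
  isBAPU : IsBAPU P ψ
  ξ : I → E n
  ξ_mem : ∀ i, ξ i ∈ P i

/-! ### The Fourier type reservoir -/

/-- The space `C_c^∞(ℝⁿ)` of complex test functions with its usual (LF) topology. -/
abbrev Test (n : ℕ) : Type := 𝓓((⊤ : TopologicalSpace.Opens (E n)), ℂ)

/-- Test functions as Schwartz functions. -/
def testToSchwartz (n : ℕ) : Test n →ₗ[ℂ] 𝓢(E n, ℂ) where
  toFun φ := φ.hasCompactSupport.toSchwartzMap φ.contDiff
  map_add' _ _ := rfl
  map_smul' _ _ := rfl

/-- The Fourier transform of test functions. -/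
def fourierTest (n : ℕ) : Test n →ₗ[ℂ] 𝓢(E n, ℂ) where
  toFun φ := 𝓕 (testToSchwartz n φ)
  map_add' φ χ := by simp [FourierTransform.fourier_add]
  map_smul' c φ := by simp [FourierTransform.fourier_smul]

/-- The space `Z(ℝⁿ) = 𝓕(C_c^∞(ℝⁿ))`. -/
def ZSpace (n : ℕ) : Type := LinearMap.range (fourierTest n)

instance (n : ℕ) : AddCommGroup (ZSpace n) :=
  inferInstanceAs (AddCommGroup (LinearMap.range (fourierTest n)))

instance (n : ℕ) : Module ℂ (ZSpace n) :=
  inferInstanceAs (Module ℂ (LinearMap.range (fourierTest n)))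

/-- The Fourier transform as a (bijective) map from `C_c^∞(ℝⁿ)` to `Z(ℝⁿ)`. -/
def fourierZ (n : ℕ) : Test n →ₗ[ℂ] ZSpace n := (fourierTest n).rangeRestrict

/-- The topology transported from `C_c^∞(ℝⁿ)` by the Fourier transform. -/
instance (n : ℕ) : TopologicalSpace (ZSpace n) :=
  TopologicalSpace.coinduced (fourierZ n) inferInstance

lemma fourierTest_injective (n : ℕ) : Function.Injective (fourierTest n) := by
  intro φ χ h
  have h' : 𝓕⁻ (𝓕 (testToSchwartz n φ)) = 𝓕⁻ (𝓕 (testToSchwartz n χ)) := congrArg _ h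
  rw [FourierTransform.fourierInv_fourier_eq, FourierTransform.fourierInv_fourier_eq] at h'
  ext x
  exact DFunLike.congr_fun h' x

lemma fourierZ_injective (n : ℕ) : Function.Injective (fourierZ n) := fun _ _ h =>
  fourierTest_injective n (congrArg Subtype.val h)

lemma fourierZ_surjective (n : ℕ) : Function.Surjective (fourierZ n) :=
  (fourierTest n).surjective_rangeRestrict

/-- The Fourier type reservoir `Z'(ℝⁿ)`. -/
abbrev ZDual (n : ℕ) : Type := ZSpace n →L[ℂ] ℂ

/-- The Fourier transform `Z'(ℝⁿ) → 𝓓'(ℝⁿ)`, `(𝓕 f)(φ) = f (𝓕 φ)`. -/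
def ZDual.fourier {n : ℕ} (f : ZDual n) : Test n →L[ℂ] ℂ where
  toLinearMap := f.toLinearMap ∘ₗ fourierZ n
  cont := f.continuous.comp continuous_coinduced_rng

lemma integrable_mul_schwartz {n : ℕ} {p q : ℝ≥0∞} [ENNReal.HolderTriple p q 1] {h : E n → ℂ}
    (hh : MemLp h p volume) (g : 𝓢(E n, ℂ)) : Integrable (fun x => h x * g x) volume :=
  hh.integrable_mul (g.memLp q volume)

/-- The function `𝓕⁻¹ φ ∈ Z(ℝⁿ)`, for a test function `φ`, as the element
`z ↦ ∫ (𝓕⁻¹ φ) z` of `Z'(ℝⁿ)`. -/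
def zOfTest {n : ℕ} (φ : Test n) : ZDual n where
  toFun z := ∫ x, (𝓕⁻ (testToSchwartz n φ)) x * z.1 x
  map_add' z w := by
    have h : ∀ v : 𝓢(E n, ℂ), Integrable (fun x => (𝓕⁻ (testToSchwartz n φ)) x * v x) volume :=
      fun v => integrable_mul_schwartz (p := 2) (q := 2) (SchwartzMap.memLp _ _ _) v
    rw [← integral_add (h z.1) (h w.1)]
    exact integral_congr_ae (.of_forall fun x => mul_add _ _ _)
  map_smul' c z := by
    rw [RingHom.id_apply, smul_eq_mul, ← integral_const_mul]
    exact integral_congr_ae (.of_forall fun x => mul_left_comm _ _ _)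
  cont := by
    refine continuous_coinduced_dom.2 ?_
    refine (TestFunction.integralAgainstBilinCLM (ContinuousLinearMap.mul ℂ ℂ) volume
      (φ : E n → ℂ)).continuous.congr fun χ => ?_
    rw [TestFunction.integralAgainstBilinCLM_eq_integral
      (φ.continuous.locallyIntegrable.locallyIntegrableOn _)]
    have h := SchwartzMap.integral_fourier_mul_eq (testToSchwartz n χ)
      (𝓕⁻ (testToSchwartz n φ))
    rw [FourierTransform.fourier_fourierInv_eq] at h
    exact h.symm.trans (integral_congr_ae (.of_forall fun x => mul_comm _ _))

/-- The complex conjugate of a test function. -/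
def conjTest {n : ℕ} (φ : Test n) : Test n :=
  TestFunction.postcompCLM (𝕜 := ℝ) (Complex.conjCLE : ℂ →L[ℝ] ℂ) φ

/-! ### The generalized `α`-modulation spaces -/

/-- The product of a real test function with a Schwartz function, as a test function. -/
def mulTest {n : ℕ} (ψ : 𝓓((⊤ : TopologicalSpace.Opens (E n)), ℝ)) :
    𝓢(E n, ℂ) →ₗ[ℂ] Test n where
  toFun g :=
    { toFun := fun ξ => (ψ ξ : ℂ) * g ξ
      contDiff' := (Complex.ofRealCLM.contDiff.comp ψ.contDiff).mul (g.smooth _)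
      hasCompactSupport' := by
        have h : HasCompactSupport fun ξ => (ψ ξ : ℂ) :=
          ψ.hasCompactSupport.comp_left (g := fun r : ℝ => (r : ℂ)) Complex.ofReal_zero
        exact h.mul_right
      tsupport_subset' := fun _ _ => trivial }
  map_add' g h := by
    ext ξ
    exact mul_add _ _ _
  map_smul' c g := by
    ext ξ
    exact mul_left_comm _ _ _

/-- The tempered distribution `𝓕⁻¹ (ψ · 𝓕 f)`, that is `g ↦ (𝓕 f)(ψ · 𝓕⁻¹ g)`. -/
def freqBlock {n : ℕ} (ψ : 𝓓((⊤ : TopologicalSpace.Opens (E n)), ℝ)) (f : ZDual n) :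
    𝓢(E n, ℂ) →ₗ[ℂ] ℂ where
  toFun g := f.fourier (mulTest ψ (𝓕⁻ g))
  map_add' g h := by simp [FourierTransform.fourierInv_add]
  map_smul' c g := by simp [FourierTransform.fourierInv_smul]

/-- The `L^p` norm of a functional on Schwartz functions: the `L^p` norm of the (almost everywhere
unique) function `h` in `L^p` that represents it, and `∞` if there is none. -/
def distLpENorm {n : ℕ} (p : ℝ≥0∞) (u : 𝓢(E n, ℂ) →ₗ[ℂ] ℂ) : ℝ≥0∞ :=
  ⨅ (h : E n → ℂ) (_ : MemLp h p volume) (_ : ∀ g : 𝓢(E n, ℂ), u g = ∫ x, h x * g x),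
    eLpNorm h p volume

/-- The `ℓ^q` norm of a family of extended nonnegative reals. -/
def lqENorm {I : Type*} (q : ℝ≥0∞) (a : I → ℝ≥0∞) : ℝ≥0∞ :=
  if q = ∞ then ⨆ i, a i else (∑' i, a i ^ q.toReal) ^ (1 / q.toReal)

lemma lqENorm_mono {I : Type*} (q : ℝ≥0∞) {a b : I → ℝ≥0∞} (h : ∀ i, a i ≤ b i) :
    lqENorm q a ≤ lqENorm q b := by
  unfold lqENorm
  split_ifs with hq
  · exact iSup_mono h
  · have h0 := ENNReal.toReal_nonneg (a := q)
    gcongr with i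
    exact h i

lemma lqENorm_add_le {I : Type*} {q : ℝ≥0∞} (hq : 1 ≤ q) (a b : I → ℝ≥0∞) :
    lqENorm q (fun i => a i + b i) ≤ lqENorm q a + lqENorm q b := by
  unfold lqENorm
  split_ifs with h
  · exact iSup_le fun i => add_le_add (le_iSup a i) (le_iSup b i)
  · have h1 : 1 ≤ q.toReal := by simpa using ENNReal.toReal_mono h hq
    have h0 : 0 < q.toReal := by linarith
    have key : ∀ F : Finset I, ∑ i ∈ F, (a i + b i) ^ q.toReal ≤
        ((∑' i, a i ^ q.toReal) ^ (1 / q.toReal) +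
          (∑' i, b i ^ q.toReal) ^ (1 / q.toReal)) ^ q.toReal := by
      intro F
      have h2 := ENNReal.Lp_add_le F a b h1
      have h3 : (∑ i ∈ F, (a i + b i) ^ q.toReal) ^ (1 / q.toReal) ≤
          (∑' i, a i ^ q.toReal) ^ (1 / q.toReal) + (∑' i, b i ^ q.toReal) ^ (1 / q.toReal) := by
        refine h2.trans ?_
        gcongr <;> exact ENNReal.sum_le_tsum F
      rwa [one_div, ENNReal.rpow_inv_le_iff h0, ← one_div] at h3
    rw [one_div, ENNReal.rpow_inv_le_iff h0, ← one_div, ENNReal.tsum_eq_iSup_sum]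
    exact iSup_le key

lemma lqENorm_const_mul {I : Type*} {q : ℝ≥0∞} (hq : 1 ≤ q) (c : ℝ≥0∞) (a : I → ℝ≥0∞) :
    lqENorm q (fun i => c * a i) = c * lqENorm q a := by
  unfold lqENorm
  split_ifs with h
  · rw [ENNReal.mul_iSup]
  · have h1 : 1 ≤ q.toReal := by simpa using ENNReal.toReal_mono h hq
    have h0 : 0 < q.toReal := by linarith
    simp_rw [ENNReal.mul_rpow_of_nonneg _ _ h0.le]
    rw [ENNReal.tsum_mul_left, ENNReal.mul_rpow_of_nonneg _ _ (by positivity), ← ENNReal.rpow_mul,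
      mul_one_div_cancel h0.ne', ENNReal.rpow_one]

lemma eq_zero_of_lqENorm_eq_zero {I : Type*} {q : ℝ≥0∞} (hq : 1 ≤ q) {a : I → ℝ≥0∞}
    (h : lqENorm q a = 0) (i : I) : a i = 0 := by
  unfold lqENorm at h
  split_ifs at h with hq'
  · exact le_antisymm ((le_iSup a i).trans h.le) zero_le
  · have h1 : 1 ≤ q.toReal := by simpa using ENNReal.toReal_mono hq' hq
    have h0 : 0 < q.toReal := by linarith
    rw [ENNReal.rpow_eq_zero_iff_of_pos (by positivity), ENNReal.tsum_eq_zero] at h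
    exact (ENNReal.rpow_eq_zero_iff_of_pos h0).1 (h i)

lemma distLpENorm_zero {n : ℕ} (p : ℝ≥0∞) :
    distLpENorm p (0 : 𝓢(E n, ℂ) →ₗ[ℂ] ℂ) = 0 := by
  refine le_antisymm ?_ zero_le
  refine iInf_le_of_le 0 (iInf_le_of_le MemLp.zero (iInf_le_of_le ?_ ?_)) <;> simp

lemma distLpENorm_add_le {n : ℕ} {p : ℝ≥0∞} [hp : Fact (1 ≤ p)] (u v : 𝓢(E n, ℂ) →ₗ[ℂ] ℂ) :
    distLpENorm p (u + v) ≤ distLpENorm p u + distLpENorm p v := by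
  unfold distLpENorm
  simp only [ENNReal.iInf_add, ENNReal.add_iInf]
  refine le_iInf fun k => le_iInf fun hk => le_iInf fun hku => le_iInf fun h => le_iInf fun hh =>
    le_iInf fun hhu => ?_
  have := ENNReal.HolderConjugate.conjExponent hp.out
  refine iInf_le_of_le (h + k) (iInf_le_of_le (hh.add hk) (iInf_le_of_le (fun g => ?_)
    (eLpNorm_add_le hh.1 hk.1 hp.out)))
  rw [LinearMap.add_apply, hku, hhu, ← integral_add
    (integrable_mul_schwartz (q := p.conjExponent) hh g)
    (integrable_mul_schwartz (q := p.conjExponent) hk g)]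
  exact integral_congr_ae (.of_forall fun x => (add_mul _ _ _).symm)

lemma distLpENorm_smul_le {n : ℕ} {p : ℝ≥0∞} (c : ℂ) (u : 𝓢(E n, ℂ) →ₗ[ℂ] ℂ) :
    distLpENorm p (c • u) ≤ ‖c‖ₑ * distLpENorm p u := by
  rcases eq_or_ne c 0 with rfl | hc
  · simp [distLpENorm_zero]
  have hc0 : ‖c‖ₑ ≠ 0 := by simpa using hc
  have hct : ‖c‖ₑ ≠ ∞ := enorm_ne_top
  unfold distLpENorm
  simp only [ENNReal.mul_iInf_of_ne hc0 hct]
  refine le_iInf fun h => le_iInf fun hh => le_iInf fun hhu => ?_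
  refine iInf_le_of_le (c • h) (iInf_le_of_le (hh.const_smul c) (iInf_le_of_le (fun g => ?_)
    (eLpNorm_const_smul c h p volume).le))
  rw [LinearMap.smul_apply, hhu, smul_eq_mul, ← integral_const_mul]
  exact integral_congr_ae (.of_forall fun x => (mul_assoc _ _ _).symm)

lemma eq_zero_of_distLpENorm_eq_zero {n : ℕ} {p : ℝ≥0∞} [hp : Fact (1 ≤ p)]
    {u : 𝓢(E n, ℂ) →ₗ[ℂ] ℂ} (hu : distLpENorm p u = 0) : u = 0 := by
  ext g
  rw [LinearMap.zero_apply, ← enorm_eq_zero]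
  have key : ∀ h : E n → ℂ, MemLp h p volume → (∀ g : 𝓢(E n, ℂ), u g = ∫ x, h x * g x) →
      ‖u g‖ₑ ≤ eLpNorm g p.conjExponent volume * eLpNorm h p volume := by
    intro h hh hhu
    rw [hhu g, mul_comm]
    refine (enorm_integral_le_lintegral_enorm _).trans ?_
    rw [← eLpNorm_one_eq_lintegral_enorm]
    exact eLpNorm_smul_le_mul_eLpNorm (φ := h) (f := g) (p := p) (q := p.conjExponent)
      g.continuous.aestronglyMeasurable hh.1
  have hg : eLpNorm g p.conjExponent volume ≠ ∞ := (g.memLp _ _).2.ne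
  rcases eq_or_ne (eLpNorm g p.conjExponent volume) 0 with h0 | h0
  · by_contra hne
    refine ENNReal.zero_ne_top (hu.symm.trans ?_)
    refine iInf_eq_top.2 fun h => iInf_eq_top.2 fun hh => iInf_eq_top.2 fun hhu => ?_
    have h1 := key h hh hhu
    rw [h0, zero_mul] at h1
    exact absurd (le_antisymm h1 zero_le) hne
  · have h1 : ‖u g‖ₑ ≤ eLpNorm g p.conjExponent volume * distLpENorm p u := by
      unfold distLpENorm
      simp only [ENNReal.mul_iInf_of_ne h0 hg]
      exact le_iInf fun h => le_iInf fun hh => le_iInf fun hhu => key h hh hhu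
    rw [hu, mul_zero] at h1
    exact le_antisymm h1 zero_le

lemma freqBlock_zero {n : ℕ} (ψ : 𝓓((⊤ : TopologicalSpace.Opens (E n)), ℝ)) :
    freqBlock ψ 0 = 0 := rfl

lemma freqBlock_add {n : ℕ} (ψ : 𝓓((⊤ : TopologicalSpace.Opens (E n)), ℝ)) (f g : ZDual n) :
    freqBlock ψ (f + g) = freqBlock ψ f + freqBlock ψ g := rfl

lemma freqBlock_smul {n : ℕ} (ψ : 𝓓((⊤ : TopologicalSpace.Opens (E n)), ℝ)) (c : ℂ)
    (f : ZDual n) : freqBlock ψ (c • f) = c • freqBlock ψ f := rfl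

/-- A Fourier type distribution all of whose frequency blocks vanish is zero. -/
lemma eq_zero_of_freqBlock_eq_zero {n : ℕ} {I : Type*} {P : I → Set (E n)}
    (hP : IsAdmissibleCovering P) (hPo : ∀ i, IsOpen (P i))
    {ψ : I → 𝓓((⊤ : TopologicalSpace.Opens (E n)), ℝ)} (hψ : IsBAPU P ψ) {f : ZDual n}
    (hf : ∀ i, freqBlock (ψ i) f = 0) : f = 0 := by
  classical
  have h0 : ∀ φ : Test n, f.fourier φ = 0 := by
    intro φ
    obtain ⟨N, hN⟩ := hP.admissible
    have hK : IsCompact (tsupport φ) := φ.hasCompactSupport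
    obtain ⟨J, hJ⟩ := hK.elim_finite_subcover P hPo (by rw [hP.covers]; exact Set.subset_univ _)
    have hfin : (⋃ j ∈ J, {i | (P j ∩ P i).Nonempty}).Finite :=
      J.finite_toSet.biUnion fun j _ =>
        Set.finite_of_encard_le_coe (hN j)
    have hsum : φ = ∑ i ∈ hfin.toFinset, mulTest (ψ i) (testToSchwartz n φ) := by
      ext ξ
      have hev : (∑ i ∈ hfin.toFinset, mulTest (ψ i) (testToSchwartz n φ)) ξ =
          ∑ i ∈ hfin.toFinset, (ψ i ξ : ℂ) * φ ξ := by
        rw [FunLike.coe_sum, Finset.sum_apply]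
        rfl
      rw [hev, ← Finset.sum_mul]
      rcases eq_or_ne (φ ξ) 0 with hz | hz
      · simp [hz]
      have hξ : ξ ∈ ⋃ j ∈ J, P j := hJ (subset_tsupport _ hz)
      obtain ⟨j, hj, hξj⟩ := Set.mem_iUnion₂.1 hξ
      have h1 : ∑ i ∈ hfin.toFinset, ψ i ξ = 1 := by
        refine (hasSum_sum_of_ne_finset_zero fun i hi => ?_).unique (hψ.hasSum_one ξ)
        by_contra hne
        refine hi (hfin.mem_toFinset.2 (Set.mem_iUnion₂.2 ⟨j, hj, ξ, hξj, ?_⟩))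
        exact hψ.tsupport_subset i (subset_tsupport _ hne)
      have h2 : ∑ i ∈ hfin.toFinset, (ψ i ξ : ℂ) = 1 := by exact_mod_cast h1
      rw [h2, one_mul]
    rw [hsum, map_sum]
    refine Finset.sum_eq_zero fun i _ => ?_
    have h3 := LinearMap.congr_fun (hf i) (𝓕 (testToSchwartz n φ))
    change f.fourier (mulTest (ψ i) (𝓕⁻ (𝓕 (testToSchwartz n φ)))) = 0 at h3
    rwa [FourierTransform.fourierInv_fourier_eq] at h3
  ext z
  obtain ⟨φ, rfl⟩ := fourierZ_surjective n z
  exact h0 φ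

section Spaces

variable {n : ℕ} {𝔤 : Type*} [LieRing 𝔤] [LieAlgebra ℝ 𝔤]
  {G : AdmissibleLieGroup n 𝔤} {α : ℝ} {I : Type*}

/-- The (possibly infinite) norm of `M^{s,α}_{p,q}(G)`. -/
def alphaModENorm (d : AlphaModData G α I) (s : ℝ) (p q : ℝ≥0∞) (f : ZDual n) : ℝ≥0∞ :=
  lqENorm q fun i =>
    ENNReal.ofReal ((1 + d.ν (d.ξ i) ^ 2) ^ (s / 2)) * distLpENorm p (freqBlock (d.ψ i) f)

set_option linter.unusedSectionVars false

variable (d : AlphaModData G α I) (s : ℝ) (p q : ℝ≥0∞) [hp : Fact (1 ≤ p)] [hq : Fact (1 ≤ q)]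

lemma alphaModENorm_zero : alphaModENorm d s p q 0 = 0 := by
  have h := lqENorm_const_mul (I := I) hq.out 0 0
  simp only [zero_mul] at h
  simp only [alphaModENorm, freqBlock_zero, distLpENorm_zero, mul_zero]
  exact h

lemma alphaModENorm_add_le (f g : ZDual n) :
    alphaModENorm d s p q (f + g) ≤ alphaModENorm d s p q f + alphaModENorm d s p q g := by
  refine (lqENorm_mono q fun i => ?_).trans (lqENorm_add_le hq.out _ _)
  rw [freqBlock_add, ← mul_add]
  gcongr
  exact distLpENorm_add_le _ _

lemma alphaModENorm_smul_le (c : ℂ) (f : ZDual n) :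
    alphaModENorm d s p q (c • f) ≤ ‖c‖ₑ * alphaModENorm d s p q f := by
  refine (lqENorm_mono q fun i => ?_).trans (lqENorm_const_mul hq.out _ _).le
  rw [freqBlock_smul, mul_left_comm]
  gcongr
  exact distLpENorm_smul_le _ _

lemma alphaModENorm_smul (c : ℂ) (f : ZDual n) :
    alphaModENorm d s p q (c • f) = ‖c‖ₑ * alphaModENorm d s p q f := by
  rcases eq_or_ne c 0 with rfl | hc
  · rw [zero_smul ℂ f, alphaModENorm_zero, enorm_zero, zero_mul]
  refine le_antisymm (alphaModENorm_smul_le d s p q c f) ?_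
  have h := alphaModENorm_smul_le d s p q c⁻¹ (c • f)
  rw [inv_smul_smul₀ hc] at h
  calc ‖c‖ₑ * alphaModENorm d s p q f
      ≤ ‖c‖ₑ * (‖c⁻¹‖ₑ * alphaModENorm d s p q (c • f)) := by gcongr
    _ = alphaModENorm d s p q (c • f) := by
      rw [← mul_assoc, ← enorm_mul, mul_inv_cancel₀ hc, enorm_one, one_mul]

lemma eq_zero_of_alphaModENorm_eq_zero {f : ZDual n} (hf : alphaModENorm d s p q f = 0) :
    f = 0 := by
  refine eq_zero_of_freqBlock_eq_zero d.isAlphaCovering.toIsAdmissibleCovering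
    d.isAlphaCovering.isOpen d.isBAPU fun i => eq_zero_of_distLpENorm_eq_zero (p := p) ?_
  have h := eq_zero_of_lqENorm_eq_zero hq.out hf i
  have hw : ENNReal.ofReal ((1 + d.ν (d.ξ i) ^ 2) ^ (s / 2)) ≠ 0 := by
    rw [Ne, ENNReal.ofReal_eq_zero, not_le]
    positivity
  exact (mul_eq_zero.1 h).resolve_left hw

/-- `M^{s,α}_{p,q}(G)` as a linear subspace of `Z'(ℝⁿ)`. -/
def alphaModSubmodule : Submodule ℂ (ZDual n) where
  carrier := {f | alphaModENorm d s p q f < ∞}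
  zero_mem' := by simp [alphaModENorm_zero]
  add_mem' {f g} hf hg :=
    (alphaModENorm_add_le d s p q f g).trans_lt (ENNReal.add_lt_top.2 ⟨hf, hg⟩)
  smul_mem' c f hf :=
    (alphaModENorm_smul_le d s p q c f).trans_lt (ENNReal.mul_lt_top enorm_lt_top hf)

/-- The generalized `α`-modulation space `M^{s,α}_{p,q}(G)`, with its norm. -/
def AlphaModSpace : Type := alphaModSubmodule d s p q

instance : AddCommGroup (AlphaModSpace d s p q) :=
  inferInstanceAs (AddCommGroup (alphaModSubmodule d s p q))

instance : Module ℂ (AlphaModSpace d s p q) :=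
  inferInstanceAs (Module ℂ (alphaModSubmodule d s p q))

instance : Norm (AlphaModSpace d s p q) where
  norm f := (alphaModENorm d s p q f.1).toReal

lemma alphaMod_core : NormedSpace.Core ℂ (AlphaModSpace d s p q) where
  norm_nonneg _ := ENNReal.toReal_nonneg
  norm_smul c f := by
    change (alphaModENorm d s p q (c • f.1)).toReal = _ * (alphaModENorm d s p q f.1).toReal
    rw [alphaModENorm_smul, ENNReal.toReal_mul, toReal_enorm]
  norm_triangle f g := by
    change (alphaModENorm d s p q (f.1 + g.1)).toReal ≤ _
    refine (ENNReal.toReal_mono ?_ (alphaModENorm_add_le d s p q f.1 g.1)).trans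
      ENNReal.toReal_add_le
    exact (ENNReal.add_lt_top.2 ⟨f.2, g.2⟩).ne
  norm_eq_zero_iff f := by
    constructor
    · intro h
      refine Subtype.ext (eq_zero_of_alphaModENorm_eq_zero d s p q ?_)
      exact ((ENNReal.toReal_eq_zero_iff _).1 h).resolve_right (ne_of_lt f.2)
    · rintro rfl
      change (alphaModENorm d s p q 0).toReal = 0
      rw [alphaModENorm_zero, ENNReal.toReal_zero]

instance : NormedAddCommGroup (AlphaModSpace d s p q) :=
  NormedAddCommGroup.ofCore (alphaMod_core d s p q)

instance : NormedSpace ℂ (AlphaModSpace d s p q) :=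
  NormedSpace.ofCore (alphaMod_core d s p q)

end Spaces

end GenAlphaMod

end

open GenAlphaMod

/-! An element `f` is recovered from its frequency blocks `𝓕⁻¹(ψ_i 𝓕f)`, and its norm is a weighted
`ℓ^q(L^p)` norm of them. The duality therefore reduces to those of `L^p` and `ℓ^q`, once the
multipliers are known to be uniformly bounded on `L^p` and each set of one covering to meet
boundedly many sets of the other, with comparable weights.

Geometry. In step at most two, left translations are affine with unipotent linear part, hence
preserve Lebesgue measure, and `D_r` multiplies it by `r ^ Q`. So a ball of radius `R` has volume
proportional to `R ^ Q`, and `P_i` lies in a ball of radius `≲ |P_i| ^ (1/Q) ≲ (1 + ν²) ^ (α/2)`. As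
`α ≤ 1`, the quasi-triangle inequality shows that `1 + ν²` is essentially constant on `P_i`. Any two
quasi-norms are comparable, so weights and volumes of intersecting sets of two coverings are
comparable, and a packing argument bounds the number of intersections (`exists_encard_le`). This is
why all choices may differ between the two spaces.

Analysis. Young's inequality bounds the multipliers (`distLpENorm_comp_freqMult_le`). Together with
Schur's test it gives the synthesis estimate `exists_alphaModENorm_le_of_freqBlock_eq`: if `f` is
the sum of multipliers applied to pieces `u_j`, its norm is controlled by the weighted `ℓ^q(L^p)`
norm of `(u_j)`. Consequences for `p, q < ∞` are the membership and the density of the functions of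
`Z`.

Duality. Inserting both partitions of unity and using Hölder's inequality in `L^p` and in `ℓ^q`
bounds the pairing (`exists_enorm_fourier_conjTest_le`). Conversely, a bounded functional `ℓ`
defines an element `f` of `Z'` by its values on test functions. Choosing for each block of `f` an
almost norming function, combining finitely many of them and applying `ℓ` to the synthesized
function, the converse of Hölder's inequality gives `‖f‖ ≲ ‖ℓ‖` (`exists_alphaModENorm_le_opENorm`).
Synthesis is only used for the finite exponents `p, q`, so `p' = ∞` or `q' = ∞` causes no trouble.
By density, `ℓ` is the functional attached to `f`. -/

noncomputable section

namespace GenAlphaMod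

open Filter Topology

/-! ### The dual of `L^p` -/

section LpDual

variable {α : Type*} [MeasurableSpace α] {μ : Measure α} {p p' : ℝ≥0∞}

/-- A positive integrable function truncated at `1` dominates its own `p`-th power because `p ≥ 1`.
The resulting weight replaces the constant `1` of a finite measure space: functions dominated by a
multiple of it play the role of bounded functions. -/
lemma exists_pos_memLp [SigmaFinite μ] (h1 : 1 ≤ p) (hp : p ≠ ∞) :
    ∃ G : α → ℝ, Measurable G ∧ (∀ x, 0 < G x) ∧ MemLp G p μ := by
  obtain ⟨g, hg0, hgm, hgi⟩ := exists_pos_lintegral_lt_of_sigmaFinite μ one_ne_zero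
  have hm : Measurable fun x => min (g x : ℝ) 1 := (hgm.coe_nnreal_real).min measurable_const
  have hpos : ∀ x, 0 < min (g x : ℝ) 1 := fun x => lt_min (by exact_mod_cast hg0 x) one_pos
  refine ⟨fun x => min (g x : ℝ) 1, hm, hpos, ?_⟩
  have hp0 : p ≠ 0 := (zero_lt_one.trans_le h1).ne'
  have hpr : 1 ≤ p.toReal := by simpa using ENNReal.toReal_mono hp h1
  rw [← integrable_norm_rpow_iff hm.aestronglyMeasurable hp0 hp]
  have hgint : Integrable (fun x => (g x : ℝ)) μ := by
    refine ⟨hgm.coe_nnreal_real.aestronglyMeasurable, ?_⟩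
    simpa [HasFiniteIntegral] using hgi.trans ENNReal.one_lt_top
  refine hgint.mono' (hm.norm.pow_const _).aestronglyMeasurable (.of_forall fun x => ?_)
  rw [Real.norm_of_nonneg (by positivity), Real.norm_of_nonneg (hpos x).le]
  calc (min (g x : ℝ) 1) ^ p.toReal ≤ (min (g x : ℝ) 1) ^ (1 : ℝ) :=
        Real.rpow_le_rpow_of_exponent_ge (hpos x) (min_le_right _ _) hpr
    _ ≤ g x := by rw [Real.rpow_one]; exact min_le_left _ _

lemma tendsto_eLpNorm_sub_of_dominated {F : Type*} [NormedAddCommGroup F]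
    (h1 : 1 ≤ p) (hp : p ≠ ∞) {u : ℕ → α → F} {f : α → F} {g : α → ℝ}
    (hu : ∀ k, AEStronglyMeasurable (u k) μ) (hf : AEStronglyMeasurable f μ) (hg : MemLp g p μ)
    (hug : ∀ k, ∀ᵐ x ∂μ, ‖u k x‖ ≤ g x) (hfg : ∀ᵐ x ∂μ, ‖f x‖ ≤ g x)
    (hlim : ∀ᵐ x ∂μ, Tendsto (fun k => u k x) atTop (𝓝 (f x))) :
    Tendsto (fun k => eLpNorm (u k - f) p μ) atTop (𝓝 0) := by
  have hp0 : p ≠ 0 := (zero_lt_one.trans_le h1).ne'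
  have hpr : 0 < p.toReal := ENNReal.toReal_pos hp0 hp
  simp_rw [eLpNorm_eq_lintegral_rpow_enorm_toReal hp0 hp]
  have key : Tendsto (fun k => ∫⁻ x, ‖(u k - f) x‖ₑ ^ p.toReal ∂μ) atTop
      (𝓝 (∫⁻ _, 0 ∂μ)) := by
    refine tendsto_lintegral_of_dominated_convergence' (fun x => ‖2 * g x‖ₑ ^ p.toReal)
      (fun k => ((hu k).sub hf).enorm.pow_const _) (fun k => ?_) ?_ ?_
    · filter_upwards [hug k, hfg] with x h1 h2
      gcongr
      rw [enorm_le_iff_norm_le, Pi.sub_apply, Real.norm_eq_abs]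
      refine (norm_sub_le _ _).trans (le_trans ?_ (le_abs_self _))
      linarith
    · exact (lintegral_rpow_enorm_lt_top_of_eLpNorm_lt_top hp0 hp (hg.const_mul 2).2).ne
    · filter_upwards [hlim] with x hx
      have h3 : Tendsto (fun k => ‖u k x - f x‖ₑ) atTop (𝓝 0) := by
        have := (hx.sub_const (f x)).enorm
        simpa using this
      have := (ENNReal.continuous_rpow_const (y := p.toReal)).tendsto 0 |>.comp h3
      simpa [Function.comp_def, hpr] using this
  rw [lintegral_zero] at key
  have := (ENNReal.continuous_rpow_const (y := 1 / p.toReal)).tendsto 0 |>.comp key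
  simpa [Function.comp_def, hpr] using this

/-- The complex measure `A ↦ L (A.indicator G)` attached to a functional `L` on `L^p`. -/
def functionalMeasure [Fact (1 ≤ p)] (hp : p ≠ ∞) (L : Lp ℂ p μ →L[ℂ] ℂ) {G : α → ℂ}
    (hG : MemLp G p μ) : ComplexMeasure α := by
  classical exact
  { measureOf' := fun A => if hA : MeasurableSet A then L ((hG.indicator hA).toLp) else 0
    empty' := by
      rw [dif_pos MeasurableSet.empty]
      convert map_zero L
      rw [Lp.eq_zero_iff_ae_eq_zero]
      exact (hG.indicator MeasurableSet.empty).coeFn_toLp.trans (by simp; rfl)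
    not_measurable' := fun A hA => dif_neg hA
    m_iUnion' := by
      intro A hA hd
      have h1 : (1 : ℝ≥0∞) ≤ p := Fact.out
      have hp0 : p ≠ 0 := (zero_lt_one.trans_le h1).ne'
      have hpr : 0 < p.toReal := ENNReal.toReal_pos hp0 hp
      simp_rw [dif_pos (hA _), dif_pos (MeasurableSet.iUnion hA)]
      -- The measure `ρ` is finite and `‖1_B G‖_p = ρ(B) ^ (1/p)`. The remainder of the series in
      -- `L^p` is thus a power of the tail of a convergent numerical series, which gives countable
      -- additivity.
      set ρ : Measure α := μ.withDensity fun x => ‖G x‖ₑ ^ p.toReal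
      have hρ : ∀ B, MeasurableSet B →
          eLpNorm (B.indicator G) p μ = (ρ B) ^ (1 / p.toReal) := by
        intro B hB
        rw [eLpNorm_indicator_eq_eLpNorm_restrict hB,
          eLpNorm_eq_lintegral_rpow_enorm_toReal hp0 hp, withDensity_apply _ hB]
      have hρt : ∑' i, ρ (A i) ≠ ∞ := by
        rw [← measure_iUnion hd hA]
        refine ((measure_mono (Set.subset_univ _)).trans_lt ?_).ne
        rw [withDensity_apply _ MeasurableSet.univ, Measure.restrict_univ]
        exact lintegral_rpow_enorm_lt_top_of_eLpNorm_lt_top hp0 hp hG.2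
      have hsum : HasSum (fun i => (hG.indicator (hA i)).toLp)
          ((hG.indicator (MeasurableSet.iUnion hA)).toLp) := by
        rw [HasSum, SummationFilter.unconditional_filter, Lp.tendsto_Lp_iff_tendsto_eLpNorm]
        have htail := (ENNReal.continuous_rpow_const (y := 1 / p.toReal)).tendsto 0 |>.comp
          (ENNReal.tendsto_tsum_compl_atTop_zero hρt)
        rw [ENNReal.zero_rpow_of_pos (by positivity)] at htail
        refine htail.congr fun s => ?_
        have hms : MeasurableSet (⋃ i : {i // i ∉ s}, A i) :=
          MeasurableSet.iUnion fun i => hA i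
        simp only [Function.comp_apply]
        have hdisj : Pairwise (Function.onFun Disjoint fun i : {i // i ∉ s} => A i) :=
          fun i j hij => hd fun h => hij (Subtype.ext h)
        rw [← measure_iUnion hdisj fun i => hA i, ← hρ _ hms, ← eLpNorm_neg]
        refine eLpNorm_congr_ae ?_
        have h2 : ⇑(∑ i ∈ s, (hG.indicator (hA i)).toLp) =ᵐ[μ]
            fun x => ∑ i ∈ s, (A i).indicator G x := by
          refine (Lp.coeFn_finsetSum _ _).trans ?_
          have : ∀ i ∈ s, ∀ᵐ x ∂μ, (hG.indicator (hA i)).toLp ((A i).indicator G) x =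
              (A i).indicator G x :=
            fun i _ => (hG.indicator (hA i)).coeFn_toLp
          filter_upwards [(ae_ball_iff s.countable_toSet).2 this] with x hx
          rw [Finset.sum_apply]
          exact Finset.sum_congr rfl hx
        filter_upwards [h2] with x hx
        simp only [Pi.neg_apply, Pi.sub_apply, hx]
        by_cases hxU : x ∈ ⋃ i, A i
        · obtain ⟨j, hj⟩ := Set.mem_iUnion.1 hxU
          have hne : ∀ i, i ≠ j → x ∉ A i := fun i hij hi =>
            Set.disjoint_left.1 (hd hij) hi hj
          rw [Set.indicator_of_mem hxU]
          by_cases hjs : j ∈ s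
          · rw [Finset.sum_eq_single_of_mem j hjs fun i _ hij =>
              Set.indicator_of_notMem (hne i hij) _, Set.indicator_of_mem hj,
              Set.indicator_of_notMem]
            · simp
            · rintro hx
              obtain ⟨i, hi⟩ := Set.mem_iUnion.1 hx
              exact hne i (fun h => i.2 (h ▸ hjs)) hi
          · rw [Finset.sum_eq_zero fun i hi =>
              Set.indicator_of_notMem (hne i (fun h => hjs (h ▸ hi))) _,
              Set.indicator_of_mem (Set.mem_iUnion.2 ⟨⟨j, hjs⟩, hj⟩)]
            simp
        · have hne : ∀ i, x ∉ A i := fun i hi => hxU (Set.mem_iUnion.2 ⟨i, hi⟩)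
          rw [Set.indicator_of_notMem hxU, Finset.sum_eq_zero fun i _ =>
            Set.indicator_of_notMem (hne i) _, Set.indicator_of_notMem]
          · simp
          · rintro hx
            obtain ⟨i, hi⟩ := Set.mem_iUnion.1 hx
            exact hne i hi
      exact hsum.mapL L }

lemma functionalMeasure_apply [Fact (1 ≤ p)] (hp : p ≠ ∞) (L : Lp ℂ p μ →L[ℂ] ℂ) {G : α → ℂ}
    (hG : MemLp G p μ) {A : Set α} (hA : MeasurableSet A) :
    functionalMeasure hp L hG A = L ((hG.indicator hA).toLp) := dif_pos hA

/-- Radon–Nikodym, applied to the real and imaginary parts of the complex measure: it is absolutely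
continuous because `1_A G` is zero in `L^p` when `A` is null. -/
lemma exists_integrable_functional_eq [SigmaFinite μ] [Fact (1 ≤ p)] (hp : p ≠ ∞)
    (L : Lp ℂ p μ →L[ℂ] ℂ) {G : α → ℂ} (hG : MemLp G p μ) :
    ∃ h : α → ℂ, Measurable h ∧ Integrable h μ ∧
      ∀ (A : Set α) (hA : MeasurableSet A), L ((hG.indicator hA).toLp) = ∫ x in A, h x ∂μ := by
  set c := functionalMeasure hp L hG
  have hc : c ≪ᵥ μ.toENNRealVectorMeasure := by
    refine VectorMeasure.AbsolutelyContinuous.mk fun A hA h0 => ?_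
    rw [Measure.toENNRealVectorMeasure_apply_measurable hA] at h0
    rw [functionalMeasure_apply hp L hG hA]
    convert map_zero L
    rw [Lp.eq_zero_iff_ae_eq_zero]
    refine (hG.indicator hA).coeFn_toLp.trans ?_
    exact indicator_meas_zero h0
  obtain ⟨hre, him⟩ := (ComplexMeasure.absolutelyContinuous_ennreal_iff c _).1 hc
  have h1 := SignedMeasure.withDensityᵥ_rnDeriv_eq _ μ hre
  have h2 := SignedMeasure.withDensityᵥ_rnDeriv_eq _ μ him
  have i1 := SignedMeasure.integrable_rnDeriv (ComplexMeasure.re c) μ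
  have i2 := SignedMeasure.integrable_rnDeriv (ComplexMeasure.im c) μ
  refine ⟨fun x => (SignedMeasure.rnDeriv (ComplexMeasure.re c) μ x : ℂ) +
    (SignedMeasure.rnDeriv (ComplexMeasure.im c) μ x : ℂ) * Complex.I,
    ((SignedMeasure.measurable_rnDeriv _ _).complex_ofReal).add
      ((SignedMeasure.measurable_rnDeriv _ _).complex_ofReal.mul_const _),
    i1.ofReal.add (i2.ofReal.mul_const _), fun A hA => ?_⟩
  have j1 : Integrable (fun x => (SignedMeasure.rnDeriv (ComplexMeasure.re c) μ x : ℂ))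
    (μ.restrict A) := i1.ofReal.restrict
  have j2 : Integrable (fun x => (SignedMeasure.rnDeriv (ComplexMeasure.im c) μ x : ℂ))
    (μ.restrict A) := i2.ofReal.restrict
  rw [integral_add j1 (j2.mul_const _), integral_mul_const, integral_complex_ofReal,
    integral_complex_ofReal,
    ← withDensityᵥ_apply i1 hA, ← withDensityᵥ_apply i2 hA, h1, h2,
    ← functionalMeasure_apply hp L hG hA]
  exact (Complex.re_add_im (c A)).symm

/-- The quotient `F / G` is bounded, hence a pointwise limit of simple functions with the same
bound. For simple functions times `G` the formula is linearity; both sides pass to the limit by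
dominated convergence, in `L^p` with majorant `c G` and in `L^1` with majorant `c |h|`. -/
lemma functional_eq_integral_of_norm_le [Fact (1 ≤ p)] (hp : p ≠ ∞)
    (L : Lp ℂ p μ →L[ℂ] ℂ) {G : α → ℝ} (hGm : Measurable G) (hG0 : ∀ x, 0 < G x)
    (hG : MemLp (fun x => (G x : ℂ)) p μ) {h : α → ℂ} (hi : Integrable h μ)
    (hL : ∀ (A : Set α) (hA : MeasurableSet A),
      L ((hG.indicator hA).toLp) = ∫ x in A, h x ∂μ)
    {F : α → ℂ} (hFm : Measurable F) {c : ℝ} (hc : 0 ≤ c) (hF : ∀ x, ‖F x‖ ≤ c * G x)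
    (hFp : MemLp F p μ) : L hFp.toLp = ∫ x, h x / G x * F x ∂μ := by
  have hsim : ∀ (s : SimpleFunc α ℂ) (hs : MemLp (fun x => s x * (G x : ℂ)) p μ),
      L hs.toLp = ∫ x, h x * s x ∂μ := by
    intro s
    induction s using SimpleFunc.induction with
    | const c hA =>
      rename_i A
      intro hs
      have e1 : hs.toLp = c • (hG.indicator hA).toLp := by
        rw [← MemLp.toLp_const_smul]
        refine MemLp.toLp_congr _ _ (.of_forall fun x => ?_)
        by_cases hx : x ∈ A <;> simp [hx]
      rw [e1, map_smul, hL A hA, smul_eq_mul, ← integral_const_mul, ← integral_indicator hA]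
      refine integral_congr_ae (.of_forall fun x => ?_)
      by_cases hx : x ∈ A <;> simp [hx, mul_comm]
    | add hd hf hg =>
      rename_i f g
      intro hs
      have hbd : ∀ t : SimpleFunc α ℂ, ∃ C, ∀ x, ‖t x‖ ≤ C := fun t =>
        SimpleFunc.exists_forall_norm_le t
      have hm : ∀ t : SimpleFunc α ℂ, MemLp (fun x => t x * (G x : ℂ)) p μ := by
        intro t
        obtain ⟨C, hC⟩ := hbd t
        refine (hG.const_mul (C : ℂ)).mono
          (t.measurable.mul hGm.complex_ofReal).aestronglyMeasurable
          (.of_forall fun x => ?_)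
        rw [norm_mul, norm_mul]
        gcongr
        exact (hC x).trans (by simpa using le_abs_self C)
      have hti : ∀ t : SimpleFunc α ℂ, Integrable (fun x => h x * t x) μ := by
        intro t
        obtain ⟨C, hC⟩ := hbd t
        exact hi.mul_bdd t.measurable.aestronglyMeasurable (.of_forall hC)
      have e1 : hs.toLp = (hm f).toLp + (hm g).toLp := by
        rw [← MemLp.toLp_add]
        refine MemLp.toLp_congr _ _ (.of_forall fun x => ?_)
        simp [add_mul]
      rw [e1, map_add, hf, hg, ← integral_add (hti f) (hti g)]
      refine integral_congr_ae (.of_forall fun x => ?_)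
      simp [mul_add]
  have hfm : StronglyMeasurable fun x => F x / (G x : ℂ) :=
    (hFm.div hGm.complex_ofReal).stronglyMeasurable
  have hfb : ∀ x, ‖F x / (G x : ℂ)‖ ≤ c := by
    intro x
    rw [norm_div, Complex.norm_of_nonneg (hG0 x).le, div_le_iff₀ (hG0 x)]
    exact hF x
  set t := hfm.approxBounded c
  have htb : ∀ k x, ‖t k x‖ ≤ c := hfm.norm_approxBounded_le hc
  have htl : ∀ x, Tendsto (fun k => t k x) atTop (𝓝 (F x / (G x : ℂ))) := fun x =>
    hfm.tendsto_approxBounded_of_norm_le (hfb x)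
  have htG : ∀ k x, ‖t k x * (G x : ℂ)‖ ≤ c * G x := by
    intro k x
    rw [norm_mul, Complex.norm_of_nonneg (hG0 x).le]
    exact mul_le_mul_of_nonneg_right (htb k x) (hG0 x).le
  have hGr : MemLp G p μ := hG.re
  have hmk : ∀ k, MemLp (fun x => t k x * (G x : ℂ)) p μ := fun k =>
    (hGr.const_mul c).mono' ((t k).measurable.mul hGm.complex_ofReal).aestronglyMeasurable
      (.of_forall (htG k))
  have hl1 : Tendsto (fun k => L (hmk k).toLp) atTop (𝓝 (L hFp.toLp)) := by
    refine (L.continuous.tendsto _).comp ?_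
    rw [Lp.tendsto_Lp_iff_tendsto_eLpNorm'']
    refine tendsto_eLpNorm_sub_of_dominated Fact.out hp (fun k => (hmk k).1) hFp.1
      (hGr.const_mul c) (fun k => .of_forall (htG k)) (.of_forall hF) (.of_forall fun x => ?_)
    have := (htl x).mul_const (G x : ℂ)
    rwa [div_mul_cancel₀ _ (by exact_mod_cast (hG0 x).ne')] at this
  have hl2 : Tendsto (fun k => ∫ x, h x * t k x ∂μ) atTop (𝓝 (∫ x, h x / G x * F x ∂μ)) := by
    refine tendsto_integral_of_dominated_convergence (fun x => ‖h x‖ * c)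
      (fun k => hi.1.mul (t k).measurable.aestronglyMeasurable) (hi.norm.mul_const c)
      (fun k => .of_forall fun x => ?_) (.of_forall fun x => ?_)
    · rw [norm_mul]
      gcongr
      exact htb k x
    · rw [div_mul_eq_mul_div, mul_div_assoc]
      exact (htl x).const_mul _
  refine tendsto_nhds_unique hl1 (hl2.congr fun k => (hsim (t k) (hmk k)).symm)

/-- The converse of Hölder's inequality, tested on functions dominated by a positive `G`. -/
lemma eLpNorm_le_of_forall_integral_mul_le [hpp : p.HolderConjugate p'] (h1 : 1 ≤ p) (hp : p ≠ ∞)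
    {G : α → ℝ} (hGm : Measurable G) (hG0 : ∀ x, 0 < G x)
    (hG : MemLp (fun x => (G x : ℂ)) p μ) {h : α → ℂ} (hm : Measurable h)
    (hi : Integrable (fun x => h x * G x) μ) {C : ℝ≥0∞} (hC : C ≠ ∞)
    (hb : ∀ F : α → ℂ, Measurable F → (∃ c, 0 ≤ c ∧ ∀ x, ‖F x‖ ≤ c * G x) →
      ‖∫ x, h x * F x ∂μ‖ₑ ≤ C * eLpNorm F p μ) :
    eLpNorm h p' μ ≤ C := by
  have hp0 : p ≠ 0 := (zero_lt_one.trans_le h1).ne'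
  have hpr : 0 < p.toReal := ENNReal.toReal_pos hp0 hp
  -- On `A k` the function `h` is bounded and `G` is bounded below, so that truncating to `A k`
  -- makes the extremal functions of Hölder's inequality admissible tests.
  set A : ℕ → Set α := fun k => {x | ‖h x‖ ≤ k ∧ 1 ≤ (k + 1) * G x}
  have hA : ∀ k, MeasurableSet (A k) := fun k =>
    (measurableSet_le hm.norm measurable_const).inter
      (measurableSet_le measurable_const (hGm.const_mul _))
  have hAmono : Monotone A := by
    intro j k hjk x hx
    have hjk' : (j : ℝ) ≤ k := by exact_mod_cast hjk
    have hx2 := hx.2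
    have := (hG0 x).le
    exact ⟨hx.1.trans hjk', hx2.trans (by gcongr)⟩
  have hAU : ⋃ k, A k = Set.univ := by
    refine Set.eq_univ_of_forall fun x => Set.mem_iUnion.2 ?_
    obtain ⟨k, hk⟩ := exists_nat_ge (max ‖h x‖ (1 / G x))
    refine ⟨k, (le_max_left _ _).trans hk, ?_⟩
    have := (le_max_right _ _).trans hk
    rw [div_le_iff₀ (hG0 x)] at this
    linarith [hG0 x]
  have hint : ∀ F : α → ℂ, Measurable F → (∃ c, 0 ≤ c ∧ ∀ x, ‖F x‖ ≤ c * G x) →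
      Integrable (fun x => h x * F x) μ := by
    rintro F hF ⟨c, -, hc⟩
    refine (hi.norm.const_mul c).mono' (hm.mul hF).aestronglyMeasurable (.of_forall fun x => ?_)
    rw [norm_mul, norm_mul, Complex.norm_of_nonneg (hG0 x).le]
    nlinarith [mul_le_mul_of_nonneg_left (hc x) (norm_nonneg (h x))]
  -- A test function `F` that makes `h F` a nonnegative `g` turns the hypothesis into a bound on `∫
  -- g`, finite because `h F` is integrable.
  have hval : ∀ (F : α → ℂ) (g : α → ℝ), Measurable F → (∃ c, 0 ≤ c ∧ ∀ x, ‖F x‖ ≤ c * G x) →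
      (∀ x, 0 ≤ g x) → (∀ x, h x * F x = g x) →
      ∫⁻ x, ENNReal.ofReal (g x) ∂μ ≤ C * eLpNorm F p μ ∧ ∫⁻ x, ENNReal.ofReal (g x) ∂μ ≠ ∞ := by
    intro F g hF hc hg hFg
    have h3 := hint F hF hc
    simp_rw [hFg] at h3
    have h4 : Integrable g μ := by simpa using h3.re
    have h5 : ∫⁻ x, ENNReal.ofReal (g x) ∂μ = ‖∫ x, h x * F x ∂μ‖ₑ := by
      simp_rw [hFg]
      rw [integral_complex_ofReal, ← ofReal_integral_eq_lintegral_ofReal h4 (.of_forall hg),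
        ← ofReal_norm, Complex.norm_of_nonneg (integral_nonneg hg)]
    exact ⟨h5 ▸ hb F hF hc, h5 ▸ enorm_ne_top⟩
  rcases eq_or_ne p' ∞ with hp' | hp'
  · subst hp'
    have hp1 : p = 1 := by
      have := hpp.inv_add_inv_eq_inv
      simpa using this
    subst hp1
    rw [eLpNorm_exponent_top]
    refine essSup_le_of_ae_le _ ?_
    -- Test with the phase `conj h / |h|` on the part of `{|h| > C}` in `A k`: positive measure
    -- would give `C μ(B) < ∫_B |h| ≤ C μ(B)`.
    have hB : ∀ k, μ ({x | C < ‖h x‖ₑ} ∩ A k) = 0 := by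
      intro k
      set B := {x | C < ‖h x‖ₑ} ∩ A k
      have hBm : MeasurableSet B := (measurableSet_lt measurable_const hm.enorm).inter (hA k)
      have hFm : Measurable (B.indicator fun x => conj (h x) / (‖h x‖ : ℂ)) :=
        ((Complex.continuous_conj.measurable.comp hm).div
          hm.norm.complex_ofReal).indicator hBm
      have hF1 : ∀ x, ‖B.indicator (fun x => conj (h x) / (‖h x‖ : ℂ)) x‖ ≤
          B.indicator (fun _ => (1 : ℝ)) x := by
        intro x
        by_cases hx : x ∈ B
        · simp only [Set.indicator_of_mem hx, norm_div, RCLike.norm_conj, Complex.norm_real,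
            norm_norm]
          exact div_self_le_one _
        · simp [hx]
      have hBG : ∀ x, B.indicator (fun _ => (1 : ℝ)) x ≤ (k + 1) * G x := by
        intro x
        by_cases hx : x ∈ B
        · simpa [Set.indicator_of_mem hx] using hx.2.2
        · rw [Set.indicator_of_notMem hx]
          have := hG0 x
          positivity
      obtain ⟨h6, h7⟩ := hval _ (B.indicator fun x => ‖h x‖) hFm
        ⟨k + 1, by positivity, fun x => (hF1 x).trans (hBG x)⟩
        (fun x => Set.indicator_nonneg (fun _ _ => norm_nonneg _) x) (fun x => by
          by_cases hx : x ∈ B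
          · have hne : (‖h x‖ : ℂ) ≠ 0 := by
              have : h x ≠ 0 := by
                rintro h0
                have := hx.1
                simp [h0] at this
              simpa using this
            simp only [Set.indicator_of_mem hx]
            rw [mul_div_assoc', Complex.mul_conj']
            field_simp
          · simp [hx])
      have h8 : ∫⁻ x, ENNReal.ofReal (B.indicator (fun x => ‖h x‖) x) ∂μ =
          ∫⁻ x in B, ‖h x‖ₑ ∂μ := by
        rw [← lintegral_indicator hBm]
        refine lintegral_congr fun x => ?_
        by_cases hx : x ∈ B <;> simp [hx]
      have h9 : eLpNorm (B.indicator fun x => conj (h x) / (‖h x‖ : ℂ)) 1 μ ≤ μ B := by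
        refine (eLpNorm_mono_real hF1).trans ?_
        rw [eLpNorm_indicator_const hBm one_ne_zero ENNReal.one_ne_top]
        simp
      rw [h8] at h6 h7
      by_contra hne
      have h10 : ∫⁻ x in B, C ∂μ < ∫⁻ x in B, ‖h x‖ₑ ∂μ := by
        refine setLIntegral_strict_mono hBm hne hm.enorm ?_ (.of_forall fun x hx => hx.1)
        rw [setLIntegral_const]
        refine ENNReal.mul_ne_top hC fun htop => ?_
        have h11 : MemLp (B.indicator fun _ => (1 : ℝ)) 1 μ :=
          (hG.re.const_mul (k + 1 : ℝ)).mono' (aestronglyMeasurable_const.indicator hBm)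
            (.of_forall fun x => by
              rw [Real.norm_of_nonneg (Set.indicator_nonneg (fun _ _ => zero_le_one) x)]
              exact hBG x)
        have h12 := h11.2
        rw [eLpNorm_indicator_const hBm one_ne_zero ENNReal.one_ne_top] at h12
        simp [htop] at h12
      rw [setLIntegral_const] at h10
      exact absurd (h6.trans (by gcongr)) h10.not_ge
    have h13 : μ {x | C < ‖h x‖ₑ} = 0 := by
      have : {x | C < ‖h x‖ₑ} = ⋃ k, ({x | C < ‖h x‖ₑ} ∩ A k) := by
        rw [← Set.inter_iUnion, hAU, Set.inter_univ]
      rw [this, measure_iUnion_null_iff]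
      exact hB
    rw [EventuallyLE, ae_iff]
    simpa using h13
  · have hpq : p.toReal.HolderConjugate p'.toReal :=
      hpp.toReal_of_ne_top hp hp'
    set r := p'.toReal
    have hr1 : 1 < r := hpq.symm.lt
    have hp'0 : p' ≠ 0 := hpp.symm.ne_zero
    rw [eLpNorm_eq_lintegral_rpow_enorm_toReal hp'0 hp']
    change (∫⁻ x, ‖h x‖ₑ ^ r ∂μ) ^ (1 / r) ≤ C
    have hX : ∀ k, (∫⁻ x in A k, ‖h x‖ₑ ^ r ∂μ) ≤ C ^ r := by
      intro k
      -- The equality case of Hölder's inequality: `h F = |h| ^ r` and `|F| ^ p = |h| ^ r` on `A k`.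
      -- With `X` the integral of `|h| ^ r` over `A k`, this yields `X ≤ C X ^ (1/p)`, and `X`,
      -- being finite, can be divided out.
      set F : α → ℂ := (A k).indicator fun x => conj (h x) * ((‖h x‖ ^ (r - 2) : ℝ) : ℂ)
      have hFm : Measurable F :=
        ((Complex.continuous_conj.measurable.comp hm).mul
          (hm.norm.pow_const _).complex_ofReal).indicator (hA k)
      have hnorm : ∀ x, ‖conj (h x) * ((‖h x‖ ^ (r - 2) : ℝ) : ℂ)‖ = ‖h x‖ ^ (r - 1) := by
        intro x
        rw [norm_mul, RCLike.norm_conj, Complex.norm_of_nonneg (by positivity)]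
        rcases eq_or_lt_of_le (norm_nonneg (h x)) with h0 | h0
        · rw [← h0, zero_mul, Real.zero_rpow (by linarith)]
        · rw [← Real.rpow_one_add' h0.le (by linarith)]
          congr 1; ring
      have hFb : ∀ x, ‖F x‖ ≤ ((k : ℝ) ^ (r - 1) * (k + 1)) * G x := by
        intro x
        have := hG0 x
        by_cases hx : x ∈ A k
        · simp only [F]
          rw [Set.indicator_of_mem hx, hnorm]
          calc ‖h x‖ ^ (r - 1) ≤ (k : ℝ) ^ (r - 1) * 1 := by
                rw [mul_one]
                exact Real.rpow_le_rpow (norm_nonneg _) hx.1 (by linarith)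
            _ ≤ (k : ℝ) ^ (r - 1) * ((k + 1) * G x) := by
                gcongr
                exact hx.2
            _ = _ := by ring
        · simp only [F]
          rw [Set.indicator_of_notMem hx, norm_zero]
          positivity
      obtain ⟨h6, h7⟩ := hval F ((A k).indicator fun x => ‖h x‖ ^ r) hFm
        ⟨_, by positivity, hFb⟩
        (fun x => Set.indicator_nonneg (fun _ _ => by positivity) x) (fun x => by
          by_cases hx : x ∈ A k
          · simp only [F, Set.indicator_of_mem hx]
            rw [← mul_assoc, Complex.mul_conj', ← Complex.ofReal_pow, ← Complex.ofReal_mul]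
            congr 1
            rcases eq_or_lt_of_le (norm_nonneg (h x)) with h0 | h0
            · rw [← h0, Real.zero_rpow (by linarith : r ≠ 0)]
              simp
            · rw [← Real.rpow_natCast, ← Real.rpow_add h0]
              congr 1; push_cast; ring
          · simp [F, hx])
      have h8 : ∫⁻ x, ENNReal.ofReal ((A k).indicator (fun x => ‖h x‖ ^ r) x) ∂μ =
          ∫⁻ x in A k, ‖h x‖ₑ ^ r ∂μ := by
        rw [← lintegral_indicator (hA k)]
        refine lintegral_congr fun x => ?_
        by_cases hx : x ∈ A k
        · simp only [Set.indicator_of_mem hx]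
          rw [← ENNReal.ofReal_rpow_of_nonneg (norm_nonneg _) (by linarith),
            ofReal_norm]
        · simp [hx]
      have h9 : eLpNorm F p μ = (∫⁻ x in A k, ‖h x‖ₑ ^ r ∂μ) ^ (1 / p.toReal) := by
        rw [eLpNorm_indicator_eq_eLpNorm_restrict (hA k),
          eLpNorm_eq_lintegral_rpow_enorm_toReal hp0 hp]
        congr 1
        refine lintegral_congr fun x => ?_
        rw [← ofReal_norm, hnorm,
          ← ENNReal.ofReal_rpow_of_nonneg (norm_nonneg _) (by linarith), ofReal_norm,
          ← ENNReal.rpow_mul]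
        congr 1
        have := hpq.symm.sub_one_mul_conj
        linarith
      rw [h8, h9] at h6
      rw [h8] at h7
      set X := ∫⁻ x in A k, ‖h x‖ₑ ^ r ∂μ
      rcases eq_or_ne X 0 with hX0 | hX0
      · rw [hX0]; exact zero_le
      have h10 : X ^ (1 / r) ≤ C := by
        have e1 : X ^ (1 / r) = X * (X ^ (1 / p.toReal))⁻¹ := by
          rw [← ENNReal.rpow_neg]
          nth_rewrite 2 [← ENNReal.rpow_one X]
          rw [← ENNReal.rpow_add _ _ hX0 h7]
          congr 1
          have := hpq.inv_add_inv_eq_one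
          rw [one_div, one_div]
          linarith
        rw [e1]
        have hne : X ^ (1 / p.toReal) ≠ 0 := by
          simp [ENNReal.rpow_eq_zero_iff, hX0, h7]
        have hnt : X ^ (1 / p.toReal) ≠ ∞ := by
          simp [ENNReal.rpow_eq_top_iff, hX0, h7]
        calc X * (X ^ (1 / p.toReal))⁻¹ ≤ C * X ^ (1 / p.toReal) * (X ^ (1 / p.toReal))⁻¹ := by
              gcongr
          _ = C := by rw [mul_assoc, ENNReal.mul_inv_cancel hne hnt, mul_one]
      rwa [one_div, ENNReal.rpow_inv_le_iff (by linarith)] at h10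
    rw [one_div, ENNReal.rpow_inv_le_iff (by linarith), ← setLIntegral_univ, ← hAU,
      setLIntegral_iUnion_of_directed _ (directed_of_isDirected_le hAmono)]
    exact iSup_le hX

/-- The dual of `L^p` is `L^{p'}`. -/
theorem exists_memLp_functional_eq [SigmaFinite μ] [Fact (1 ≤ p)] [Fact (1 ≤ p')]
    [hpp : p.HolderConjugate p'] (hp : p ≠ ∞) (L : Lp ℂ p μ →L[ℂ] ℂ) {C : ℝ≥0∞} (hC : C ≠ ∞)
    (hLC : ∀ f, ‖L f‖ₑ ≤ C * ‖f‖ₑ) :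
    ∃ h : α → ℂ, MemLp h p' μ ∧ eLpNorm h p' μ ≤ C ∧
      ∀ f : Lp ℂ p μ, L f = ∫ x, h x * f x ∂μ := by
  have h1 : (1 : ℝ≥0∞) ≤ p := Fact.out
  obtain ⟨G, hGm, hG0, hGr⟩ := exists_pos_memLp (μ := μ) h1 hp
  have hG : MemLp (fun x => (G x : ℂ)) p μ := hGr.ofReal
  obtain ⟨h₀, h₀m, h₀i, h₀L⟩ := exists_integrable_functional_eq hp L hG
  set h : α → ℂ := fun x => h₀ x / G x
  have hm : Measurable h := h₀m.div hGm.complex_ofReal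
  have hrep : ∀ (F : α → ℂ) (_ : Measurable F), (∃ c, 0 ≤ c ∧ ∀ x, ‖F x‖ ≤ c * G x) →
      ∀ hFp : MemLp F p μ, L hFp.toLp = ∫ x, h x * F x ∂μ := by
    rintro F hF ⟨c, hc, hFc⟩ hFp
    exact functional_eq_integral_of_norm_le hp L hGm hG0 hG h₀i h₀L hF hc hFc hFp
  have hle : eLpNorm h p' μ ≤ C := by
    refine eLpNorm_le_of_forall_integral_mul_le h1 hp hGm hG0 hG hm ?_ hC fun F hF hc => ?_
    · refine h₀i.congr (.of_forall fun x => ?_)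
      exact (div_mul_cancel₀ _ (by exact_mod_cast (hG0 x).ne')).symm
    · have hFp : MemLp F p μ := by
        obtain ⟨c, -, hc⟩ := hc
        exact (hGr.const_mul c).mono' hF.aestronglyMeasurable (.of_forall hc)
      rw [← hrep F hF hc hFp]
      refine (hLC _).trans_eq ?_
      rw [Lp.enorm_toLp]
  have hmem : MemLp h p' μ := ⟨hm.aestronglyMeasurable, hle.trans_lt hC.lt_top⟩
  refine ⟨h, hmem, hle, fun f => ?_⟩
  set T : Lp ℂ p μ →L[ℂ] ℂ :=
    (ContinuousLinearMap.mul ℂ ℂ).lpPairing μ p' p hmem.toLp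
  have hT : ∀ f : Lp ℂ p μ, T f = ∫ x, h x * f x ∂μ := by
    intro f
    rw [ContinuousLinearMap.lpPairing_eq_integral]
    refine integral_congr_ae ?_
    filter_upwards [hmem.coeFn_toLp] with x hx
    simp [hx]
  rw [← hT f]
  obtain ⟨g, hgm, hfg⟩ := (Lp.aestronglyMeasurable f)
  have hgp : MemLp g p μ := (Lp.memLp f).ae_eq hfg
  have hfe : f = hgp.toLp := by
    rw [← Lp.toLp_coeFn f (Lp.memLp f)]
    exact MemLp.toLp_congr _ _ hfg
  -- The truncations of `g` to `{|g| ≤ k G}` converge to it in `L^p`, so the two continuous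
  -- functionals `L` and `T` agree everywhere.
  set A : ℕ → Set α := fun k => {x | ‖g x‖ ≤ k * G x}
  have hA : ∀ k, MeasurableSet (A k) := fun k =>
    measurableSet_le hgm.measurable.norm (hGm.const_mul _)
  have hgk : ∀ k, MemLp ((A k).indicator g) p μ := fun k => hgp.indicator (hA k)
  have hlim : Tendsto (fun k => (hgk k).toLp) atTop (𝓝 f) := by
    rw [hfe, Lp.tendsto_Lp_iff_tendsto_eLpNorm'']
    refine tendsto_eLpNorm_sub_of_dominated h1 hp (fun k => (hgk k).1) hgp.1 hgp.norm
      (fun k => .of_forall fun x => norm_indicator_le_norm_self _ _) (.of_forall fun x => le_rfl)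
      (.of_forall fun x => ?_)
    obtain ⟨k, hk⟩ := exists_nat_ge (‖g x‖ / G x)
    refine tendsto_const_nhds.congr' ?_
    filter_upwards [eventually_ge_atTop k] with j hj
    rw [Set.indicator_of_mem]
    change ‖g x‖ ≤ j * G x
    rw [← div_le_iff₀ (hG0 x)]
    exact hk.trans (by exact_mod_cast hj)
  refine tendsto_nhds_unique ((L.continuous.tendsto _).comp hlim)
    (((T.continuous.tendsto _).comp hlim).congr fun k => ?_)
  simp only [Function.comp_apply]
  rw [hT, hrep _ (hgm.measurable.indicator (hA k)) ⟨k, by positivity, fun x => ?_⟩ (hgk k)]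
  · refine integral_congr_ae ?_
    filter_upwards [(hgk k).coeFn_toLp] with x hx
    rw [hx]
  · by_cases hx : x ∈ A k
    · rw [Set.indicator_of_mem hx]
      exact hx
    · rw [Set.indicator_of_notMem hx, norm_zero]
      have := hG0 x
      positivity

end LpDual

/-! ### Functionals on Schwartz functions represented by `L^p` functions -/

section Schwartz

variable {n : ℕ} {p p' : ℝ≥0∞}

lemma exists_memLp_eq_integral_of_distLpENorm_lt_top {u : 𝓢(E n, ℂ) →ₗ[ℂ] ℂ}
    (hu : distLpENorm p u < ∞) :
    ∃ h : E n → ℂ, MemLp h p volume ∧ ∀ g : 𝓢(E n, ℂ), u g = ∫ x, h x * g x := by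
  unfold distLpENorm at hu
  simp only [iInf_lt_iff] at hu
  obtain ⟨h, hh, hu, -⟩ := hu
  exact ⟨h, hh, hu⟩

/-- Test functions separate locally integrable functions, so the infimum runs over a single
almost-everywhere class and any representing function computes it. -/
lemma distLpENorm_eq_eLpNorm (h1 : 1 ≤ p) {u : 𝓢(E n, ℂ) →ₗ[ℂ] ℂ} {h : E n → ℂ}
    (hh : MemLp h p volume) (hu : ∀ g : 𝓢(E n, ℂ), u g = ∫ x, h x * g x) :
    distLpENorm p u = eLpNorm h p volume := by
  refine le_antisymm (iInf_le_of_le h (iInf_le_of_le hh (iInf_le_of_le hu le_rfl))) ?_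
  refine le_iInf fun k => le_iInf fun hk => le_iInf fun hku => (eLpNorm_congr_ae ?_).le
  refine ae_eq_of_integral_contDiff_smul_eq (hh.locallyIntegrable h1) (hk.locallyIntegrable h1)
    fun g hg hgc => ?_
  set g' : 𝓢(E n, ℂ) := HasCompactSupport.toSchwartzMap (f := fun x => (g x : ℂ))
    (hgc.comp_left (g := fun r : ℝ => (r : ℂ)) Complex.ofReal_zero)
    (Complex.ofRealCLM.contDiff.comp hg)
  have := (hu g').symm.trans (hku g')
  have e : ∀ f : E n → ℂ, ∫ x, g x • f x = ∫ x, f x * g' x := fun f =>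
    integral_congr_ae (.of_forall fun x => by
      change g x • f x = f x * (g x : ℂ)
      rw [Complex.real_smul, mul_comm])
  rw [e, e, this]

/-- A functional on Schwartz functions that is bounded for the `L^p` norm is represented by a
function in `L^{p'}`. -/
lemma distLpENorm_le_of_forall_enorm_le [Fact (1 ≤ p)] [Fact (1 ≤ p')]
    [hpp : p.HolderConjugate p'] (hp : p ≠ ∞) {u : 𝓢(E n, ℂ) →ₗ[ℂ] ℂ} {C : ℝ≥0∞} (hC : C ≠ ∞)
    (hu : ∀ g : 𝓢(E n, ℂ), ‖u g‖ₑ ≤ C * eLpNorm g p volume) : distLpENorm p' u ≤ C := by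
  set e : 𝓢(E n, ℂ) →ₗ[ℂ] Lp ℂ p (volume : Measure (E n)) :=
    (SchwartzMap.toLpCLM ℂ ℂ p volume).toLinearMap
  have hd : DenseRange e := SchwartzMap.denseRange_toLpCLM (F := ℂ) hp
  have heq : ∀ g, ‖e g‖ₑ = eLpNorm g p volume := fun g => by
    rw [Lp.enorm_def]
    exact eLpNorm_congr_ae (SchwartzMap.coeFn_toLp g p volume)
  have hb : ∀ g, ‖u g‖ ≤ C.toReal * ‖e g‖ := fun g => by
    have h1 := hu g
    rw [← heq, ← ofReal_norm, ← ofReal_norm, ← ENNReal.ofReal_toReal hC,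
      ← ENNReal.ofReal_mul ENNReal.toReal_nonneg,
      ENNReal.ofReal_le_ofReal_iff (by positivity)] at h1
    exact h1
  -- Schwartz functions are dense in `L^p` for `p < ∞`, so `u` extends to `L^p` with the same bound
  -- and the duality of `L^p` applies.
  set L := u.extendOfNorm e
  have hLe : ∀ g, L (e g) = u g := LinearMap.extendOfNorm_eq hd ⟨_, hb⟩
  have hLb : ∀ f, ‖L f‖ₑ ≤ C * ‖f‖ₑ := fun f => by
    have h1 := LinearMap.norm_extendOfNorm_apply_le hd _ hb f
    rw [← ofReal_norm, ← ofReal_norm, ← ENNReal.ofReal_toReal hC,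
      ← ENNReal.ofReal_mul ENNReal.toReal_nonneg]
    exact ENNReal.ofReal_le_ofReal h1
  obtain ⟨h, hh, hhC, hrep⟩ := exists_memLp_functional_eq (p' := p') hp L hC hLb
  refine (distLpENorm_eq_eLpNorm Fact.out hh fun g => ?_).trans_le hhC
  rw [← hLe, hrep]
  refine integral_congr_ae ?_
  filter_upwards [SchwartzMap.coeFn_toLp g p volume] with x hx
  change h x * (g.toLp p volume : E n → ℂ) x = _
  rw [hx]

/-! ### Young's inequality and Fourier multipliers -/

/-- Hölder's inequality with exponents `1 - 1/r` and `1/r`, with `k` as the weight, followed by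
Tonelli and translation invariance. -/
lemma lintegral_convolution_rpow_le {k a : E n → ℝ≥0∞} (hk : Measurable k) (ha : Measurable a)
    {r : ℝ} (hr : 1 ≤ r) :
    ∫⁻ y, (∫⁻ t, k t * a (y - t)) ^ r ≤ (∫⁻ t, k t) ^ r * ∫⁻ y, a y ^ r := by
  have hr0 : 0 < r := by linarith
  have hinner : ∀ y, (∫⁻ t, k t * a (y - t)) ^ r ≤
      (∫⁻ t, k t) ^ (r - 1) * ∫⁻ t, k t * a (y - t) ^ r := by
    intro y
    have h1 := ENNReal.lintegral_mul_norm_pow_le (μ := (volume : Measure (E n))) (f := k)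
      (g := fun t => k t * a (y - t) ^ r) hk.aemeasurable
      (hk.mul ((ha.comp (measurable_const.sub measurable_id)).pow_const r)).aemeasurable
      (p := 1 - 1 / r) (q := 1 / r) (by rw [sub_nonneg, div_le_one hr0]; exact hr)
      (by positivity) (by ring)
    have h2 : ∀ t, k t ^ (1 - 1 / r) * (k t * a (y - t) ^ r) ^ (1 / r) = k t * a (y - t) := by
      intro t
      rw [ENNReal.mul_rpow_of_nonneg _ _ (by positivity), ← ENNReal.rpow_mul,
        mul_one_div_cancel hr0.ne', ENNReal.rpow_one, ← mul_assoc,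
        ← ENNReal.rpow_add_of_nonneg _ _ (by rw [sub_nonneg, div_le_one hr0]; exact hr)
          (by positivity), sub_add_cancel, ENNReal.rpow_one]
    simp_rw [h2] at h1
    refine (ENNReal.rpow_le_rpow h1 hr0.le).trans_eq ?_
    rw [ENNReal.mul_rpow_of_nonneg _ _ hr0.le, ← ENNReal.rpow_mul, ← ENNReal.rpow_mul,
      one_div_mul_cancel hr0.ne', ENNReal.rpow_one, sub_mul, one_mul,
      one_div_mul_cancel hr0.ne']
  refine (lintegral_mono hinner).trans_eq ?_
  have hmeas : Measurable fun z : E n × E n => k z.2 * a (z.1 - z.2) ^ r :=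
    (hk.comp measurable_snd).mul ((ha.comp (measurable_fst.sub measurable_snd)).pow_const r)
  rw [lintegral_const_mul _ hmeas.lintegral_prod_right', lintegral_lintegral_swap
    hmeas.aemeasurable]
  have h3 : ∀ t, ∫⁻ y, k t * a (y - t) ^ r = k t * ∫⁻ y, a y ^ r := by
    intro t
    rw [lintegral_const_mul _ (by fun_prop)]
    congr 1
    exact lintegral_sub_right_eq_self (fun y => a y ^ r) t
  simp_rw [h3]
  rw [lintegral_mul_const _ hk, ← mul_assoc]
  congr 1
  nth_rewrite 2 [← ENNReal.rpow_one (∫⁻ t, k t)]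
  rw [← ENNReal.rpow_add_of_nonneg _ _ (by linarith) zero_le_one, sub_add_cancel]

/-- The Fourier multiplier `g ↦ 𝓕 (ψ · 𝓕⁻¹ g)` on Schwartz functions. -/
def freqMult (ψ : 𝓓((⊤ : TopologicalSpace.Opens (E n)), ℝ)) : 𝓢(E n, ℂ) →ₗ[ℂ] 𝓢(E n, ℂ) where
  toFun g := fourierTest n (mulTest ψ (𝓕⁻ g))
  map_add' g h := by simp [FourierTransform.fourierInv_add]
  map_smul' c g := by simp [FourierTransform.fourierInv_smul]

/-- A real test function as a complex Schwartz function. -/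
def realTestToSchwartz (ψ : 𝓓((⊤ : TopologicalSpace.Opens (E n)), ℝ)) : 𝓢(E n, ℂ) :=
  HasCompactSupport.toSchwartzMap (f := fun x => (ψ x : ℂ))
    (ψ.hasCompactSupport.comp_left (g := fun r : ℝ => (r : ℂ)) Complex.ofReal_zero)
    (Complex.ofRealCLM.contDiff.comp ψ.contDiff)

/-- With the inverse transform inside and the direct one outside, the multiplier is a correlation
with `𝓕⁻¹ψ`. Reflecting `g` turns it into a convolution evaluated at `-x`. -/
lemma freqMult_apply (ψ : 𝓓((⊤ : TopologicalSpace.Opens (E n)), ℝ)) (g : 𝓢(E n, ℂ)) (x : E n) :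
    freqMult ψ g x = ∫ t, (𝓕⁻ (realTestToSchwartz ψ)) t * g (x + t) := by
  set R : 𝓢(E n, ℂ) :=
    SchwartzMap.compCLMOfContinuousLinearEquiv ℂ (ContinuousLinearEquiv.neg ℝ) g
  have hR : ∀ y, R y = g (-y) := fun y => rfl
  have h1 := SchwartzMap.convolution_apply (ContinuousLinearMap.mul ℂ ℂ)
    (𝓕⁻ (realTestToSchwartz ψ)) R (-x)
  have h2 : (MeasureTheory.convolution (𝓕⁻ (realTestToSchwartz ψ) : 𝓢(E n, ℂ)) R
      (ContinuousLinearMap.mul ℂ ℂ) volume) (-x) =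
      ∫ t, (𝓕⁻ (realTestToSchwartz ψ)) t * g (x + t) := by
    refine integral_congr_ae (.of_forall fun t => ?_)
    simp only [ContinuousLinearMap.mul_apply', hR]
    rw [neg_sub, sub_neg_eq_add, add_comm t x]
  rw [← h2, ← h1]
  have h3 : SchwartzMap.pairing (ContinuousLinearMap.mul ℂ ℂ)
      (𝓕 (𝓕⁻ (realTestToSchwartz ψ))) (𝓕 R) = testToSchwartz n (mulTest ψ (𝓕⁻ g)) := by
    ext ξ
    rw [FourierTransform.fourier_fourierInv_eq, SchwartzMap.pairing_apply_apply]
    change (ψ ξ : ℂ) * (𝓕 R) ξ = (ψ ξ : ℂ) * (𝓕⁻ g) ξ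
    congr 1
    rw [SchwartzMap.fourier_coe, SchwartzMap.fourierInv_coe, Real.fourierInv_eq_fourier_comp_neg]
    rfl
  change 𝓕 (testToSchwartz n (mulTest ψ (𝓕⁻ g))) x = 𝓕⁻ (SchwartzMap.pairing
    (ContinuousLinearMap.mul ℂ ℂ) (𝓕 (𝓕⁻ (realTestToSchwartz ψ))) (𝓕 R)) (-x)
  rw [h3, SchwartzMap.fourier_coe, SchwartzMap.fourierInv_coe, Real.fourierInv_eq_fourier_neg,
    neg_neg]

/-- Young's inequality for Fourier multipliers acting on functionals by duality. -/
lemma distLpENorm_comp_freqMult_le [hp1 : Fact (1 ≤ p)] (hp : p ≠ ∞)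
    (ψ : 𝓓((⊤ : TopologicalSpace.Opens (E n)), ℝ)) (u : 𝓢(E n, ℂ) →ₗ[ℂ] ℂ) {C : ℝ≥0∞}
    (hC : eLpNorm (𝓕⁻ (fun ξ => (ψ ξ : ℂ))) 1 volume ≤ C) :
    distLpENorm p (u ∘ₗ freqMult ψ) ≤ C * distLpENorm p u := by
  have hp0 : p ≠ 0 := (zero_lt_one.trans_le hp1.out).ne'
  have hpr : 1 ≤ p.toReal := by simpa using ENNReal.toReal_mono hp hp1.out
  have hpp : p.HolderConjugate p.conjExponent := ENNReal.HolderConjugate.conjExponent hp1.out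
  rcases eq_or_ne C 0 with hC0 | hC0
  -- Here the right-hand side is `0` even when the norm of `u` is infinite, so the composition
  -- itself must be shown to vanish.
  · have hz : ∀ g, freqMult ψ g = 0 := by
      intro g
      ext x
      rw [freqMult_apply, zero_apply]
      refine integral_eq_zero_of_ae ?_
      have h1 : eLpNorm (𝓕⁻ (realTestToSchwartz ψ) : 𝓢(E n, ℂ)) 1 volume = 0 := by
        refine le_antisymm ?_ zero_le
        rw [← hC0, SchwartzMap.fourierInv_coe]
        exact hC
      rw [eLpNorm_eq_zero_iff (SchwartzMap.continuous _).aestronglyMeasurable one_ne_zero] at h1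
      filter_upwards [h1] with t ht
      simp [ht]
    have : u ∘ₗ freqMult ψ = 0 := by
      ext g
      simp [hz g]
    rw [this, distLpENorm_zero]
    exact zero_le
  by_cases hut : distLpENorm p u = ∞
  · rw [hut, ENNReal.mul_top hC0]
    exact le_top
  obtain ⟨h', hh', hu'⟩ := exists_memLp_eq_integral_of_distLpENorm_lt_top (lt_top_iff_ne_top.2 hut)
  obtain ⟨h, hm, hhh⟩ := hh'.1
  have hh : MemLp h p volume := hh'.ae_eq hhh
  have hu : ∀ g : 𝓢(E n, ℂ), u g = ∫ x, h x * g x := fun g => by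
    rw [hu']
    refine integral_congr_ae ?_
    filter_upwards [hhh] with x hx
    rw [hx]
  rw [distLpENorm_eq_eLpNorm hp1.out hh hu]
  set k : 𝓢(E n, ℂ) := 𝓕⁻ (realTestToSchwartz ψ) with hk
  have hkC : ∫⁻ t, ‖k t‖ₑ ≤ C := by
    rw [← eLpNorm_one_eq_lintegral_enorm, hk, SchwartzMap.fourierInv_coe]
    exact hC
  have hkm : Measurable fun t => ‖k t‖ₑ := k.continuous.enorm.measurable
  have hmm : Measurable h := hm.measurable
  -- By duality the correlation acting on `g` becomes a convolution acting on `h`; `H` represents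
  -- the composed functional.
  set H : E n → ℂ := fun y => ∫ t, k t * h (y - t)
  have hHm : StronglyMeasurable H := by
    refine StronglyMeasurable.integral_prod_right
      (f := fun y t => k t * h (y - t)) ?_
    exact ((k.continuous.measurable.comp measurable_snd).mul
      (hmm.comp (measurable_fst.sub measurable_snd))).stronglyMeasurable
  have hHle : eLpNorm H p volume ≤ C * eLpNorm h p volume := by
    rw [eLpNorm_eq_lintegral_rpow_enorm_toReal hp0 hp,
      eLpNorm_eq_lintegral_rpow_enorm_toReal hp0 hp, one_div,
      ENNReal.rpow_inv_le_iff (by linarith), ENNReal.mul_rpow_of_nonneg _ _ (by linarith),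
      ← ENNReal.rpow_mul, inv_mul_cancel₀ (by linarith), ENNReal.rpow_one]
    calc ∫⁻ y, ‖H y‖ₑ ^ p.toReal
        ≤ ∫⁻ y, (∫⁻ t, ‖k t‖ₑ * ‖h (y - t)‖ₑ) ^ p.toReal := by
          gcongr with y
          refine (enorm_integral_le_lintegral_enorm _).trans_eq ?_
          simp only [enorm_mul]
      _ ≤ (∫⁻ t, ‖k t‖ₑ) ^ p.toReal * ∫⁻ y, ‖h y‖ₑ ^ p.toReal :=
          lintegral_convolution_rpow_le hkm hmm.enorm hpr
      _ ≤ _ := by gcongr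
  have hCt : ∫⁻ t, ‖k t‖ₑ < ∞ := k.integrable.2
  have hHp : MemLp H p volume := by
    refine ⟨hHm.aestronglyMeasurable, ?_⟩
    rw [eLpNorm_eq_lintegral_rpow_enorm_toReal hp0 hp]
    refine ENNReal.rpow_lt_top_of_nonneg (by positivity) (ne_of_lt ?_)
    calc ∫⁻ y, ‖H y‖ₑ ^ p.toReal
        ≤ ∫⁻ y, (∫⁻ t, ‖k t‖ₑ * ‖h (y - t)‖ₑ) ^ p.toReal := by
          gcongr with y
          refine (enorm_integral_le_lintegral_enorm _).trans_eq ?_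
          simp only [enorm_mul]
      _ ≤ (∫⁻ t, ‖k t‖ₑ) ^ p.toReal * ∫⁻ y, ‖h y‖ₑ ^ p.toReal :=
          lintegral_convolution_rpow_le hkm hmm.enorm hpr
      _ < ∞ := ENNReal.mul_lt_top (ENNReal.rpow_lt_top_of_nonneg (by linarith) hCt.ne)
          (lintegral_rpow_enorm_lt_top_of_eLpNorm_lt_top hp0 hp hh.2)
  refine (distLpENorm_eq_eLpNorm hp1.out hHp fun g => ?_).trans_le hHle
  have hbound : ∀ t, ∫⁻ x, ‖h x‖ₑ * ‖g (x + t)‖ₑ ≤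
      eLpNorm h p volume * eLpNorm g p.conjExponent volume := by
    intro t
    have h1 : eLpNorm (fun x => g (x + t)) p.conjExponent volume =
        eLpNorm g p.conjExponent volume :=
      eLpNorm_comp_measurePreserving g.continuous.aestronglyMeasurable
        (measurePreserving_add_right volume t)
    rw [← h1]
    have h2 := eLpNorm_smul_le_mul_eLpNorm (p := p) (q := p.conjExponent) (r := 1)
      (φ := h) (f := fun x => g (x + t)) (μ := volume)
      (by fun_prop) hh.1
    rw [eLpNorm_one_eq_lintegral_enorm] at h2
    simpa only [Pi.smul_apply', smul_eq_mul, enorm_mul] using h2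
  have hfin : (∫⁻ t, ‖k t‖ₑ) * (eLpNorm h p volume * eLpNorm g p.conjExponent volume) < ∞ :=
    ENNReal.mul_lt_top hCt (ENNReal.mul_lt_top hh.2 (g.memLp _ _).2)
  have hgm : Measurable g := g.continuous.measurable
  have hkm' : Measurable k := k.continuous.measurable
  -- Integrability on the product, before and after translating the variable, justifies the two
  -- exchanges of integrals below. The bound is Hölder's inequality in `x`, uniform in the
  -- translation `t`.
  have hint1 : Integrable (fun z : E n × E n => h z.2 * (k z.1 * g (z.2 + z.1)))
      (volume.prod volume) := by
    have hme : Measurable fun z : E n × E n => h z.2 * (k z.1 * g (z.2 + z.1)) :=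
      (hmm.comp measurable_snd).mul ((hkm'.comp measurable_fst).mul
        (hgm.comp (measurable_snd.add measurable_fst)))
    refine ⟨hme.aestronglyMeasurable, ?_⟩
    rw [HasFiniteIntegral, lintegral_prod _ hme.enorm.aemeasurable]
    refine lt_of_le_of_lt ?_ hfin
    rw [← lintegral_mul_const _ hkm]
    refine lintegral_mono fun t => ?_
    refine le_trans (le_of_eq ?_) (mul_le_mul_right (hbound t) _)
    rw [← lintegral_const_mul _ (by fun_prop)]
    refine lintegral_congr fun x => ?_
    simp only [enorm_mul]
    ring
  have hint2 : Integrable (fun z : E n × E n => h (z.2 - z.1) * (k z.1 * g z.2))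
      (volume.prod volume) := by
    have hme : Measurable fun z : E n × E n => h (z.2 - z.1) * (k z.1 * g z.2) :=
      (hmm.comp (measurable_snd.sub measurable_fst)).mul ((hkm'.comp measurable_fst).mul
        (hgm.comp measurable_snd))
    refine ⟨hme.aestronglyMeasurable, ?_⟩
    rw [HasFiniteIntegral, lintegral_prod _ hme.enorm.aemeasurable]
    refine lt_of_le_of_lt ?_ hfin
    rw [← lintegral_mul_const _ hkm]
    refine lintegral_mono fun t => ?_
    refine le_trans (le_of_eq ?_) (mul_le_mul_right (hbound t) _)
    rw [← lintegral_const_mul _ (by fun_prop),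
      ← lintegral_sub_right_eq_self (fun x => ‖k t‖ₑ * (‖h x‖ₑ * ‖g (x + t)‖ₑ)) t]
    refine lintegral_congr fun x => ?_
    simp only [enorm_mul, sub_add_cancel]
    ring
  rw [LinearMap.comp_apply, hu]
  calc ∫ x, h x * freqMult ψ g x = ∫ x, ∫ t, h x * (k t * g (x + t)) := by
        refine integral_congr_ae (.of_forall fun x => ?_)
        simp only [freqMult_apply, integral_const_mul]
        rfl
    _ = ∫ t, ∫ x, h x * (k t * g (x + t)) :=
        (integral_integral_swap (f := fun t x => h x * (k t * g (x + t))) hint1).symm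
    _ = ∫ t, ∫ y, h (y - t) * (k t * g y) := by
        refine integral_congr_ae (.of_forall fun t => ?_)
        simp only
        rw [← integral_sub_right_eq_self _ t]
        simp only [sub_add_cancel]
    _ = ∫ y, ∫ t, h (y - t) * (k t * g y) :=
        integral_integral_swap (f := fun t y => h (y - t) * (k t * g y)) hint2
    _ = ∫ y, H y * g y := by
        refine integral_congr_ae (.of_forall fun y => ?_)
        simp only [H]
        rw [← integral_mul_const]
        refine integral_congr_ae (.of_forall fun t => ?_)
        simp only
        ring

end Schwartz

/-! ### Geometry of the group -/

namespace AdmissibleLieGroup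

variable {n : ℕ} {𝔤 : Type*} [LieRing 𝔤] [LieAlgebra ℝ 𝔤] (G : AdmissibleLieGroup n 𝔤)

lemma step_eq_one_or_two : G.step = 1 ∨ G.step = 2 := by
  obtain ⟨i, hi⟩ := G.exists_deg_eq_step
  have h1 := G.one_le_deg i
  have h2 := G.step_le_two
  omega

lemma deg_eq_one_or_two (i : Fin n) : G.deg i = 1 ∨ G.deg i = 2 := by
  have h1 := G.one_le_deg i
  have h2 := (G.deg_le_step i).trans G.step_le_two
  omega

lemma homDim_pos : 0 < G.homDim := by
  obtain ⟨i, -⟩ := G.exists_deg_eq_step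
  exact Finset.sum_pos (fun j _ => G.one_le_deg j) ⟨i, Finset.mem_univ i⟩

lemma basis_mem_layer (i : Fin n) : G.basis i ∈ layer G.basis G.deg (G.deg i) :=
  Submodule.subset_span ⟨i, rfl, rfl⟩

/-- The second layer is central. -/
lemma lie_layer_two (x : 𝔤) {z : 𝔤} (hz : z ∈ layer G.basis G.deg 2) : ⁅x, z⁆ = 0 := by
  rcases G.step_eq_one_or_two with hs | hs
  · have : {i | G.deg i = 2} = ∅ := by
      ext i
      have := G.deg_le_step i
      simp only [Set.mem_ofPred_eq, Set.mem_empty_iff_false, iff_false]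
      omega
    rw [layer, this, Set.image_empty, Submodule.span_empty, Submodule.mem_bot] at hz
    rw [hz, lie_zero]
  have htop : ∀ a ∈ layer G.basis G.deg 1, ∀ y ∈ layer G.basis G.deg 2, ⁅a, y⁆ = 0 := by
    have := G.bracket_top
    rwa [hs] at this
  have hb : ∀ i, ∀ y ∈ layer G.basis G.deg 2, ⁅G.basis i, y⁆ = 0 := by
    intro i y hy
    have hi := G.basis_mem_layer i
    rcases G.deg_eq_one_or_two i with h1 | h2
    · rw [h1] at hi
      exact htop _ hi y hy
    · rw [h2] at hi
      -- A second-layer element is a combination of brackets of first-layer elements, each of which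
      -- commutes with the second layer; Jacobi's identity then makes the second layer abelian.
      have hl := G.bracket_layer 1 le_rfl (by omega)
      rw [← hl] at hy
      induction hy using Submodule.span_induction with
      | mem y hy =>
        obtain ⟨a, ha, b, hb, rfl⟩ := hy
        have e1 : ⁅G.basis i, a⁆ = 0 := by rw [← lie_skew, htop a ha _ hi, neg_zero]
        have e2 : ⁅G.basis i, b⁆ = 0 := by rw [← lie_skew, htop b hb _ hi, neg_zero]
        rw [leibniz_lie, e1, e2, zero_lie, lie_zero, add_zero]
      | zero => rw [lie_zero]
      | add a b _ _ ha hb => rw [lie_add, ha, hb, add_zero]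
      | smul c a _ ha => rw [lie_smul, ha, smul_zero]
  have hx : x ∈ Submodule.span ℝ (Set.range G.basis) := by
    rw [G.basis.span_eq]; exact Submodule.mem_top
  induction hx using Submodule.span_induction with
  | mem y hy =>
    obtain ⟨i, rfl⟩ := hy
    exact hb i z hz
  | zero => rw [zero_lie]
  | add a b _ _ ha hb => rw [add_lie, ha, hb, add_zero]
  | smul c a _ ha => rw [smul_lie, ha, smul_zero]

lemma lie_basis_mem_layer_two (i j : Fin n) :
    ⁅G.basis i, G.basis j⁆ ∈ layer G.basis G.deg 2 := by
  have hi := G.basis_mem_layer i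
  have hj := G.basis_mem_layer j
  rcases G.deg_eq_one_or_two j with h1 | h2
  · rcases G.deg_eq_one_or_two i with h1' | h2'
    · rw [h1] at hj
      rw [h1'] at hi
      rcases G.step_eq_one_or_two with hs | hs
      · rw [G.bracket_top _ hi _ (by rwa [hs])]
        exact Submodule.zero_mem _
      · rw [← G.bracket_layer 1 le_rfl (by omega)]
        exact Submodule.subset_span ⟨_, hi, _, hj, rfl⟩
    · rw [h2'] at hi
      rw [← lie_skew, G.lie_layer_two _ hi, neg_zero]
      exact Submodule.zero_mem _
  · rw [h2] at hj
    rw [G.lie_layer_two _ hj]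
    exact Submodule.zero_mem _

lemma lie_mem_layer_two (x y : 𝔤) : ⁅x, y⁆ ∈ layer G.basis G.deg 2 := by
  have hx : x ∈ Submodule.span ℝ (Set.range G.basis) := by
    rw [G.basis.span_eq]; exact Submodule.mem_top
  have hy : y ∈ Submodule.span ℝ (Set.range G.basis) := by
    rw [G.basis.span_eq]; exact Submodule.mem_top
  induction hx using Submodule.span_induction with
  | mem x hx =>
    obtain ⟨i, rfl⟩ := hx
    induction hy using Submodule.span_induction with
    | mem y hy =>
      obtain ⟨j, rfl⟩ := hy
      exact G.lie_basis_mem_layer_two i j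
    | zero => rw [lie_zero]; exact Submodule.zero_mem _
    | add a b _ _ ha hb => rw [lie_add]; exact Submodule.add_mem _ ha hb
    | smul c a _ ha => rw [lie_smul]; exact Submodule.smul_mem _ _ ha
  | zero => rw [zero_lie]; exact Submodule.zero_mem _
  | add a b _ _ ha hb => rw [add_lie]; exact Submodule.add_mem _ ha hb
  | smul c a _ ha => rw [smul_lie]; exact Submodule.smul_mem _ _ ha

/-- Half the Lie bracket, in coordinates. -/
def halfLie : E n →ₗ[ℝ] E n →ₗ[ℝ] E n :=
  LinearMap.mk₂ ℝ (fun x y => (1 / 2 : ℝ) • G.coord ⁅G.coord.symm x, G.coord.symm y⁆)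
    (fun x y z => by simp) (fun c x y => by simp [smul_comm c])
    (fun x y z => by simp) (fun c x y => by simp [smul_comm c])

lemma mul_eq (x y : E n) : G.mul x y = x + y + G.halfLie x y := rfl

lemma halfLie_self (x : E n) : G.halfLie x x = 0 := by
  change (1 / 2 : ℝ) • G.coord ⁅G.coord.symm x, G.coord.symm x⁆ = 0
  simp

lemma halfLie_swap (x y : E n) : G.halfLie x y = -G.halfLie y x := by
  change (1 / 2 : ℝ) • G.coord ⁅G.coord.symm x, G.coord.symm y⁆ =
    -((1 / 2 : ℝ) • G.coord ⁅G.coord.symm y, G.coord.symm x⁆)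
  rw [← lie_skew, map_neg, smul_neg]

lemma halfLie_halfLie_right (x y z : E n) : G.halfLie x (G.halfLie y z) = 0 := by
  change (1 / 2 : ℝ) • G.coord ⁅G.coord.symm x,
    G.coord.symm ((1 / 2 : ℝ) • G.coord ⁅G.coord.symm y, G.coord.symm z⁆)⁆ = 0
  rw [map_smul, LinearEquiv.symm_apply_apply, lie_smul, G.lie_layer_two _ (G.lie_mem_layer_two _ _)]
  simp

lemma halfLie_halfLie_left (x y z : E n) : G.halfLie (G.halfLie x y) z = 0 := by
  rw [halfLie_swap, halfLie_halfLie_right, neg_zero]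

/-- The dilations as linear maps. -/
def dilₗ (r : ℝ) : E n →ₗ[ℝ] E n where
  toFun := G.dil r
  map_add' x y := by ext i; simp [dil, mul_add]
  map_smul' c x := by ext i; simp [dil, mul_left_comm]

lemma coord_basis (i : Fin n) : G.coord (G.basis i) = EuclideanSpace.single i 1 := by
  ext j
  simp [coord, Finsupp.single_apply, eq_comm]

lemma dil_coord_basis (r : ℝ) (i : Fin n) :
    G.dil r (G.coord (G.basis i)) = r ^ G.deg i • G.coord (G.basis i) := by
  rw [coord_basis]
  ext j
  by_cases h : j = i
  · subst h; simp [dil]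
  · simp [dil, h]

lemma dil_coord_of_mem_layer (r : ℝ) (k : ℕ) {z : 𝔤} (hz : z ∈ layer G.basis G.deg k) :
    G.dil r (G.coord z) = r ^ k • G.coord z := by
  change G.dilₗ r (G.coord z) = _
  induction hz using Submodule.span_induction with
  | mem z hz =>
    obtain ⟨i, hi, rfl⟩ := hz
    have := G.dil_coord_basis r i
    rw [show G.deg i = k from hi] at this
    exact this
  | zero => simp
  | add a b _ _ ha hb => rw [map_add, map_add, ha, hb, smul_add]
  | smul c a _ ha => rw [map_smul, map_smul, ha, smul_comm]

lemma halfLie_coord (a b : 𝔤) :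
    G.halfLie (G.coord a) (G.coord b) = (1 / 2 : ℝ) • G.coord ⁅a, b⁆ := by
  change (1 / 2 : ℝ) • G.coord ⁅G.coord.symm (G.coord a), G.coord.symm (G.coord b)⁆ = _
  simp

/-- Dilations are automorphisms: a bracket of two vectors of degree one has degree two, matching `r
* r = r ^ 2`, and every other bracket of basis vectors vanishes. -/
lemma halfLie_dil (r : ℝ) (x y : E n) :
    G.halfLie (G.dil r x) (G.dil r y) = G.dil r (G.halfLie x y) := by
  have key : (G.halfLie.compl₂ (G.dilₗ r)) ∘ₗ (G.dilₗ r) = G.halfLie.compr₂ (G.dilₗ r) := by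
    refine (G.basis.map G.coord).ext fun i => (G.basis.map G.coord).ext fun j => ?_
    simp only [Module.Basis.map_apply, LinearMap.comp_apply, LinearMap.compl₂_apply,
      LinearMap.compr₂_apply]
    change G.halfLie (G.dil r (G.coord (G.basis i))) (G.dil r (G.coord (G.basis j))) =
      G.dil r (G.halfLie (G.coord (G.basis i)) (G.coord (G.basis j)))
    rw [dil_coord_basis, dil_coord_basis, halfLie_coord, map_smul, map_smul,
      LinearMap.smul_apply, halfLie_coord]
    change _ = G.dilₗ r _
    rw [map_smul]
    change _ = (1 / 2 : ℝ) • G.dil r _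
    rw [G.dil_coord_of_mem_layer r 2 (G.lie_basis_mem_layer_two i j)]
    have hi := G.basis_mem_layer i
    have hj := G.basis_mem_layer j
    rcases G.deg_eq_one_or_two j with h1 | h2
    · rcases G.deg_eq_one_or_two i with h1' | h2'
      · rw [h1, h1', smul_smul, smul_smul, smul_smul]
        congr 1
        ring
      · rw [h2'] at hi
        rw [← lie_skew, G.lie_layer_two _ hi]
        simp
    · rw [h2] at hj
      rw [G.lie_layer_two _ hj]
      simp
  exact LinearMap.congr_fun (LinearMap.congr_fun key x) y

lemma mul_dil (r : ℝ) (x y : E n) :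
    G.mul (G.dil r x) (G.dil r y) = G.dil r (G.mul x y) := by
  rw [mul_eq, mul_eq, halfLie_dil]
  change _ = G.dilₗ r _
  rw [map_add, map_add]
  rfl

lemma dil_one (x : E n) : G.dil 1 x = x := by
  ext i
  simp [dil]

lemma dil_zero (r : ℝ) : G.dil r 0 = 0 := (G.dilₗ r).map_zero

lemma continuous_dil_left (x : E n) : Continuous fun r => G.dil r x := by
  refine (PiLp.continuous_toLp 2 _).comp (continuous_pi fun i => ?_)
  fun_prop

lemma continuous_mul : Continuous fun z : E n × E n => G.mul z.1 z.2 := by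
  have h : Continuous fun z : E n × E n => G.halfLie z.1 z.2 := by
    have := LinearMap.continuous_of_finiteDimensional
      (LinearMap.toContinuousLinearMap.toLinearMap ∘ₗ
        G.halfLie : E n →ₗ[ℝ] E n →L[ℝ] E n)
    exact (this.comp continuous_fst).clm_apply continuous_snd
  simp only [mul_eq]
  fun_prop

/-! ### Volumes of balls -/

lemma det_dilₗ (r : ℝ) : LinearMap.det (G.dilₗ r) = r ^ G.homDim := by
  rw [← LinearMap.det_toMatrix (EuclideanSpace.basisFun (Fin n) ℝ).toBasis]
  have : LinearMap.toMatrix (EuclideanSpace.basisFun (Fin n) ℝ).toBasis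
      (EuclideanSpace.basisFun (Fin n) ℝ).toBasis (G.dilₗ r) =
      Matrix.diagonal fun i => r ^ G.deg i := by
    ext i j
    rw [LinearMap.toMatrix_apply]
    simp only [OrthonormalBasis.coe_toBasis, EuclideanSpace.basisFun_apply]
    change (G.dil r (EuclideanSpace.single j 1)) i = _
    by_cases h : i = j
    · subst h; simp [dil]
    · simp [dil, h]
  rw [this, Matrix.det_diagonal, homDim, Finset.prod_pow_eq_pow_sum]

/-- The bracket with `c` squares to zero because the group has step at most two. A nilpotent map has
characteristic polynomial `X ^ n`, which takes the value `1` at `1`. -/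
lemma det_one_add_halfLie (c : E n) : LinearMap.det (1 + G.halfLie c) = 1 := by
  have hnil : IsNilpotent (-(G.halfLie c) : Module.End ℝ (E n)) := by
    refine ⟨2, ?_⟩
    rw [neg_sq, sq]
    ext x : 1
    exact G.halfLie_halfLie_right _ _ _
  have h1 := LinearMap.isNilpotent_iff_charpoly _ |>.1 hnil
  have h2 := LinearMap.eval_charpoly (-(G.halfLie c) : Module.End ℝ (E n)) 1
  rw [h1] at h2
  simpa using h2.symm

/-- Left translation is a Euclidean translation after the unipotent linear map `1 + halfLie c`,
which has determinant `1`. -/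
lemma volume_preimage_mul (c : E n) (S : Set (E n)) :
    volume ((fun x => G.mul c x) ⁻¹' S) = volume S := by
  have h : (fun x => G.mul c x) ⁻¹' S =
      (1 + G.halfLie c : E n →ₗ[ℝ] E n) ⁻¹' ((fun x => c + x) ⁻¹' S) := by
    ext x
    simp [mul_eq, add_assoc]
  rw [h, Measure.addHaar_preimage_linearMap _ (by rw [det_one_add_halfLie]; exact one_ne_zero),
    det_one_add_halfLie, measure_preimage_add]
  simp

lemma volume_ball {ν : E n → ℝ} (hν : G.IsHomQuasiNorm ν) (c : E n) {R : ℝ} (hR : 0 < R) :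
    volume (G.ball ν c R) = ENNReal.ofReal (R ^ G.homDim) * volume {x | ν x < 1} := by
  have h1 : G.ball ν c R = (fun x => G.mul (-c) x) ⁻¹' (G.dilₗ R⁻¹ ⁻¹' {x | ν x < 1}) := by
    ext x
    change ν (G.mul (-c) x) < R ↔ ν (G.dil R⁻¹ (G.mul (-c) x)) < 1
    rw [hν.homogeneous _ (inv_pos.2 hR), inv_mul_lt_iff₀ hR, mul_one]
  have hd : LinearMap.det (G.dilₗ R⁻¹) ≠ 0 := by
    rw [det_dilₗ]; positivity
  rw [h1, volume_preimage_mul, Measure.addHaar_preimage_linearMap _ hd, det_dilₗ, inv_pow, inv_inv,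
    abs_of_pos (by positivity)]

/-! ### Quasi-norms -/

namespace IsHomQuasiNorm

variable {G} {ν ν' : E n → ℝ}

lemma map_zero (hν : G.IsHomQuasiNorm ν) : ν 0 = 0 := by
  have := hν.homogeneous 2 two_pos 0
  rw [G.dil_zero] at this
  linarith

lemma pos (hν : G.IsHomQuasiNorm ν) {x : E n} (hx : x ≠ 0) : 0 < ν x :=
  lt_of_le_of_ne (hν.nonneg x) fun h => hx (hν.eq_zero x h.symm)

/-- Let `m > 0` be a lower bound of `ν` on the Euclidean sphere. A point outside the Euclidean ball
is brought to the sphere by some `D_r` with `r ≤ 1`; homogeneity forces `r ≥ m`, and since degrees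
are at most two, `r² ‖x‖ ≤ ‖D_r x‖ = 1`. This is the source of the bound `1 / m²`. -/
lemma isCompact_setOf_le_one (hν : G.IsHomQuasiNorm ν) : IsCompact {x | ν x ≤ 1} := by
  have hS : IsCompact (Metric.sphere (0 : E n) 1) := isCompact_sphere 0 1
  obtain ⟨m, hm0, hm⟩ := hS.exists_forall_le' hν.continuous.continuousOn (a := 0)
    fun x hx => hν.pos (by rintro rfl; simp at hx)
  refine Metric.isCompact_of_isClosed_isBounded (isClosed_le hν.continuous continuous_const) ?_
  refine isBounded_iff_forall_norm_le.2 ⟨max 1 (1 / m ^ 2), fun x hx => ?_⟩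
  rcases le_or_gt ‖x‖ 1 with h | h
  · exact h.trans (le_max_left _ _)
  refine le_trans ?_ (le_max_right _ _)
  have hcont : Continuous fun r => ‖G.dil r x‖ := (G.continuous_dil_left x).norm
  have h0 : G.dil 0 x = 0 := by
    ext i
    have := G.one_le_deg i
    simp [dil, show G.deg i ≠ 0 by omega]
  obtain ⟨r, ⟨hr0, hr1⟩, hr⟩ := intermediate_value_Icc zero_le_one hcont.continuousOn
    (show (1 : ℝ) ∈ Set.Icc ‖G.dil 0 x‖ ‖G.dil 1 x‖ by
      rw [h0, dil_one, norm_zero]; exact ⟨zero_le_one, h.le⟩)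
  simp only at hr
  have hr0' : 0 < r := lt_of_le_of_ne hr0 (by rintro rfl; rw [h0, norm_zero] at hr; linarith)
  have hmr : m ≤ r := by
    have h1 := hm (G.dil r x) (by simpa using hr)
    rw [hν.homogeneous r hr0'] at h1
    have : ν x ≤ 1 := hx
    nlinarith
  have h2 : r ^ 2 * ‖x‖ ≤ 1 := by
    rw [← hr]
    have h3 : ‖r ^ 2 • x‖ ≤ ‖G.dil r x‖ := by
      rw [EuclideanSpace.norm_eq, EuclideanSpace.norm_eq]
      refine Real.sqrt_le_sqrt (Finset.sum_le_sum fun i _ => ?_)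
      have h4 : ‖(r ^ 2 • x) i‖ ≤ ‖(G.dil r x) i‖ := by
        simp only [dil, PiLp.smul_apply, smul_eq_mul, norm_mul, norm_pow]
        rw [Real.norm_of_nonneg hr0]
        gcongr ?_ * _
        exact pow_le_pow_of_le_one hr0 hr1 ((G.deg_le_step i).trans G.step_le_two)
      gcongr
    rwa [norm_smul, norm_pow, Real.norm_of_nonneg hr0] at h3
  rw [le_div_iff₀ (by positivity)]
  calc ‖x‖ * m ^ 2 ≤ ‖x‖ * r ^ 2 := by gcongr
    _ ≤ 1 := by linarith

lemma volume_pos (hν : G.IsHomQuasiNorm ν) : 0 < volume {x | ν x < 1} :=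
  (isOpen_lt hν.continuous continuous_const).measure_pos volume
    ⟨0, by simp [hν.map_zero]⟩

lemma volume_lt_top (hν : G.IsHomQuasiNorm ν) : volume {x | ν x < 1} < ∞ :=
  (measure_mono fun x (hx : ν x < 1) => hx.le).trans_lt hν.isCompact_setOf_le_one.measure_lt_top

lemma dil_inv_le_one (hν : G.IsHomQuasiNorm ν) {t : ℝ} (ht : 0 < t) {x : E n} (hx : ν x ≤ t) :
    ν (G.dil t⁻¹ x) ≤ 1 := by
  rw [hν.homogeneous _ (inv_pos.2 ht), inv_mul_le_iff₀ ht, mul_one]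
  exact hx

/-- Homogeneity reduces the comparison to the compact unit ball of `ν'`, where the continuous `ν` is
bounded. -/
lemma exists_le_mul (hν : G.IsHomQuasiNorm ν) (hν' : G.IsHomQuasiNorm ν') :
    ∃ C, 1 ≤ C ∧ ∀ x, ν x ≤ C * ν' x := by
  obtain ⟨C, hC⟩ := hν'.isCompact_setOf_le_one.exists_bound_of_continuousOn
    hν.continuous.continuousOn
  refine ⟨max 1 C, le_max_left _ _, fun x => ?_⟩
  rcases eq_or_ne x 0 with rfl | hx
  · rw [hν.map_zero, hν'.map_zero, mul_zero]
  have ht := hν'.pos hx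
  have h1 := hC _ (hν'.dil_inv_le_one ht le_rfl)
  rw [Real.norm_of_nonneg (hν.nonneg _), hν.homogeneous _ (inv_pos.2 ht), inv_mul_le_iff₀ ht] at h1
  calc ν x ≤ ν' x * C := h1
    _ ≤ max 1 C * ν' x := by rw [mul_comm]; gcongr; exact le_max_right _ _

/-- Since dilations are automorphisms, both factors may be scaled into the compact unit ball, where
the product is bounded. -/
lemma exists_mul_le (hν : G.IsHomQuasiNorm ν) :
    ∃ C, 1 ≤ C ∧ ∀ x y, ν (G.mul x y) ≤ C * (ν x + ν y) := by
  obtain ⟨C, hC⟩ := (hν.isCompact_setOf_le_one.prod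
    hν.isCompact_setOf_le_one).exists_bound_of_continuousOn
    (hν.continuous.comp G.continuous_mul).continuousOn
  refine ⟨max 1 C, le_max_left _ _, fun x y => ?_⟩
  rcases eq_or_lt_of_le (add_nonneg (hν.nonneg x) (hν.nonneg y)) with h0 | ht
  · have hx : x = 0 := hν.eq_zero x (by linarith [hν.nonneg x, hν.nonneg y])
    have hy : y = 0 := hν.eq_zero y (by linarith [hν.nonneg x, hν.nonneg y])
    subst hx hy
    simp [mul_eq, hν.map_zero]
  have h1 := hC (G.dil (ν x + ν y)⁻¹ x, G.dil (ν x + ν y)⁻¹ y)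
    ⟨hν.dil_inv_le_one ht (by linarith [hν.nonneg y]),
      hν.dil_inv_le_one ht (by linarith [hν.nonneg x])⟩
  simp only [Function.comp_apply] at h1
  rw [G.mul_dil, Real.norm_of_nonneg (hν.nonneg _), hν.homogeneous _ (inv_pos.2 ht),
    inv_mul_le_iff₀ ht] at h1
  calc ν (G.mul x y) ≤ (ν x + ν y) * C := h1
    _ ≤ max 1 C * (ν x + ν y) := by rw [mul_comm]; gcongr; exact le_max_right _ _

lemma mul_neg_comm (hν : G.IsHomQuasiNorm ν) (a b : E n) :
    ν (G.mul (-a) b) = ν (G.mul (-b) a) := by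
  rw [← hν.symmetric]
  congr 1
  rw [mul_eq, mul_eq, LinearMap.map_neg, LinearMap.map_neg, LinearMap.neg_apply,
    LinearMap.neg_apply, G.halfLie_swap a b]
  abel

end IsHomQuasiNorm

/-- Insertion of `c⁻¹ c` by associativity, valid because iterated brackets vanish. It converts the
bound for products into a quasi-triangle inequality. -/
lemma mul_neg_mul (a b c : E n) : G.mul (-a) b = G.mul (G.mul (-a) c) (G.mul (-c) b) := by
  simp only [mul_eq, map_add, LinearMap.map_neg, LinearMap.neg_apply, LinearMap.add_apply,
    halfLie_halfLie_right, halfLie_halfLie_left, halfLie_self, neg_zero, add_zero]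
  abel

end AdmissibleLieGroup

/-! ### Comparison of two coverings -/

section Coverings

variable {n : ℕ} {𝔤 : Type*} [LieRing 𝔤] [LieAlgebra ℝ 𝔤]
  {G : AdmissibleLieGroup n 𝔤} {α : ℝ} {I κ : Type*}

lemma AdmissibleLieGroup.IsHomQuasiNorm.exists_quasi_triangle {ν : E n → ℝ}
    (hν : G.IsHomQuasiNorm ν) : ∃ C, 1 ≤ C ∧ ∀ a b c,
      ν (G.mul (-a) b) ≤ C * (ν (G.mul (-a) c) + ν (G.mul (-c) b)) := by
  obtain ⟨C, hC1, hC⟩ := hν.exists_mul_le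
  refine ⟨C, hC1, fun a b c => ?_⟩
  rw [G.mul_neg_mul a b c]
  exact hC _ _

lemma AdmissibleLieGroup.zero_mul (x : E n) : G.mul 0 x = x := by
  simp [AdmissibleLieGroup.mul_eq]

namespace AlphaModData

variable (d : AlphaModData G α I) (d' : AlphaModData G α κ)

/-- The volume of the `i`-th set of the covering. -/
def vol (i : I) : ℝ := (volume (d.P i)).toReal

lemma exists_vol_bounds : ∃ C : ℝ, 0 < C ∧ ∀ i, volume (d.P i) = ENNReal.ofReal (d.vol i) ∧
    0 < d.vol i ∧ ∀ ξ ∈ d.P i, (1 + d.ν ξ ^ 2) ^ (α * G.homDim / 2) ≤ C * d.vol i ∧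
      d.vol i ≤ C * (1 + d.ν ξ ^ 2) ^ (α * G.homDim / 2) := by
  obtain ⟨C, hC, h⟩ := d.isAlphaCovering.size
  refine ⟨C, hC, fun i => ?_⟩
  have hpow : ∀ ξ, 0 < (1 + d.ν ξ ^ 2) ^ (α * G.homDim / 2) := fun ξ => by positivity
  have hfin : volume (d.P i) ≠ ∞ :=
    ((h i _ (d.ξ_mem i)).2.trans_lt ENNReal.ofReal_lt_top).ne
  have hb : ∀ ξ ∈ d.P i, (1 + d.ν ξ ^ 2) ^ (α * G.homDim / 2) ≤ C * d.vol i ∧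
      d.vol i ≤ C * (1 + d.ν ξ ^ 2) ^ (α * G.homDim / 2) := by
    intro ξ hξ
    obtain ⟨h1, h2⟩ := h i ξ hξ
    have := hpow ξ
    rw [ENNReal.ofReal_le_iff_le_toReal hfin] at h1
    refine ⟨?_, ENNReal.toReal_le_of_le_ofReal (by positivity) h2⟩
    rwa [inv_mul_le_iff₀ hC] at h1
  refine ⟨(ENNReal.ofReal_toReal hfin).symm, ?_, hb⟩
  have h1 := (hpow (d.ξ i)).trans_le (hb _ (d.ξ_mem i)).1
  exact (mul_pos_iff_of_pos_left hC).1 h1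

/-- A ball inscribed in `P i` has volume at most `|P i|`, so its radius is `≲ |P i| ^ (1/Q)`; the
ratio condition transfers this to circumscribed balls. -/
lemma exists_subset_ball : ∃ A : ℝ, 0 < A ∧ ∀ i, ∃ c R, 0 < R ∧ d.P i ⊆ G.ball d.ν c R ∧
    R ≤ A * d.vol i ^ (1 / (G.homDim : ℝ)) := by
  obtain ⟨C, hC, hvol⟩ := d.exists_vol_bounds
  obtain ⟨K, hK1, hK⟩ := d.isAlphaCovering.ratio
  have hν := d.isHomQuasiNorm
  have hQ : 0 < G.homDim := G.homDim_pos
  have hQr : (0 : ℝ) < G.homDim := by exact_mod_cast hQ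
  set v₀ := (volume {x | d.ν x < 1}).toReal
  have hv₀ : 0 < v₀ := ENNReal.toReal_pos hν.volume_pos.ne' hν.volume_lt_top.ne
  have hv₀e : volume {x | d.ν x < 1} = ENNReal.ofReal v₀ :=
    (ENNReal.ofReal_toReal hν.volume_lt_top.ne).symm
  -- The factor `2` makes the bound on the outer radius strict, so that an actual ball can be
  -- extracted from the infimum.
  refine ⟨2 * K * (1 / v₀) ^ (1 / (G.homDim : ℝ)), by positivity, fun i => ?_⟩
  obtain ⟨hV, hV0, -⟩ := hvol i
  set τ := (1 / v₀ * d.vol i) ^ (1 / (G.homDim : ℝ)) with hτ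
  have hτ0 : 0 < τ := by positivity
  have hτQ : τ ^ G.homDim = 1 / v₀ * d.vol i := by
    rw [hτ, ← Real.rpow_natCast, ← Real.rpow_mul (by positivity), one_div_mul_cancel hQr.ne',
      Real.rpow_one]
  have hin : G.innerRadius d.ν (d.P i) ≤ ENNReal.ofReal τ := by
    refine iSup_le fun c => iSup_le fun r => iSup_le fun hcr => ENNReal.ofReal_le_ofReal ?_
    rcases le_or_gt r 0 with hr | hr
    · exact hr.trans hτ0.le
    have h1 := measure_mono (μ := volume) hcr
    rw [G.volume_ball hν c hr, hv₀e, hV, ← ENNReal.ofReal_mul (by positivity),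
      ENNReal.ofReal_le_ofReal_iff hV0.le] at h1
    rw [← pow_le_pow_iff_left₀ hr.le hτ0.le hQ.ne', hτQ, one_div, inv_mul_eq_div,
      le_div_iff₀ hv₀]
    exact h1
  have hout : G.outerRadius d.ν (d.P i) < ENNReal.ofReal (2 * K * τ) := by
    refine (hK i).trans_lt ((mul_le_mul_right hin _).trans_lt ?_)
    rw [← ENNReal.ofReal_mul (by linarith), ENNReal.ofReal_lt_ofReal_iff (by positivity)]
    have : 0 < K * τ := by positivity
    linarith
  unfold AdmissibleLieGroup.outerRadius at hout
  simp only [iInf_lt_iff] at hout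
  obtain ⟨c, R, hsub, hR⟩ := hout
  have hR0 : 0 < R := (hν.nonneg _).trans_lt (hsub (d.ξ_mem i))
  refine ⟨c, R, hR0, hsub, ?_⟩
  rw [ENNReal.ofReal_lt_ofReal_iff (by positivity)] at hR
  refine hR.le.trans_eq ?_
  rw [hτ, Real.mul_rpow (by positivity) hV0.le, ← mul_assoc]

/-- The radius of a ball around `P i` is `≲ (1 + ν(η)²) ^ (α/2) ≤ J` with `J² = 1 + ν(η)²`, and `α ≤
1` is what makes this linear in `J`. Going from `0` to `ξ` through `η` and the centre of the ball
then gives `ν(ξ) ≲ J`. -/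
lemma exists_weight_le_self (hα1 : α ≤ 1) : ∃ B : ℝ, 0 < B ∧ ∀ i, ∀ ξ ∈ d.P i,
    ∀ η ∈ d.P i, 1 + d.ν ξ ^ 2 ≤ B * (1 + d.ν η ^ 2) := by
  obtain ⟨C, hC, hvol⟩ := d.exists_vol_bounds
  obtain ⟨A, hA, hball⟩ := d.exists_subset_ball
  have hν := d.isHomQuasiNorm
  obtain ⟨T, hT1, hT⟩ := hν.exists_quasi_triangle
  have hQr : (0 : ℝ) < G.homDim := by exact_mod_cast G.homDim_pos
  set M := A * C ^ (1 / (G.homDim : ℝ))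
  have hM : 0 < M := by positivity
  set D := T * (1 + T * (2 * M))
  refine ⟨1 + D ^ 2, by positivity, fun i ξ hξ η hη => ?_⟩
  obtain ⟨c, R, hR0, hsub, hR⟩ := hball i
  have hV := ((hvol i).2.2 η hη).2
  set J := Real.sqrt (1 + d.ν η ^ 2)
  have hJ0 : 0 ≤ J := Real.sqrt_nonneg _
  have hJsq : J ^ 2 = 1 + d.ν η ^ 2 := Real.sq_sqrt (by positivity)
  have hνJ : d.ν η ≤ J := Real.le_sqrt_of_sq_le (by linarith)
  have hRJ : R ≤ M * J := by
    refine hR.trans ?_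
    have h1 : d.vol i ≤ C * J ^ (G.homDim : ℝ) := by
      refine hV.trans ?_
      gcongr
      rw [← hJsq, ← Real.rpow_natCast J 2, ← Real.rpow_mul hJ0]
      have hJ1 : 1 ≤ J := by
        rw [Real.one_le_sqrt]
        nlinarith [sq_nonneg (d.ν η)]
      refine Real.rpow_le_rpow_of_exponent_le hJ1 ?_
      push_cast
      nlinarith
    calc A * d.vol i ^ (1 / (G.homDim : ℝ))
        ≤ A * (C * J ^ (G.homDim : ℝ)) ^ (1 / (G.homDim : ℝ)) := by
          have := (hvol i).2.1.le
          gcongr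
      _ = M * J := by
          rw [Real.mul_rpow hC.le (by positivity), ← Real.rpow_mul hJ0,
            mul_one_div_cancel hQr.ne', Real.rpow_one, ← mul_assoc]
  have h1 : d.ν (G.mul (-c) ξ) < R := hsub hξ
  have h2 : d.ν (G.mul (-η) c) < R := by
    rw [hν.mul_neg_comm]; exact hsub hη
  have h3 := hT η ξ c
  have h4 := hT 0 ξ η
  rw [neg_zero, G.zero_mul, G.zero_mul] at h4
  have h5 : d.ν ξ ≤ D * J := by
    calc d.ν ξ ≤ T * (d.ν η + d.ν (G.mul (-η) ξ)) := h4
      _ ≤ T * (J + T * (2 * (M * J))) := by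
          gcongr
          refine h3.trans ?_
          gcongr
          linarith
      _ = D * J := by simp only [D]; ring
  rw [← hJsq]
  have h6 : d.ν ξ ^ 2 ≤ (D * J) ^ 2 := pow_le_pow_left₀ (hν.nonneg ξ) h5 2
  nlinarith [sq_nonneg (d.ν η)]

lemma exists_one_add_sq_le {ν ν' : E n → ℝ} (hν : G.IsHomQuasiNorm ν)
    (hν' : G.IsHomQuasiNorm ν') : ∃ C : ℝ, 0 < C ∧ ∀ x, 1 + ν x ^ 2 ≤ C * (1 + ν' x ^ 2) := by
  obtain ⟨C, hC1, hC⟩ := hν.exists_le_mul hν'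
  refine ⟨C ^ 2, by positivity, fun x => ?_⟩
  have h1 := pow_le_pow_left₀ (hν.nonneg x) (hC x) 2
  nlinarith

/-- Points in intersecting sets of two coverings have comparable size. -/
lemma exists_weight_le (hα1 : α ≤ 1) : ∃ B : ℝ, 0 < B ∧ ∀ i j,
    (d.P i ∩ d'.P j).Nonempty → 1 + d.ν (d.ξ i) ^ 2 ≤ B * (1 + d'.ν (d'.ξ j) ^ 2) := by
  obtain ⟨B₁, hB₁, h₁⟩ := d.exists_weight_le_self hα1
  obtain ⟨B₂, hB₂, h₂⟩ := d'.exists_weight_le_self hα1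
  obtain ⟨C, hC, h⟩ := exists_one_add_sq_le d.isHomQuasiNorm d'.isHomQuasiNorm
  refine ⟨B₁ * (C * B₂), by positivity, fun i j ⟨η, hi, hj⟩ => ?_⟩
  calc 1 + d.ν (d.ξ i) ^ 2 ≤ B₁ * (1 + d.ν η ^ 2) := h₁ i _ (d.ξ_mem i) η hi
    _ ≤ B₁ * (C * (B₂ * (1 + d'.ν (d'.ξ j) ^ 2))) := by
        gcongr
        refine (h η).trans ?_
        gcongr
        exact h₂ j η hj _ (d'.ξ_mem j)
    _ = _ := by ring

/-- At a common point both volumes are comparable to the same power of the weight, up to the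
comparison of the two quasi-norms. -/
lemma exists_vol_le (hα0 : 0 ≤ α) : ∃ S : ℝ, 0 < S ∧ ∀ i j,
    (d.P i ∩ d'.P j).Nonempty → d.vol i ≤ S * d'.vol j := by
  obtain ⟨C₁, hC₁, h₁⟩ := d.exists_vol_bounds
  obtain ⟨C₂, hC₂, h₂⟩ := d'.exists_vol_bounds
  obtain ⟨C, hC, h⟩ := exists_one_add_sq_le d.isHomQuasiNorm d'.isHomQuasiNorm
  refine ⟨C₁ * (C ^ (α * G.homDim / 2) * C₂), by positivity, fun i j ⟨η, hi, hj⟩ => ?_⟩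
  calc d.vol i ≤ C₁ * (1 + d.ν η ^ 2) ^ (α * G.homDim / 2) := ((h₁ i).2.2 η hi).2
    _ ≤ C₁ * (C * (1 + d'.ν η ^ 2)) ^ (α * G.homDim / 2) := by
        gcongr
        exact h η
    _ = C₁ * (C ^ (α * G.homDim / 2) * (1 + d'.ν η ^ 2) ^ (α * G.homDim / 2)) := by
        rw [Real.mul_rpow hC.le (by positivity)]
    _ ≤ C₁ * (C ^ (α * G.homDim / 2) * (C₂ * d'.vol j)) := by
        gcongr
        exact ((h₂ j).2.2 η hj).1
    _ = _ := by ring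

/-- A point lies in at most `N` sets of an admissible covering, so the sum of their indicators is at
most `N` times the indicator of `U`. -/
lemma exists_sum_volume_le : ∃ N : ℕ, ∀ (F : Finset I) (U : Set (E n)), MeasurableSet U →
    (∀ i ∈ F, d.P i ⊆ U) → ∑ i ∈ F, volume (d.P i) ≤ N * volume U := by
  classical
  obtain ⟨N, hN⟩ := d.isAlphaCovering.admissible
  refine ⟨N, fun F U hU hF => ?_⟩
  have hm : ∀ i, MeasurableSet (d.P i) := fun i => (d.isAlphaCovering.isOpen i).measurableSet
  calc ∑ i ∈ F, volume (d.P i)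
      = ∫⁻ x, ∑ i ∈ F, (d.P i).indicator (fun _ => (1 : ℝ≥0∞)) x := by
        rw [lintegral_finsetSum _ fun i _ => measurable_const.indicator (hm i)]
        refine Finset.sum_congr rfl fun i _ => ?_
        rw [lintegral_indicator_const (hm i), one_mul]
    _ ≤ ∫⁻ x, U.indicator (fun _ => (N : ℝ≥0∞)) x := by
        refine lintegral_mono fun x => ?_
        by_cases hx : ∃ i ∈ F, x ∈ d.P i
        · obtain ⟨i, hi, hxi⟩ := hx
          simp only
          rw [Set.indicator_of_mem (hF i hi hxi)]
          simp only [Set.indicator_apply]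
          rw [Finset.sum_boole]
          have h1 : ((F.filter fun j => x ∈ d.P j : Finset I) : Set I).encard ≤ N :=
            (Set.encard_le_encard fun j hj => by
              simp only [Finset.coe_filter] at hj
              exact ⟨x, hxi, hj.2⟩).trans (hN i)
          rw [Set.encard_coe_eq_coe_finsetCard] at h1
          exact_mod_cast h1
        · push Not at hx
          rw [Finset.sum_eq_zero fun i hi => Set.indicator_of_notMem (hx i hi) _]
          exact zero_le
    _ = N * volume U := lintegral_indicator_const hU _

/-- Each set of one covering meets a bounded number of sets of the other. -/
lemma exists_encard_le (hα0 : 0 ≤ α) : ∃ N : ℕ, ∀ i,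
    {j | (d.P i ∩ d'.P j).Nonempty}.encard ≤ N := by
  obtain ⟨N', hN'⟩ := d'.exists_sum_volume_le
  obtain ⟨S, hS, hvol⟩ := d.exists_vol_le d' hα0
  obtain ⟨S', hS', hvol'⟩ := d'.exists_vol_le d hα0
  obtain ⟨A, hA, hball⟩ := d.exists_subset_ball
  obtain ⟨A', hA', hball'⟩ := d'.exists_subset_ball
  obtain ⟨_, -, hb⟩ := d.exists_vol_bounds
  obtain ⟨_, -, hb'⟩ := d'.exists_vol_bounds
  have hν := d.isHomQuasiNorm
  have hν' := d'.isHomQuasiNorm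
  obtain ⟨T, hT1, hT⟩ := hν.exists_quasi_triangle
  obtain ⟨T', hT1', hT'⟩ := hν'.exists_quasi_triangle
  obtain ⟨L, hL1, hL⟩ := hν.exists_le_mul hν'
  have hQr : (0 : ℝ) < G.homDim := by exact_mod_cast G.homDim_pos
  set v₀ := (volume {x | d.ν x < 1}).toReal
  have hv₀e : volume {x | d.ν x < 1} = ENNReal.ofReal v₀ :=
    (ENNReal.ofReal_toReal hν.volume_lt_top.ne).symm
  -- From the centre `c` to a point of `P'_j`, pass through a common point `η`. The first leg is
  -- measured by `ν`; the second stays inside `P'_j`, is measured by `ν'` and converted by `L`. The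
  -- final `+ 1` makes the inclusion in the open ball strict.
  set M := T * (A + L * (T' * (2 * (A' * S' ^ (1 / (G.homDim : ℝ)))))) + 1
  have hM : 0 < M := by positivity
  obtain ⟨N, hN⟩ := exists_nat_ge (N' * (M ^ G.homDim * v₀) * S)
  refine ⟨N, fun i => ?_⟩
  set τ := d.vol i ^ (1 / (G.homDim : ℝ))
  have hVi := (hb i).2.1
  have hτ0 : 0 < τ := by positivity
  have hτQ : τ ^ G.homDim = d.vol i := by
    rw [← Real.rpow_natCast, ← Real.rpow_mul hVi.le, one_div_mul_cancel hQr.ne', Real.rpow_one]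
  obtain ⟨c, R, hR0, hsub, hR⟩ := hball i
  have hP : ∀ j, (d.P i ∩ d'.P j).Nonempty → d'.P j ⊆ G.ball d.ν c (M * τ) := by
    rintro j hij y hy
    obtain ⟨η, hηi, hηj⟩ := hij
    obtain ⟨c', R', hR0', hsub', hR'⟩ := hball' j
    have hVj := (hb' j).2.1
    have h1 : R' ≤ A' * S' ^ (1 / (G.homDim : ℝ)) * τ := by
      refine hR'.trans ?_
      rw [mul_assoc, ← Real.mul_rpow hS'.le hVi.le]
      gcongr
      exact hvol' j i ⟨η, hηj, hηi⟩
    have h2 : d.ν (G.mul (-c) η) < R := hsub hηi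
    have h3 : d'.ν (G.mul (-c') y) < R' := hsub' hy
    have h4 : d'.ν (G.mul (-η) c') < R' := by
      rw [hν'.mul_neg_comm]; exact hsub' hηj
    change d.ν (G.mul (-c) y) < M * τ
    calc d.ν (G.mul (-c) y) ≤ T * (d.ν (G.mul (-c) η) + d.ν (G.mul (-η) y)) := hT _ _ _
      _ ≤ T * (A * τ + L * (T' * (2 * (A' * S' ^ (1 / (G.homDim : ℝ)) * τ)))) := by
          gcongr
          · exact h2.le.trans hR
          · refine (hL _).trans ?_
            gcongr
            refine (hT' _ _ c').trans ?_
            gcongr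
            linarith
      _ < M * τ := by
          simp only [M]
          nlinarith
  -- Packing: `N + 1` intersecting sets, each of volume at least `|P i| / S`, would lie in one ball
  -- of volume `M ^ Q v₀ |P i|` with multiplicity at most `N'`, which contradicts the choice of `N`.
  by_contra hcon
  rw [not_le] at hcon
  obtain ⟨t, hts, htc⟩ := Set.exists_subset_encard_eq (Order.add_one_le_of_lt hcon)
  have htf : t.Finite := Set.finite_of_encard_eq_coe (k := N + 1) (by rw [htc]; rfl)
  have hcard : htf.toFinset.card = N + 1 := by
    have := htf.encard_eq_coe_toFinset_card
    rw [htc] at this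
    exact_mod_cast this.symm
  have h1 := hN' htf.toFinset (G.ball d.ν c (M * τ))
    ((isOpen_lt (hν.continuous.comp (G.continuous_mul.comp
      (continuous_const.prodMk continuous_id))) continuous_const).measurableSet)
    fun j hj => hP j (hts (htf.mem_toFinset.1 hj))
  rw [G.volume_ball hν c (by positivity), hv₀e, mul_pow, hτQ] at h1
  have h2 : ((N + 1 : ℕ) : ℝ) * (d.vol i / S) ≤ N' * (M ^ G.homDim * d.vol i * v₀) := by
    have h3 : ∑ j ∈ htf.toFinset, ENNReal.ofReal (d.vol i / S) ≤
        ∑ j ∈ htf.toFinset, volume (d'.P j) := by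
      refine Finset.sum_le_sum fun j hj => ?_
      rw [(hb' j).1]
      refine ENNReal.ofReal_le_ofReal ?_
      rw [div_le_iff₀' hS]
      exact hvol i j (hts (htf.mem_toFinset.1 hj))
    have h4 := h3.trans h1
    rw [Finset.sum_const, hcard, nsmul_eq_mul, ← ENNReal.ofReal_mul (by positivity),
      ← ENNReal.ofReal_natCast, ← ENNReal.ofReal_natCast, ← ENNReal.ofReal_mul (by positivity),
      ← ENNReal.ofReal_mul (by positivity), ENNReal.ofReal_le_ofReal_iff (by positivity)] at h4
    exact h4
  have h5 : ((N + 1 : ℕ) : ℝ) ≤ N' * (M ^ G.homDim * v₀) * S := by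
    rw [mul_div_assoc', div_le_iff₀ hS] at h2
    have h6 : ((N + 1 : ℕ) : ℝ) * d.vol i ≤ N' * (M ^ G.homDim * v₀) * S * d.vol i := by
      refine h2.trans_eq ?_
      ring
    exact le_of_mul_le_mul_right h6 hVi
  push_cast at h5
  linarith

/-- The weights of the modulation spaces. -/
def weight (s : ℝ) (i : I) : ℝ≥0∞ := ENNReal.ofReal ((1 + d.ν (d.ξ i) ^ 2) ^ (s / 2))

lemma weight_ne_top (s : ℝ) (i : I) : d.weight s i ≠ ∞ := ENNReal.ofReal_ne_top

lemma weight_mul_weight_neg (s : ℝ) (i : I) : d.weight s i * d.weight (-s) i = 1 := by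
  rw [weight, weight, ← ENNReal.ofReal_mul (by positivity), ← Real.rpow_add (by positivity)]
  simp [neg_div]

/-- The sign of `s` decides which of the two one-sided comparisons of `1 + ν²` is raised to a power,
since negative powers reverse the inequality. -/
lemma exists_weight_comparable (hα1 : α ≤ 1) (s : ℝ) : ∃ C : ℝ≥0∞, C ≠ ∞ ∧
    ∀ i j, (d.P i ∩ d'.P j).Nonempty → d.weight s i ≤ C * d'.weight s j := by
  rcases le_total 0 s with hs | hs
  · obtain ⟨B, hB, h⟩ := d.exists_weight_le d' hα1
    refine ⟨ENNReal.ofReal (B ^ (s / 2)), ENNReal.ofReal_ne_top, fun i j hij => ?_⟩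
    rw [weight, weight, ← ENNReal.ofReal_mul (by positivity),
      ← Real.mul_rpow hB.le (by positivity)]
    refine ENNReal.ofReal_le_ofReal (Real.rpow_le_rpow (by positivity) (h i j hij) (by linarith))
  · obtain ⟨B, hB, h⟩ := d'.exists_weight_le d hα1
    refine ⟨ENNReal.ofReal (B ^ (-s / 2)), ENNReal.ofReal_ne_top, fun i j hij => ?_⟩
    rw [weight, weight, ← ENNReal.ofReal_mul (by positivity)]
    refine ENNReal.ofReal_le_ofReal ?_
    have h1 := h j i (by rwa [Set.inter_comm])
    have h2 : (1 + d.ν (d.ξ i) ^ 2) ^ (s / 2) ≤ (B⁻¹ * (1 + d'.ν (d'.ξ j) ^ 2)) ^ (s / 2) := by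
      refine Real.rpow_le_rpow_of_nonpos (by positivity) ?_ (by linarith)
      rwa [inv_mul_le_iff₀ hB]
    rwa [Real.mul_rpow (by positivity) (by positivity), Real.inv_rpow hB.le,
      ← Real.rpow_neg hB.le, ← neg_div] at h2

end AlphaModData

end Coverings

/-! ### Estimates in `ℓ^q` -/

section Lq

variable {I K : Type*} {q q' : ℝ≥0∞}

lemma lqENorm_of_ne_top (hq : q ≠ ∞) (a : I → ℝ≥0∞) :
    lqENorm q a = (∑' i, a i ^ q.toReal) ^ (1 / q.toReal) := if_neg hq

lemma one_le_toReal_of_one_le (h1 : 1 ≤ q) (hq : q ≠ ∞) : 1 ≤ q.toReal := by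
  simpa using ENNReal.toReal_mono hq h1

/-- Schur's test for a relation that is finite in both directions. -/
lemma lqENorm_tsum_indicator_le (h1 : 1 ≤ q) (hq : q ≠ ∞) {R : I → Set K} {N : ℕ}
    (hR : ∀ i, (R i).encard ≤ N) (hR' : ∀ k, {i | k ∈ R i}.encard ≤ N) (a : K → ℝ≥0∞) :
    lqENorm q (fun i => ∑' k, (R i).indicator a k) ≤ N * lqENorm q a := by
  classical
  have hr := one_le_toReal_of_one_le h1 hq
  have hr0 : 0 < q.toReal := by linarith
  set r := q.toReal
  have hfin : ∀ i, (R i).Finite := fun i => Set.finite_of_encard_le_coe (hR i)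
  have hcard : ∀ i, ((hfin i).toFinset.card : ℝ≥0∞) ≤ N := by
    intro i
    have := hR i
    rw [(hfin i).encard_eq_coe_toFinset_card] at this
    exact_mod_cast this
  have hsum : ∀ i (b : K → ℝ≥0∞), ∑' k, (R i).indicator b k = ∑ k ∈ (hfin i).toFinset, b k := by
    intro i b
    rw [tsum_eq_sum (s := (hfin i).toFinset) fun k hk =>
      Set.indicator_of_notMem (fun h => hk ((hfin i).mem_toFinset.2 h)) _]
    exact Finset.sum_congr rfl fun k hk => Set.indicator_of_mem ((hfin i).mem_toFinset.1 hk) _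
  -- The power mean inequality on at most `N` terms costs `N ^ (r - 1)`, and the exchange of the
  -- sums costs one further factor `N`.
  have key : ∑' i, (∑' k, (R i).indicator a k) ^ r ≤ (N : ℝ≥0∞) ^ r * ∑' k, a k ^ r := by
    calc ∑' i, (∑' k, (R i).indicator a k) ^ r
        ≤ ∑' i, (N : ℝ≥0∞) ^ (r - 1) * ∑' k, (R i).indicator (fun k => a k ^ r) k := by
          refine ENNReal.tsum_le_tsum fun i => ?_
          rw [hsum, hsum]
          refine (ENNReal.rpow_sum_le_const_mul_sum_rpow _ _ hr).trans ?_
          gcongr ?_ ^ (r - 1) * _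
          exact hcard i
      _ = (N : ℝ≥0∞) ^ (r - 1) * ∑' k, ∑' i, (R i).indicator (fun k => a k ^ r) k := by
          rw [ENNReal.tsum_mul_left, ENNReal.tsum_comm]
      _ ≤ (N : ℝ≥0∞) ^ (r - 1) * ∑' k, N * a k ^ r := by
          gcongr with k
          have hf : {i | k ∈ R i}.Finite := Set.finite_of_encard_le_coe (hR' k)
          rw [tsum_eq_sum (f := fun i => (R i).indicator (fun k => a k ^ r) k)
            (s := hf.toFinset) fun i hi =>
            Set.indicator_of_notMem (fun h : k ∈ R i => hi (hf.mem_toFinset.2 h)) _]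
          refine (Finset.sum_le_sum fun i _ =>
            Set.indicator_le_self (R i) (fun k => a k ^ r) k).trans ?_
          rw [Finset.sum_const, nsmul_eq_mul]
          gcongr
          have := hR' k
          rw [hf.encard_eq_coe_toFinset_card] at this
          exact_mod_cast this
      _ = (N : ℝ≥0∞) ^ r * ∑' k, a k ^ r := by
          rw [ENNReal.tsum_mul_left, ← mul_assoc]
          congr 1
          nth_rewrite 2 [← ENNReal.rpow_one (N : ℝ≥0∞)]
          rw [← ENNReal.rpow_add_of_nonneg _ _ (by linarith) zero_le_one, sub_add_cancel]
  rw [lqENorm_of_ne_top hq, lqENorm_of_ne_top hq, one_div, ENNReal.rpow_inv_le_iff hr0,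
    ENNReal.mul_rpow_of_nonneg _ _ hr0.le, ← ENNReal.rpow_mul, inv_mul_cancel₀ hr0.ne',
    ENNReal.rpow_one]
  exact key

lemma sum_mul_le_lqENorm_mul_lqENorm [hqq : q.HolderConjugate q'] (hq : q ≠ ∞) (F : Finset I)
    (a b : I → ℝ≥0∞) : ∑ i ∈ F, a i * b i ≤ lqENorm q a * lqENorm q' b := by
  rcases eq_or_ne q' ∞ with hq' | hq'
  · subst hq'
    have hq1 : q = 1 := by simpa using hqq.inv_add_inv_eq_inv
    subst hq1
    have e1 : lqENorm 1 a = ∑' i, a i := by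
      rw [lqENorm_of_ne_top ENNReal.one_ne_top]
      simp
    have e2 : lqENorm ∞ b = ⨆ i, b i := if_pos rfl
    rw [e1, e2]
    calc ∑ i ∈ F, a i * b i ≤ ∑ i ∈ F, a i * ⨆ i, b i := by
          gcongr with i
          exact le_iSup b i
      _ ≤ _ := by
          rw [← Finset.sum_mul]
          gcongr
          exact ENNReal.sum_le_tsum F
  · rw [lqENorm_of_ne_top hq, lqENorm_of_ne_top hq']
    refine (ENNReal.inner_le_Lp_mul_Lq F a b (hqq.toReal_of_ne_top hq hq')).trans ?_
    gcongr <;> exact ENNReal.sum_le_tsum F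

/-- The converse of Hölder's inequality in `ℓ^q`. -/
lemma lqENorm_le_of_forall_sum_mul_le [hqq : q.HolderConjugate q'] (hq : q ≠ ∞)
    {b : I → NNReal} {M : ℝ≥0∞}
    (h : ∀ (F : Finset I) (c : I → NNReal), ∑ i ∈ F, (c i : ℝ≥0∞) * b i ≤
      M * lqENorm q ((F : Set I).indicator fun i => (c i : ℝ≥0∞))) :
    lqENorm q' (fun i => (b i : ℝ≥0∞)) ≤ M := by
  classical
  have hq0 : q ≠ 0 := hqq.ne_zero
  have hr0 : 0 < q.toReal := ENNReal.toReal_pos hq0 hq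
  have hind : ∀ (F : Finset I) (c : I → NNReal),
      lqENorm q ((F : Set I).indicator fun i => (c i : ℝ≥0∞)) =
        (∑ i ∈ F, (c i : ℝ≥0∞) ^ q.toReal) ^ (1 / q.toReal) := by
    intro F c
    rw [lqENorm_of_ne_top hq, tsum_eq_sum (s := F) fun i hi => by
      rw [Set.indicator_of_notMem (by simpa using hi), ENNReal.zero_rpow_of_pos hr0]]
    congr 1
    exact Finset.sum_congr rfl fun i hi => by rw [Set.indicator_of_mem (by simpa using hi)]
  rcases eq_or_ne q' ∞ with hq' | hq'
  · have e2 : lqENorm q' (fun i => (b i : ℝ≥0∞)) = ⨆ i, (b i : ℝ≥0∞) := if_pos hq'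
    rw [e2]
    refine iSup_le fun i => ?_
    have := h {i} fun _ => 1
    rw [hind] at this
    simpa using this
  · have hpq := hqq.toReal_of_ne_top hq hq'
    have hr0' : 0 < q'.toReal := hpq.symm.pos
    rw [lqENorm_of_ne_top hq', one_div, ENNReal.rpow_inv_le_iff hr0', ENNReal.tsum_eq_iSup_sum]
    refine iSup_le fun F => ?_
    -- The coefficients `c` are extremal for Hölder's inequality on `F`: their `ℓ^q` norm is at most
    -- `1` and their pairing with `b` is its `ℓ^{q'}` norm over `F`.
    obtain ⟨⟨c, hc, hcb⟩, -⟩ := NNReal.isGreatest_Lp F b hpq.symm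
    simp only at hcb
    have h2 := h F c
    rw [hind] at h2
    have h3 : ∑ i ∈ F, (c i : ℝ≥0∞) * b i =
        (∑ i ∈ F, (b i : ℝ≥0∞) ^ q'.toReal) ^ (1 / q'.toReal) := by
      have h4 : ((∑ i ∈ F, b i * c i : NNReal) : ℝ≥0∞) =
          (((∑ i ∈ F, b i ^ q'.toReal) ^ (1 / q'.toReal) : NNReal) : ℝ≥0∞) := by rw [hcb]
      rw [ENNReal.coe_rpow_of_nonneg _ (by positivity)] at h4
      push_cast at h4
      simp_rw [ENNReal.coe_rpow_of_nonneg _ hr0'.le] at h4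
      rw [← h4]
      · exact Finset.sum_congr rfl fun i _ => mul_comm _ _
    have h5 : (∑ i ∈ F, (c i : ℝ≥0∞) ^ q.toReal) ^ (1 / q.toReal) ≤ 1 := by
      refine ENNReal.rpow_le_one ?_ (by positivity)
      have hc' : ∑ i ∈ F, c i ^ q.toReal ≤ 1 := hc
      have : ((∑ i ∈ F, c i ^ q.toReal : NNReal) : ℝ≥0∞) ≤ 1 := by exact_mod_cast hc'
      push_cast at this
      simpa only [ENNReal.coe_rpow_of_nonneg _ hr0.le] using this
    rw [h3, one_div, ENNReal.rpow_inv_le_iff hr0'] at h2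
    refine h2.trans ?_
    gcongr
    calc M * _ ≤ M * 1 := by gcongr
      _ = M := mul_one M

lemma exists_finset_tsum_compl_le {e : I → ℝ≥0∞} (he : ∑' i, e i ≠ ∞) {η : ℝ≥0∞} (hη : η ≠ 0) :
    ∃ F : Finset I, ∑' i : {i // i ∉ F}, e i ≤ η :=
  ((ENNReal.tendsto_tsum_compl_atTop_zero he).eventually
    (ge_mem_nhds (pos_iff_ne_zero.2 hη))).exists

lemma exists_card_mul_rpow_le {r : ℝ} (hr : 0 < r) (F : Finset I) {η : ℝ≥0∞} (hη : η ≠ 0) :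
    ∃ δ : ℝ≥0∞, δ ≠ 0 ∧ F.card * δ ^ r ≤ η := by
  refine ⟨(η / (F.card + 1 : ℕ)) ^ r⁻¹, ?_, ?_⟩
  · rw [Ne, ENNReal.rpow_eq_zero_iff_of_pos (by positivity), ENNReal.div_eq_zero_iff, not_or]
    exact ⟨hη, ENNReal.natCast_ne_top _⟩
  · rw [← ENNReal.rpow_mul, inv_mul_cancel₀ hr.ne', ENNReal.rpow_one]
    calc (F.card : ℝ≥0∞) * (η / (F.card + 1 : ℕ)) ≤
          (F.card + 1 : ℕ) * (η / (F.card + 1 : ℕ)) := by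
          gcongr
          exact Nat.le_succ _
      _ ≤ η := ENNReal.mul_div_le

lemma tsum_le_of_le_on_finset {F : Finset I} {b e : I → ℝ≥0∞} {δ η : ℝ≥0∞}
    (hb : ∀ i ∈ F, b i ≤ δ) (hb' : ∀ i ∉ F, b i ≤ e i)
    (hF : ∑' i : {i // i ∉ F}, e i ≤ η) : ∑' i, b i ≤ F.card * δ + η := by
  rw [← ENNReal.sum_add_tsum_compl F]
  refine add_le_add ?_
    ((ENNReal.tsum_le_tsum fun i : {i // i ∉ F} => hb' i i.2).trans hF)
  refine (Finset.sum_le_sum hb).trans ?_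
  rw [Finset.sum_const, nsmul_eq_mul]

/-- The tail of `e` outside a large finite `F` is small because `q < ∞`, and what remains is a
finite sum. In the density argument `b` is an approximation error: small on `F`, and equal to `e`
elsewhere, where nothing is approximated. -/
lemma exists_finset_forall_lqENorm_le (h1 : 1 ≤ q) (hq : q ≠ ∞) {e : I → ℝ≥0∞}
    (he : lqENorm q e ≠ ∞) {ε : ℝ≥0∞} (hε : ε ≠ 0) :
    ∃ (F : Finset I) (δ : ℝ≥0∞), δ ≠ 0 ∧ ∀ b : I → ℝ≥0∞, (∀ i ∈ F, b i ≤ δ) →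
      (∀ i ∉ F, b i ≤ e i) → lqENorm q b ≤ ε := by
  have hr := one_le_toReal_of_one_le h1 hq
  generalize hqr : q.toReal = r at hr
  have hr0 : 0 < r := by linarith
  have hsum : ∑' i, e i ^ r ≠ ∞ := by
    rw [lqENorm_of_ne_top hq, hqr] at he
    intro h
    rw [h, ENNReal.top_rpow_of_pos (by positivity)] at he
    exact he rfl
  have hη0 : ε ^ r / 2 ≠ 0 := by
    rw [Ne, ENNReal.div_eq_zero_iff, ENNReal.rpow_eq_zero_iff_of_pos hr0, not_or]
    exact ⟨hε, ENNReal.ofNat_ne_top⟩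
  obtain ⟨F, hF⟩ := exists_finset_tsum_compl_le hsum hη0
  obtain ⟨δ, hδ0, hδ⟩ := exists_card_mul_rpow_le hr0 F hη0
  refine ⟨F, δ, hδ0, fun b hb hb' => ?_⟩
  rw [lqENorm_of_ne_top hq, hqr, one_div, ENNReal.rpow_inv_le_iff hr0]
  refine (tsum_le_of_le_on_finset (fun i hi => ENNReal.rpow_le_rpow (hb i hi) hr0.le)
    (fun i hi => ENNReal.rpow_le_rpow (hb' i hi) hr0.le) hF).trans ?_
  refine (add_le_add hδ le_rfl).trans (ENNReal.add_halves _).le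

lemma le_lqENorm (hq1 : 1 ≤ q) (b : I → ℝ≥0∞) (i : I) : b i ≤ lqENorm q b := by
  rcases eq_or_ne q ∞ with rfl | hq
  · rw [lqENorm, if_pos rfl]
    exact le_iSup b i
  · have hr := one_le_toReal_of_one_le hq1 hq
    have hr0 : 0 < q.toReal := by linarith
    rw [lqENorm_of_ne_top hq, one_div, ENNReal.le_rpow_inv_iff hr0]
    exact ENNReal.le_tsum i

lemma lqENorm_ne_top_of_finset (hq1 : 1 ≤ q) {J : Finset I} {b : I → ℝ≥0∞}
    (h0 : ∀ j ∉ J, b j = 0) (hb : ∀ j, b j ≠ ∞) : lqENorm q b ≠ ∞ := by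
  rcases eq_or_ne q ∞ with rfl | hq
  · have h : lqENorm ∞ b ≤ ∑ j ∈ J, b j := by
      rw [lqENorm, if_pos rfl]
      refine iSup_le fun j => ?_
      by_cases hj : j ∈ J
      · exact Finset.single_le_sum (fun _ _ => zero_le) hj
      · rw [h0 j hj]
        exact zero_le
    exact (h.trans_lt (ENNReal.sum_lt_top.2 fun j _ => (hb j).lt_top)).ne
  · have hr := one_le_toReal_of_one_le hq1 hq
    have hr0 : 0 < q.toReal := by linarith
    rw [lqENorm_of_ne_top hq, tsum_eq_sum (s := J)]
    · refine ENNReal.rpow_ne_top_of_nonneg (by positivity) (ENNReal.sum_lt_top.2 fun j _ => ?_).ne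
      exact ENNReal.rpow_lt_top_of_nonneg hr0.le (hb j)
    · intro j hj
      rw [h0 j hj, ENNReal.zero_rpow_of_pos hr0]

lemma lqENorm_eq_of_forall_ne (hq1 : 1 ≤ q) {b : I → ℝ≥0∞} {j : I} (h0 : ∀ i ≠ j, b i = 0) :
    lqENorm q b = b j := by
  refine le_antisymm ?_ (le_lqENorm hq1 b j)
  rcases eq_or_ne q ∞ with rfl | hq
  · rw [lqENorm, if_pos rfl]
    refine iSup_le fun i => ?_
    rcases eq_or_ne i j with rfl | hi
    · exact le_rfl
    · rw [h0 i hi]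
      exact zero_le
  · have hr := one_le_toReal_of_one_le hq1 hq
    have hr0 : 0 < q.toReal := by linarith
    rw [lqENorm_of_ne_top hq, tsum_eq_single j, ← ENNReal.rpow_mul, mul_one_div_cancel hr0.ne',
      ENNReal.rpow_one]
    intro i hi
    rw [h0 i hi, ENNReal.zero_rpow_of_pos hr0]

end Lq

/-! ### Overlapping sets of two coverings and weighted sequence norms -/

section Blocks

variable {n : ℕ} {𝔤 : Type*} [LieRing 𝔤] [LieAlgebra ℝ 𝔤]
  {G : AdmissibleLieGroup n 𝔤} {α : ℝ} {I κ : Type*}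

namespace AlphaModData

variable (d : AlphaModData G α I) (d' : AlphaModData G α κ)

/-- The sets of the covering of `d'` that meet the `i`-th set of the covering of `d`. -/
def nbhd (i : I) : Set κ := {j | (d.P i ∩ d'.P j).Nonempty}

lemma mem_nbhd_comm {i : I} {j : κ} : j ∈ d.nbhd d' i ↔ i ∈ d'.nbhd d j := by
  change (d.P i ∩ d'.P j).Nonempty ↔ (d'.P j ∩ d.P i).Nonempty
  rw [Set.inter_comm]

/-- Weights of intersecting sets are comparable, so the weight can be moved inside the sum over
neighbours; Schur's test for the bounded overlap relation does the rest. -/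
lemma exists_lqENorm_nbhd_le (hα0 : 0 ≤ α) (hα1 : α ≤ 1) (s : ℝ) {q : ℝ≥0∞} (h1 : 1 ≤ q)
    (hq : q ≠ ∞) : ∃ C : ℝ≥0∞, C ≠ ∞ ∧ ∀ e : κ → ℝ≥0∞,
      lqENorm q (fun i => d.weight s i * ∑' j, (d.nbhd d' i).indicator e j) ≤
        C * lqENorm q fun j => d'.weight s j * e j := by
  obtain ⟨C, hC, hw⟩ := d.exists_weight_comparable d' hα1 s
  obtain ⟨N₁, hN₁⟩ := d.exists_encard_le d' hα0
  obtain ⟨N₂, hN₂⟩ := d'.exists_encard_le d hα0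
  refine ⟨C * (N₁ + N₂ : ℕ), by finiteness, fun e => ?_⟩
  have h2 := lqENorm_tsum_indicator_le h1 hq (R := d.nbhd d') (N := N₁ + N₂)
    (fun i => (hN₁ i).trans (by exact_mod_cast Nat.le_add_right _ _))
    (fun j => by
      refine le_trans (le_of_eq ?_) ((hN₂ j).trans (by exact_mod_cast Nat.le_add_left _ _))
      congr 1
      ext i
      exact d.mem_nbhd_comm d')
    (fun j => d'.weight s j * e j)
  calc lqENorm q (fun i => d.weight s i * ∑' j, (d.nbhd d' i).indicator e j)
      ≤ lqENorm q (fun i =>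
          C * ∑' j, (d.nbhd d' i).indicator (fun j => d'.weight s j * e j) j) := by
        refine lqENorm_mono q fun i => ?_
        rw [← ENNReal.tsum_mul_left, ← ENNReal.tsum_mul_left]
        refine ENNReal.tsum_le_tsum fun j => ?_
        by_cases hj : j ∈ d.nbhd d' i
        · rw [Set.indicator_of_mem hj, Set.indicator_of_mem hj, ← mul_assoc]
          gcongr
          exact hw i j hj
        · rw [Set.indicator_of_notMem hj, mul_zero]
          exact zero_le
    _ = C * lqENorm q (fun i => ∑' j, (d.nbhd d' i).indicator (fun j => d'.weight s j * e j) j) :=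
        lqENorm_const_mul h1 _ _
    _ ≤ C * (N₁ + N₂ : ℕ) * lqENorm q fun j => d'.weight s j * e j := by
        rw [mul_assoc]
        gcongr

end AlphaModData

end Blocks

/-! ### Frequency blocks and test functions -/

section TestAlgebra

variable {n : ℕ} {p p' : ℝ≥0∞}

/-- A Schwartz function `a` as the functional `g ↦ ∫ a g`. -/
def schwartzFunctional (a : 𝓢(E n, ℂ)) : 𝓢(E n, ℂ) →ₗ[ℂ] ℂ where
  toFun g := ∫ x, a x * g x
  map_add' g h := by
    have hi : ∀ v : 𝓢(E n, ℂ), Integrable (fun x => a x * v x) volume :=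
      fun v => integrable_mul_schwartz (p := 2) (q := 2) (SchwartzMap.memLp _ _ _) v
    rw [← integral_add (hi g) (hi h)]
    exact integral_congr_ae (.of_forall fun x => mul_add _ _ _)
  map_smul' c g := by
    rw [RingHom.id_apply, smul_eq_mul, ← integral_const_mul]
    exact integral_congr_ae (.of_forall fun x => mul_left_comm _ _ _)

lemma schwartzFunctional_apply (a g : 𝓢(E n, ℂ)) :
    schwartzFunctional a g = ∫ x, a x * g x := rfl

lemma schwartzFunctional_zero : schwartzFunctional (0 : 𝓢(E n, ℂ)) = 0 := by
  ext g
  simp [schwartzFunctional_apply]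

lemma distLpENorm_schwartzFunctional (hp : 1 ≤ p) (a : 𝓢(E n, ℂ)) :
    distLpENorm p (schwartzFunctional a) = eLpNorm a p volume :=
  distLpENorm_eq_eLpNorm hp (a.memLp p volume) fun _ => rfl

lemma testToSchwartz_apply (φ : Test n) (x : E n) : testToSchwartz n φ x = φ x := rfl

lemma mulTest_apply (ψ : 𝓓((⊤ : TopologicalSpace.Opens (E n)), ℝ)) (g : 𝓢(E n, ℂ)) (x : E n) :
    mulTest ψ g x = (ψ x : ℂ) * g x := rfl

lemma conjTest_apply (φ : Test n) (x : E n) : conjTest φ x = conj (φ x) := rfl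

lemma mulTest_mulTest_comm (ψ χ : 𝓓((⊤ : TopologicalSpace.Opens (E n)), ℝ)) (g : 𝓢(E n, ℂ)) :
    mulTest ψ (testToSchwartz n (mulTest χ g)) = mulTest χ (testToSchwartz n (mulTest ψ g)) := by
  ext x
  exact mul_left_comm _ _ _

lemma mulTest_conjTest (ψ : 𝓓((⊤ : TopologicalSpace.Opens (E n)), ℝ)) (φ : Test n) :
    mulTest ψ (testToSchwartz n (conjTest φ)) =
      conjTest (mulTest ψ (testToSchwartz n φ)) := by
  ext x
  rw [mulTest_apply, testToSchwartz_apply, conjTest_apply, conjTest_apply, mulTest_apply, map_mul,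
    Complex.conj_ofReal]
  rfl

lemma conjTest_conjTest (φ : Test n) : conjTest (conjTest φ) = φ := by
  ext x
  exact Complex.conj_conj _

lemma conjTest_add (φ χ : Test n) : conjTest (φ + χ) = conjTest φ + conjTest χ := by
  ext x
  exact map_add (starRingEnd ℂ) _ _

lemma conjTest_smul (c : ℂ) (φ : Test n) : conjTest (c • φ) = conj c • conjTest φ := by
  ext x
  exact map_mul (starRingEnd ℂ) _ _

/-- The complex conjugate of a Schwartz function. -/
def conjSchwartz (g : 𝓢(E n, ℂ)) : 𝓢(E n, ℂ) :=
  SchwartzMap.postcompCLM (𝕜 := ℝ) (Complex.conjCLE : ℂ →L[ℝ] ℂ) g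

lemma conjSchwartz_apply (g : 𝓢(E n, ℂ)) (x : E n) : conjSchwartz g x = conj (g x) := rfl

lemma conjSchwartz_zero : conjSchwartz (0 : 𝓢(E n, ℂ)) = 0 := by
  ext x
  exact map_zero (starRingEnd ℂ)

lemma eLpNorm_conjSchwartz (g : 𝓢(E n, ℂ)) :
    eLpNorm (conjSchwartz g) p volume = eLpNorm g p volume :=
  eLpNorm_congr_norm_ae (.of_forall fun x => by rw [conjSchwartz_apply, RCLike.norm_conj])

lemma fourier_conjSchwartz (g : 𝓢(E n, ℂ)) (x : E n) :
    𝓕 (conjSchwartz g) x = conj (𝓕⁻ g x) := by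
  rw [SchwartzMap.fourier_coe, SchwartzMap.fourierInv_coe, Real.fourier_eq, Real.fourierInv_eq,
    ← integral_conj]
  refine integral_congr_ae (.of_forall fun v => ?_)
  simp only [conjSchwartz_apply, Circle.smul_def, smul_eq_mul, map_mul,
    Circle.starRingEnd_addChar]

lemma testToSchwartz_conjTest (φ : Test n) :
    testToSchwartz n (conjTest φ) = conjSchwartz (testToSchwartz n φ) := rfl

lemma eLpNorm_fourier_conjTest (φ : Test n) :
    eLpNorm (𝓕 (testToSchwartz n (conjTest φ)) : 𝓢(E n, ℂ)) p volume =
      eLpNorm (𝓕⁻ (testToSchwartz n φ) : 𝓢(E n, ℂ)) p volume := by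
  refine eLpNorm_congr_norm_ae (.of_forall fun x => ?_)
  rw [testToSchwartz_conjTest, fourier_conjSchwartz, RCLike.norm_conj]

lemma fourierInv_freqMult (ψ : 𝓓((⊤ : TopologicalSpace.Opens (E n)), ℝ)) (g : 𝓢(E n, ℂ)) :
    𝓕⁻ (freqMult ψ g) = testToSchwartz n (mulTest ψ (𝓕⁻ g)) :=
  FourierTransform.fourierInv_fourier_eq _

lemma ZDual.ext_fourier {f g : ZDual n} (h : ∀ φ, f.fourier φ = g.fourier φ) : f = g := by
  ext z
  obtain ⟨φ, rfl⟩ := fourierZ_surjective n z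
  exact h φ

lemma freqBlock_apply (ψ : 𝓓((⊤ : TopologicalSpace.Opens (E n)), ℝ)) (f : ZDual n)
    (g : 𝓢(E n, ℂ)) : freqBlock ψ f g = f.fourier (mulTest ψ (𝓕⁻ g)) := rfl

/-- By the multiplication formula, the distributional Fourier transform of `𝓕⁻¹φ` is `φ` itself. -/
lemma zOfTest_fourier (φ χ : Test n) :
    (zOfTest φ).fourier χ = ∫ x, φ x * χ x := by
  have h := SchwartzMap.integral_fourier_mul_eq (testToSchwartz n χ) (𝓕⁻ (testToSchwartz n φ))
  rw [FourierTransform.fourier_fourierInv_eq] at h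
  calc (zOfTest φ).fourier χ
      = ∫ x, (𝓕⁻ (testToSchwartz n φ)) x * (𝓕 (testToSchwartz n χ)) x := rfl
    _ = ∫ x, (𝓕 (testToSchwartz n χ)) x * (𝓕⁻ (testToSchwartz n φ)) x :=
      integral_congr_ae (.of_forall fun x => mul_comm _ _)
    _ = ∫ x, testToSchwartz n χ x * testToSchwartz n φ x := h
    _ = ∫ x, φ x * χ x := integral_congr_ae (.of_forall fun x => mul_comm _ _)

lemma zOfTest_add (φ χ : Test n) : zOfTest (φ + χ) = zOfTest φ + zOfTest χ := by
  refine ZDual.ext_fourier fun θ => ?_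
  have hi : ∀ v : Test n, Integrable (fun x => v x * θ x) volume := fun v =>
    integrable_mul_schwartz (p := 2) (q := 2) (SchwartzMap.memLp (testToSchwartz n v) _ _)
      (testToSchwartz n θ)
  change _ = (zOfTest φ).fourier θ + (zOfTest χ).fourier θ
  rw [zOfTest_fourier, zOfTest_fourier, zOfTest_fourier, ← integral_add (hi φ) (hi χ)]
  exact integral_congr_ae (.of_forall fun x => add_mul _ _ _)

lemma zOfTest_smul (c : ℂ) (φ : Test n) : zOfTest (c • φ) = c • zOfTest φ := by
  refine ZDual.ext_fourier fun θ => ?_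
  change _ = c • (zOfTest φ).fourier θ
  rw [zOfTest_fourier, zOfTest_fourier, smul_eq_mul, ← integral_const_mul]
  exact integral_congr_ae (.of_forall fun x => mul_assoc _ _ _)

/-- The map `φ ↦ zOfTest φ` as a linear map. -/
def zOfTestₗ (n : ℕ) : Test n →ₗ[ℂ] ZDual n where
  toFun := zOfTest
  map_add' := zOfTest_add
  map_smul' := zOfTest_smul

/-- `freqBlock ψ` as a linear map. -/
def freqBlockₗ (ψ : 𝓓((⊤ : TopologicalSpace.Opens (E n)), ℝ)) :
    ZDual n →ₗ[ℂ] (𝓢(E n, ℂ) →ₗ[ℂ] ℂ) where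
  toFun := freqBlock ψ
  map_add' := freqBlock_add ψ
  map_smul' := freqBlock_smul ψ

lemma freqBlock_zOfTest (ψ : 𝓓((⊤ : TopologicalSpace.Opens (E n)), ℝ)) (φ : Test n) :
    freqBlock ψ (zOfTest φ) =
      schwartzFunctional (𝓕⁻ (testToSchwartz n (mulTest ψ (testToSchwartz n φ)))) := by
  ext g
  have h := SchwartzMap.integral_fourier_mul_eq (𝓕⁻ g)
    (𝓕⁻ (testToSchwartz n (mulTest ψ (testToSchwartz n φ))))
  rw [FourierTransform.fourier_fourierInv_eq, FourierTransform.fourier_fourierInv_eq] at h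
  rw [freqBlock_apply, zOfTest_fourier, schwartzFunctional_apply]
  calc ∫ x, φ x * mulTest ψ (𝓕⁻ g) x
      = ∫ x, (𝓕⁻ g) x * testToSchwartz n (mulTest ψ (testToSchwartz n φ)) x := by
        refine integral_congr_ae (.of_forall fun x => ?_)
        simp only [mulTest_apply, testToSchwartz_apply]
        ring
    _ = _ := h.symm
    _ = _ := integral_congr_ae (.of_forall fun x => mul_comm _ _)

/-- Writes the blocks of the function with spectrum `χ 𝓕a` in the form required by synthesis, with
`a` as the piece. -/
lemma freqBlock_zOfTest_mulTest (ψ χ : 𝓓((⊤ : TopologicalSpace.Opens (E n)), ℝ))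
    (a : 𝓢(E n, ℂ)) : freqBlock ψ (zOfTest (mulTest χ (𝓕 a))) =
      schwartzFunctional a ∘ₗ freqMult χ ∘ₗ freqMult ψ := by
  ext g
  rw [freqBlock_apply, zOfTest_fourier, LinearMap.comp_apply, LinearMap.comp_apply,
    schwartzFunctional_apply]
  have h := SchwartzMap.integral_fourier_mul_eq
    (testToSchwartz n (mulTest χ (𝓕⁻ (freqMult ψ g)))) a
  calc ∫ x, mulTest χ (𝓕 a) x * mulTest ψ (𝓕⁻ g) x
      = ∫ x, testToSchwartz n (mulTest χ (𝓕⁻ (freqMult ψ g))) x * (𝓕 a) x := by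
        refine integral_congr_ae (.of_forall fun x => ?_)
        simp only [mulTest_apply, testToSchwartz_apply, fourierInv_freqMult]
        ring
    _ = _ := h.symm
    _ = _ := integral_congr_ae (.of_forall fun x => mul_comm _ _)

lemma enorm_apply_le_distLpENorm_mul [hp1 : Fact (1 ≤ p)] [hpp : p.HolderConjugate p']
    (u : 𝓢(E n, ℂ) →ₗ[ℂ] ℂ) (g : 𝓢(E n, ℂ)) :
    ‖u g‖ₑ ≤ distLpENorm p' u * eLpNorm g p volume := by
  rcases eq_or_ne (eLpNorm g p volume) 0 with h0 | h0
  · have hg : g = 0 := by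
      rw [eLpNorm_eq_zero_iff g.continuous.aestronglyMeasurable
        (zero_lt_one.trans_le hp1.out).ne'] at h0
      ext x
      exact congrFun (Continuous.ae_eq_iff_eq volume g.continuous continuous_const |>.1 h0) x
    simp [hg]
  by_cases hu : distLpENorm p' u = ∞
  · rw [hu, ENNReal.top_mul h0]
    exact le_top
  obtain ⟨h, hh, hhu⟩ := exists_memLp_eq_integral_of_distLpENorm_lt_top (lt_top_iff_ne_top.2 hu)
  have : p'.HolderConjugate p := inferInstance
  rw [distLpENorm_eq_eLpNorm (ENNReal.HolderConjugate.one_le p' p) hh hhu, hhu]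
  refine (enorm_integral_le_lintegral_enorm _).trans ?_
  rw [← eLpNorm_one_eq_lintegral_enorm]
  exact eLpNorm_smul_le_mul_eLpNorm (φ := h) (f := g) (p := p') (q := p)
    g.continuous.aestronglyMeasurable hh.1

lemma distLpENorm_sum_le [Fact (1 ≤ p)] {I : Type*} (F : Finset I)
    (u : I → 𝓢(E n, ℂ) →ₗ[ℂ] ℂ) :
    distLpENorm p (∑ i ∈ F, u i) ≤ ∑ i ∈ F, distLpENorm p (u i) := by
  classical
  induction F using Finset.induction_on with
  | empty => simp [distLpENorm_zero]
  | insert i F hi ih =>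
    rw [Finset.sum_insert hi, Finset.sum_insert hi]
    exact (distLpENorm_add_le _ _).trans (by gcongr)

/-- Smooth functions of compact support are dense in `L^p` for `p < ∞`; one is chosen close to the
function representing `u`. -/
lemma exists_distLpENorm_sub_schwartzFunctional_le [hp1 : Fact (1 ≤ p)] (hp : p ≠ ∞)
    {u : 𝓢(E n, ℂ) →ₗ[ℂ] ℂ} (hu : distLpENorm p u ≠ ∞) {ε : ℝ≥0∞} (hε : ε ≠ 0) :
    ∃ a : 𝓢(E n, ℂ), distLpENorm p (u - schwartzFunctional a) ≤ ε := by
  obtain ⟨h, hh, hhu⟩ := exists_memLp_eq_integral_of_distLpENorm_lt_top (lt_top_iff_ne_top.2 hu)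
  obtain ⟨r, hr0, hr⟩ := ENNReal.lt_iff_exists_nnreal_btwn.1 (pos_iff_ne_zero.2 hε)
  obtain ⟨g₀, hg₁, hg₂, hg₃⟩ := hh.exist_eLpNorm_sub_le hp hp1.out (ε := (r : ℝ))
    (NNReal.coe_pos.2 (ENNReal.coe_pos.1 hr0))
  set g : 𝓢(E n, ℂ) := hg₁.toSchwartzMap hg₂
  have hg : eLpNorm (h - ⇑g) p volume ≤ ε := by
    rw [ENNReal.ofReal_coe_nnreal] at hg₃
    exact hg₃.trans hr.le
  refine ⟨g, ?_⟩
  have hpp : p.HolderConjugate p.conjExponent := ENNReal.HolderConjugate.conjExponent hp1.out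
  rw [distLpENorm_eq_eLpNorm (h := h - ⇑g) hp1.out (hh.sub (g.memLp p volume))]
  · exact hg
  · intro v
    rw [LinearMap.sub_apply, hhu, schwartzFunctional_apply, ← integral_sub
      (integrable_mul_schwartz (q := p.conjExponent) hh v)
      (integrable_mul_schwartz (q := p.conjExponent) (g.memLp p volume) v)]
    exact integral_congr_ae (.of_forall fun x => (sub_mul _ _ _).symm)

end TestAlgebra

/-! ### Analysis and synthesis with two partitions of unity -/

section Blocks

variable {n : ℕ} {𝔤 : Type*} [LieRing 𝔤] [LieAlgebra ℝ 𝔤]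
  {G : AdmissibleLieGroup n 𝔤} {α : ℝ} {I κ : Type*} {p p' q q' : ℝ≥0∞}

namespace AlphaModData

variable (d : AlphaModData G α I) (d' : AlphaModData G α κ)

lemma mem_P_of_ψ_ne_zero {i : I} {x : E n} (h : d.ψ i x ≠ 0) : x ∈ d.P i :=
  d.isBAPU.tsupport_subset i (subset_tsupport _ h)

lemma sum_ψ_eq_one {J : Finset I} {x : E n} (h : ∀ i, x ∈ d.P i → i ∈ J) :
    ∑ i ∈ J, (d.ψ i x : ℂ) = 1 := by
  have h1 : ∑ i ∈ J, d.ψ i x = 1 := by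
    refine (hasSum_sum_of_ne_finset_zero fun i hi => ?_).unique (d.isBAPU.hasSum_one x)
    by_contra hne
    exact hi (h i (d.mem_P_of_ψ_ne_zero hne))
  exact_mod_cast h1

lemma sum_mulTest_eq {J : Finset I} {φ : Test n}
    (h : ∀ x, φ x ≠ 0 → ∀ i, x ∈ d.P i → i ∈ J) :
    ∑ i ∈ J, mulTest (d.ψ i) (testToSchwartz n φ) = φ := by
  ext x
  have hev : (∑ i ∈ J, mulTest (d.ψ i) (testToSchwartz n φ)) x =
      ∑ i ∈ J, (d.ψ i x : ℂ) * φ x := by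
    rw [FunLike.coe_sum, Finset.sum_apply]
    rfl
  rw [hev, ← Finset.sum_mul]
  rcases eq_or_ne (φ x) 0 with hz | hz
  · simp [hz]
  rw [d.sum_ψ_eq_one (h x hz), one_mul]

/-- A compact set meets finitely many sets of the covering, so one finite index set serves all test
functions supported in it. This uniformity later yields continuity in the LF topology. -/
lemma exists_finset_sum_mulTest_eq {K : Set (E n)} (hK : IsCompact K) :
    ∃ J : Finset I, ∀ φ : Test n, (∀ x, φ x ≠ 0 → x ∈ K) →
      ∑ i ∈ J, mulTest (d.ψ i) (testToSchwartz n φ) = φ := by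
  classical
  obtain ⟨N, hN⟩ := d.isAlphaCovering.admissible
  obtain ⟨J, hJ⟩ := hK.elim_finite_subcover d.P d.isAlphaCovering.isOpen
    (by rw [d.isAlphaCovering.covers]; exact Set.subset_univ _)
  have hfin : (⋃ j ∈ J, {i | (d.P j ∩ d.P i).Nonempty}).Finite :=
    J.finite_toSet.biUnion fun j _ => Set.finite_of_encard_le_coe (hN j)
  refine ⟨hfin.toFinset, fun φ hφ => d.sum_mulTest_eq fun x hx i hi => ?_⟩
  obtain ⟨j, hj, hxj⟩ := Set.mem_iUnion₂.1 (hJ (hφ x hx))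
  exact hfin.mem_toFinset.2 (Set.mem_iUnion₂.2 ⟨j, hj, x, hxj, hi⟩)

lemma exists_finset_sum_mulTest_eq_self (φ : Test n) :
    ∃ J : Finset I, ∑ i ∈ J, mulTest (d.ψ i) (testToSchwartz n φ) = φ := by
  obtain ⟨J, hJ⟩ := d.exists_finset_sum_mulTest_eq φ.hasCompactSupport
  exact ⟨J, hJ φ fun x hx => subset_tsupport _ hx⟩

lemma finite_nbhd (hα0 : 0 ≤ α) (i : I) : (d.nbhd d' i).Finite := by
  obtain ⟨N, hN⟩ := d.exists_encard_le d' hα0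
  exact Set.finite_of_encard_le_coe (hN i)

lemma sum_nbhd_mulTest_mulTest (hα0 : 0 ≤ α) (i : I) (g : 𝓢(E n, ℂ)) :
    ∑ j ∈ (d.finite_nbhd d' hα0 i).toFinset,
      mulTest (d'.ψ j) (testToSchwartz n (mulTest (d.ψ i) g)) = mulTest (d.ψ i) g := by
  refine d'.sum_mulTest_eq fun x hx j hj => ?_
  refine (Set.Finite.mem_toFinset _).2 ⟨x, d.mem_P_of_ψ_ne_zero fun h0 => hx ?_, hj⟩
  rw [mulTest_apply, h0, Complex.ofReal_zero, zero_mul]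

lemma mulTest_mulTest_eq_zero {i : I} {j : κ} (h : j ∉ d.nbhd d' i) (g : 𝓢(E n, ℂ)) :
    mulTest (d'.ψ j) (testToSchwartz n (mulTest (d.ψ i) g)) = 0 := by
  ext x
  change (d'.ψ j x : ℂ) * ((d.ψ i x : ℂ) * g x) = 0
  by_cases h1 : d.ψ i x = 0
  · simp [h1]
  by_cases h2 : d'.ψ j x = 0
  · simp [h2]
  exact absurd ⟨x, d.mem_P_of_ψ_ne_zero h1, d'.mem_P_of_ψ_ne_zero h2⟩ h

lemma freqMult_comp_freqMult_eq_zero {i : I} {j : κ} (h : j ∉ d.nbhd d' i) :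
    freqMult (d'.ψ j) ∘ₗ freqMult (d.ψ i) = 0 := by
  refine LinearMap.ext fun g => ?_
  change fourierTest n (mulTest (d'.ψ j) (𝓕⁻ (freqMult (d.ψ i) g))) = 0
  rw [fourierInv_freqMult, d.mulTest_mulTest_eq_zero d' h, map_zero]

lemma exists_distLpENorm_comp_freqMult_le [Fact (1 ≤ p)] (hp : p ≠ ∞) :
    ∃ C : ℝ≥0∞, C ≠ ∞ ∧ ∀ i u, distLpENorm p (u ∘ₗ freqMult (d.ψ i)) ≤ C * distLpENorm p u := by
  obtain ⟨C, hC⟩ := d.isBAPU.bounded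
  exact ⟨ENNReal.ofReal C, ENNReal.ofReal_ne_top, fun i u =>
    distLpENorm_comp_freqMult_le hp (d.ψ i) u (hC i)⟩

/-- Synthesis: functionals `u j` with `f = ∑ j, u j ∘ freqMult (ψ' j)` control the norm of `f`. -/
lemma exists_alphaModENorm_le_of_freqBlock_eq (hα0 : 0 ≤ α) (hα1 : α ≤ 1) (s : ℝ)
    [Fact (1 ≤ p)] [hq1 : Fact (1 ≤ q)] (hp : p ≠ ∞) (hq : q ≠ ∞) :
    ∃ C : ℝ≥0∞, C ≠ ∞ ∧ ∀ (u : κ → 𝓢(E n, ℂ) →ₗ[ℂ] ℂ) (f : ZDual n),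
      (∀ i, freqBlock (d.ψ i) f = ∑ j ∈ (d.finite_nbhd d' hα0 i).toFinset,
        u j ∘ₗ freqMult (d'.ψ j) ∘ₗ freqMult (d.ψ i)) →
      alphaModENorm d s p q f ≤ C * lqENorm q fun j => d'.weight s j * distLpENorm p (u j) := by
  obtain ⟨C₁, hC₁, h₁⟩ := d.exists_distLpENorm_comp_freqMult_le hp
  obtain ⟨C₂, hC₂, h₂⟩ := d'.exists_distLpENorm_comp_freqMult_le hp
  obtain ⟨C, hC, h⟩ := d.exists_lqENorm_nbhd_le d' hα0 hα1 s hq1.out hq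
  refine ⟨C₁ * C₂ * C, by finiteness, fun u f hf => ?_⟩
  -- Each block is a sum over neighbours of a piece composed with one multiplier from each
  -- partition, which costs the constants `C₂` and `C₁`.
  have key : ∀ i, distLpENorm p (freqBlock (d.ψ i) f) ≤
      C₁ * C₂ * ∑' j, (d.nbhd d' i).indicator (fun j => distLpENorm p (u j)) j := by
    intro i
    rw [hf i, tsum_eq_sum (s := (d.finite_nbhd d' hα0 i).toFinset), Finset.mul_sum]
    · refine (distLpENorm_sum_le _ _).trans (Finset.sum_le_sum fun j hj => ?_)
      rw [Set.indicator_of_mem ((Set.Finite.mem_toFinset _).1 hj), mul_assoc,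
        ← LinearMap.comp_assoc]
      refine (h₁ i _).trans ?_
      gcongr
      exact h₂ j _
    · intro j hj
      exact Set.indicator_of_notMem (fun h => hj ((Set.Finite.mem_toFinset _).2 h)) _
  calc alphaModENorm d s p q f
      ≤ lqENorm q fun i => C₁ * C₂ * (d.weight s i *
          ∑' j, (d.nbhd d' i).indicator (fun j => distLpENorm p (u j)) j) := by
        refine lqENorm_mono q fun i => ?_
        rw [mul_left_comm]
        exact mul_le_mul_right (key i) _
    _ ≤ C₁ * C₂ * C * lqENorm q fun j => d'.weight s j * distLpENorm p (u j) := by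
        rw [lqENorm_const_mul hq1.out, mul_assoc _ C]
        gcongr
        exact h _

/-- The term of index `j` vanishes outside `J` because `a j = 0`, and outside the neighbourhood of
`i` because the two multipliers have disjoint supports. Both sums thus equal the sum over the union.
-/
lemma freqBlock_zOfTest_sum (hα0 : 0 ≤ α) {J : Finset κ} {a : κ → 𝓢(E n, ℂ)}
    (ha : ∀ j ∉ J, a j = 0) (i : I) :
    freqBlock (d.ψ i) (zOfTest (∑ j ∈ J, mulTest (d'.ψ j) (𝓕 (a j)))) =
      ∑ j ∈ (d.finite_nbhd d' hα0 i).toFinset,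
        schwartzFunctional (a j) ∘ₗ freqMult (d'.ψ j) ∘ₗ freqMult (d.ψ i) := by
  classical
  have h : freqBlock (d.ψ i) (zOfTest (∑ j ∈ J, mulTest (d'.ψ j) (𝓕 (a j)))) =
      ∑ j ∈ J, schwartzFunctional (a j) ∘ₗ freqMult (d'.ψ j) ∘ₗ freqMult (d.ψ i) := by
    change (freqBlockₗ (d.ψ i) ∘ₗ zOfTestₗ n) _ = _
    rw [map_sum]
    exact Finset.sum_congr rfl fun j _ => freqBlock_zOfTest_mulTest _ _ _
  rw [h]
  have h1 : ∀ j ∉ J, schwartzFunctional (a j) ∘ₗ freqMult (d'.ψ j) ∘ₗ freqMult (d.ψ i) = 0 := by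
    intro j hj
    rw [ha j hj, schwartzFunctional_zero, LinearMap.zero_comp]
  have h2 : ∀ j ∉ (d.finite_nbhd d' hα0 i).toFinset,
      schwartzFunctional (a j) ∘ₗ freqMult (d'.ψ j) ∘ₗ freqMult (d.ψ i) = 0 := by
    intro j hj
    rw [d.freqMult_comp_freqMult_eq_zero d' fun h => hj ((Set.Finite.mem_toFinset _).2 h),
      LinearMap.comp_zero]
  rw [Finset.sum_subset (Finset.subset_union_left (s₂ := (d.finite_nbhd d' hα0 i).toFinset))
      fun j _ hj => h1 j hj,
    Finset.sum_subset (Finset.subset_union_right (s₁ := J)) fun j _ hj => h2 j hj]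

lemma exists_alphaModENorm_zOfTest_le (hα0 : 0 ≤ α) (hα1 : α ≤ 1) (s : ℝ)
    [hp1 : Fact (1 ≤ p)] [Fact (1 ≤ q)] (hp : p ≠ ∞) (hq : q ≠ ∞) :
    ∃ C : ℝ≥0∞, C ≠ ∞ ∧ ∀ (J : Finset κ) (a : κ → 𝓢(E n, ℂ)), (∀ j ∉ J, a j = 0) →
      alphaModENorm d s p q (zOfTest (∑ j ∈ J, mulTest (d'.ψ j) (𝓕 (a j)))) ≤
        C * lqENorm q fun j => d'.weight s j * eLpNorm (a j) p volume := by
  obtain ⟨C, hC, h⟩ := d.exists_alphaModENorm_le_of_freqBlock_eq d' hα0 hα1 s hp hq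
  refine ⟨C, hC, fun J a ha => ?_⟩
  refine (h _ _ (d.freqBlock_zOfTest_sum d' hα0 ha)).trans_eq ?_
  simp only [distLpENorm_schwartzFunctional hp1.out]

/-- Synthesis with the single piece `𝓕⁻¹φ` repeated over the finitely many indices that see `K`; the
constant absorbs the `ℓ^q` norm of their weights. -/
lemma exists_alphaModENorm_zOfTest_le_of_isCompact (hα0 : 0 ≤ α) (hα1 : α ≤ 1) (s : ℝ)
    [hp1 : Fact (1 ≤ p)] [hq1 : Fact (1 ≤ q)] (hp : p ≠ ∞) (hq : q ≠ ∞) {K : Set (E n)}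
    (hK : IsCompact K) :
    ∃ C : ℝ≥0∞, C ≠ ∞ ∧ ∀ φ : Test n, (∀ x, φ x ≠ 0 → x ∈ K) →
      alphaModENorm d s p q (zOfTest φ) ≤
        C * eLpNorm (𝓕⁻ (testToSchwartz n φ) : 𝓢(E n, ℂ)) p volume := by
  classical
  obtain ⟨C, hC, h⟩ := d.exists_alphaModENorm_zOfTest_le (p := p) (q := q) d hα0 hα1 s hp hq
  obtain ⟨J, hJ⟩ := d.exists_finset_sum_mulTest_eq hK
  refine ⟨C * lqENorm q fun j => if j ∈ J then d.weight s j else 0,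
    ENNReal.mul_ne_top hC (lqENorm_ne_top_of_finset hq1.out (J := J) (fun j hj => if_neg hj)
      fun j => ?_), fun φ hφ => ?_⟩
  · split_ifs
    exacts [d.weight_ne_top s j, ENNReal.zero_ne_top]
  have ha : ∀ j ∉ J, (if j ∈ J then 𝓕⁻ (testToSchwartz n φ) else 0 : 𝓢(E n, ℂ)) = 0 :=
    fun j hj => if_neg hj
  have h1 := h J _ ha
  have h2 : ∑ j ∈ J, mulTest (d.ψ j)
      (𝓕 (if j ∈ J then 𝓕⁻ (testToSchwartz n φ) else 0 : 𝓢(E n, ℂ))) = φ := by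
    refine Eq.trans (Finset.sum_congr rfl fun j hj => ?_) (hJ φ hφ)
    rw [if_pos hj, FourierTransform.fourier_fourierInv_eq]
  rw [h2] at h1
  refine h1.trans ?_
  rw [mul_assoc, mul_comm (lqENorm _ _)]
  refine mul_le_mul_right ?_ _
  rw [← lqENorm_const_mul hq1.out]
  refine lqENorm_mono q fun j => ?_
  by_cases hj : j ∈ J
  · simp only [if_pos hj]
    rw [mul_comm]
  · simp only [if_neg hj]
    rw [FunLike.coe_zero, eLpNorm_zero, mul_zero]
    exact zero_le

lemma zOfTest_mem (hα0 : 0 ≤ α) (hα1 : α ≤ 1) (s : ℝ) [hp1 : Fact (1 ≤ p)]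
    [hq1 : Fact (1 ≤ q)] (hp : p ≠ ∞) (hq : q ≠ ∞) (φ : Test n) :
    zOfTest φ ∈ alphaModSubmodule d s p q := by
  obtain ⟨C, hC, h⟩ := d.exists_alphaModENorm_zOfTest_le_of_isCompact (p := p) (q := q)
    hα0 hα1 s hp hq φ.hasCompactSupport
  exact (h φ fun x hx => subset_tsupport _ hx).trans_lt
    (ENNReal.mul_lt_top hC.lt_top (SchwartzMap.memLp _ _ _).2)

/-- The pairing of a test function with an element of the dual space is bounded. -/
lemma exists_enorm_fourier_conjTest_le (hα0 : 0 ≤ α) (hα1 : α ≤ 1) (s : ℝ)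
    [hp1 : Fact (1 ≤ p)] [hq1 : Fact (1 ≤ q)] (hq : q ≠ ∞)
    [p.HolderConjugate p'] [q.HolderConjugate q'] :
    ∃ C : ℝ≥0∞, C ≠ ∞ ∧ ∀ (f : ZDual n) (φ : Test n),
      ‖f.fourier (conjTest φ)‖ₑ ≤
        C * alphaModENorm d' (-s) p' q' f * alphaModENorm d s p q (zOfTest φ) := by
  obtain ⟨C, hC, h⟩ := d'.exists_lqENorm_nbhd_le d hα0 hα1 s hq1.out hq
  refine ⟨C, hC, fun f φ => ?_⟩
  set A' : κ → ℝ≥0∞ := fun j => distLpENorm p' (freqBlock (d'.ψ j) f)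
  set A : I → ℝ≥0∞ := fun i => distLpENorm p (freqBlock (d.ψ i) (zOfTest φ)) with hA
  obtain ⟨J, hJ⟩ := d'.exists_finset_sum_mulTest_eq_self (conjTest φ)
  -- The factor `ψ'_j` is given to `f` and `ψ_i` to `φ`; Hölder's inequality in `L^p` bounds the
  -- pairing of the two blocks.
  have hblock : ∀ j i, ‖f.fourier (mulTest (d.ψ i) (testToSchwartz n (mulTest (d'.ψ j)
      (testToSchwartz n (conjTest φ)))))‖ₑ ≤ A' j * A i := by
    intro j i
    have h1 := enorm_apply_le_distLpENorm_mul (p := p) (p' := p') (freqBlock (d'.ψ j) f)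
      (𝓕 (testToSchwartz n (conjTest (mulTest (d.ψ i) (testToSchwartz n φ)))))
    rw [freqBlock_apply, FourierTransform.fourierInv_fourier_eq, eLpNorm_fourier_conjTest,
      ← distLpENorm_schwartzFunctional hp1.out, ← freqBlock_zOfTest, ← mulTest_conjTest] at h1
    rw [mulTest_mulTest_comm]
    exact h1
  have hterm : ∀ j, ‖f.fourier (mulTest (d'.ψ j) (testToSchwartz n (conjTest φ)))‖ₑ ≤
      A' j * ∑' i, (d'.nbhd d j).indicator A i := by
    intro j
    rw [← d'.sum_nbhd_mulTest_mulTest d hα0 j, map_sum,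
      tsum_eq_sum (s := (d'.finite_nbhd d hα0 j).toFinset), Finset.mul_sum]
    · refine (enorm_sum_le _ _).trans (Finset.sum_le_sum fun i hi => ?_)
      rw [Set.indicator_of_mem ((Set.Finite.mem_toFinset _).1 hi)]
      exact hblock j i
    · intro i hi
      exact Set.indicator_of_notMem (fun h => hi ((Set.Finite.mem_toFinset _).2 h)) _
  have : q'.HolderConjugate q := inferInstance
  calc ‖f.fourier (conjTest φ)‖ₑ
      ≤ ∑ j ∈ J, A' j * ∑' i, (d'.nbhd d j).indicator A i := by
        conv_lhs => rw [← hJ, map_sum]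
        exact (enorm_sum_le _ _).trans (Finset.sum_le_sum fun j _ => hterm j)
    -- The weights of order `s` and `-s` multiply to `1`, which prepares Hölder's inequality in
    -- `ℓ^q`.
    _ = ∑ j ∈ J, (d'.weight s j * ∑' i, (d'.nbhd d j).indicator A i) *
          (d'.weight (-s) j * A' j) := by
        refine Finset.sum_congr rfl fun j _ => ?_
        rw [mul_mul_mul_comm, d'.weight_mul_weight_neg, one_mul, mul_comm]
    _ ≤ lqENorm q (fun j => d'.weight s j * ∑' i, (d'.nbhd d j).indicator A i) *
          lqENorm q' fun j => d'.weight (-s) j * A' j :=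
        sum_mul_le_lqENorm_mul_lqENorm hq J _ _
    _ ≤ (C * lqENorm q fun i => d.weight s i * A i) *
          lqENorm q' fun j => d'.weight (-s) j * A' j := by
        gcongr
        exact h A
    _ = C * alphaModENorm d' (-s) p' q' f * alphaModENorm d s p q (zOfTest φ) := by
        rw [mul_right_comm]
        rfl

end AlphaModData

end Blocks

/-! ### Density of the test functions -/

section Density

variable {n : ℕ} {𝔤 : Type*} [LieRing 𝔤] [LieAlgebra ℝ 𝔤]
  {G : AdmissibleLieGroup n 𝔤} {α : ℝ} {I κ : Type*} {p p' q q' : ℝ≥0∞}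

namespace AlphaModData

variable (d : AlphaModData G α I) (d' : AlphaModData G α κ)

/-- The sum of the frequency blocks of `f` whose supports meet the `i`-th set of the covering. -/
def fatBlock (hα0 : 0 ≤ α) (f : ZDual n) (i : I) : 𝓢(E n, ℂ) →ₗ[ℂ] ℂ :=
  ∑ m ∈ (d.finite_nbhd d hα0 i).toFinset, freqBlock (d.ψ m) f

/-- The neighbouring `ψ_m` sum to `1` on the support of `ψ_i`, so after the multiplier `ψ_i` the fat
block acts as `f` itself. -/
lemma fatBlock_freqMult (hα0 : 0 ≤ α) (f : ZDual n) (i : I) (g : 𝓢(E n, ℂ)) :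
    d.fatBlock hα0 f i (freqMult (d.ψ i) g) = f.fourier (mulTest (d.ψ i) (𝓕⁻ g)) := by
  rw [fatBlock, LinearMap.sum_apply]
  simp only [freqBlock_apply, fourierInv_freqMult]
  rw [← map_sum, d.sum_nbhd_mulTest_mulTest d hα0]

/-- Puts `f` in the form required by synthesis, with its fat blocks as pieces, so that approximating
each fat block in `L^p` approximates `f`. -/
lemma freqBlock_eq_sum_fatBlock (hα0 : 0 ≤ α) (f : ZDual n) (k : I) :
    freqBlock (d.ψ k) f = ∑ i ∈ (d.finite_nbhd d hα0 k).toFinset,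
      d.fatBlock hα0 f i ∘ₗ freqMult (d.ψ i) ∘ₗ freqMult (d.ψ k) := by
  ext g
  rw [LinearMap.sum_apply]
  simp only [LinearMap.comp_apply, fatBlock_freqMult, fourierInv_freqMult]
  rw [← map_sum, d.sum_nbhd_mulTest_mulTest d hα0, freqBlock_apply]

lemma lqENorm_fatBlock_ne_top (hα0 : 0 ≤ α) (hα1 : α ≤ 1) (s : ℝ)
    [Fact (1 ≤ p)] [hq1 : Fact (1 ≤ q)] (hq : q ≠ ∞) {f : ZDual n}
    (hf : alphaModENorm d s p q f ≠ ∞) :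
    lqENorm q (fun i => d.weight s i * distLpENorm p (d.fatBlock hα0 f i)) ≠ ∞ := by
  obtain ⟨C, hC, h⟩ := d.exists_lqENorm_nbhd_le d hα0 hα1 s hq1.out hq
  have h1 := h fun i => distLpENorm p (freqBlock (d.ψ i) f)
  refine (lt_of_le_of_lt (lqENorm_mono q fun i => ?_)
    (h1.trans_lt (ENNReal.mul_lt_top hC.lt_top hf.lt_top))).ne
  gcongr
  rw [tsum_eq_sum (s := (d.finite_nbhd d hα0 i).toFinset)]
  · refine (distLpENorm_sum_le _ _).trans (Finset.sum_le_sum fun j hj => ?_)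
    rw [Set.indicator_of_mem ((Set.Finite.mem_toFinset _).1 hj)]
  · intro j hj
    exact Set.indicator_of_notMem (fun h => hj ((Set.Finite.mem_toFinset _).2 h)) _

lemma weight_ne_zero (s : ℝ) (i : I) : d.weight s i ≠ 0 := fun h => by
  have := d.weight_mul_weight_neg s i
  rw [h, zero_mul] at this
  exact zero_ne_one this

/-- Replace the fat blocks by Schwartz functions for finitely many indices and by zero for the
others. The error is synthesized from the differences of the pieces, whose weighted norm is made
small by approximation in `L^p` and by the smallness of the tail. -/
lemma exists_alphaModENorm_sub_zOfTest_le (hα0 : 0 ≤ α) (hα1 : α ≤ 1) (s : ℝ)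
    [hp1 : Fact (1 ≤ p)] [hq1 : Fact (1 ≤ q)] (hp : p ≠ ∞) (hq : q ≠ ∞) {f : ZDual n}
    (hf : alphaModENorm d s p q f ≠ ∞) {ε : ℝ≥0∞} (hε : ε ≠ 0) :
    ∃ φ : Test n, alphaModENorm d s p q (f - zOfTest φ) ≤ ε := by
  classical
  obtain ⟨C, hC, h⟩ := d.exists_alphaModENorm_le_of_freqBlock_eq (p := p) (q := q) d
    hα0 hα1 s hp hq
  have hU := d.lqENorm_fatBlock_ne_top hα0 hα1 s hq hf
  have hUi : ∀ i, distLpENorm p (d.fatBlock hα0 f i) ≠ ∞ := by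
    intro i hi
    have h1 := le_lqENorm hq1.out
      (fun i => d.weight s i * distLpENorm p (d.fatBlock hα0 f i)) i
    rw [hi, ENNReal.mul_top (d.weight_ne_zero s i), top_le_iff] at h1
    exact hU h1
  -- Dividing by the synthesis constant `C` here, and by the weight when choosing `a i`, makes the
  -- final error exactly `ε`.
  have hε' : ε / C ≠ 0 := ENNReal.div_ne_zero.2 ⟨hε, hC⟩
  obtain ⟨F, δ, hδ, hF⟩ := exists_finset_forall_lqENorm_le hq1.out hq hU hε'
  choose a ha using fun i => exists_distLpENorm_sub_schwartzFunctional_le hp (hUi i)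
    (ENNReal.div_ne_zero.2 ⟨hδ, d.weight_ne_top s i⟩)
  set b : I → 𝓢(E n, ℂ) := fun i => if i ∈ F then a i else 0
  have hb : ∀ i ∉ F, b i = 0 := fun i hi => if_neg hi
  refine ⟨∑ i ∈ F, mulTest (d.ψ i) (𝓕 (b i)), ?_⟩
  have h1 := h (fun i => d.fatBlock hα0 f i - schwartzFunctional (b i))
    (f - zOfTest (∑ i ∈ F, mulTest (d.ψ i) (𝓕 (b i)))) fun k => by
      change freqBlockₗ (d.ψ k) _ = _
      rw [map_sub]
      change freqBlock (d.ψ k) _ - freqBlock (d.ψ k) _ = _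
      rw [d.freqBlock_zOfTest_sum d hα0 hb, d.freqBlock_eq_sum_fatBlock hα0 f k,
        ← Finset.sum_sub_distrib]
      exact Finset.sum_congr rfl fun i _ => (LinearMap.sub_comp _ _ _).symm
  refine h1.trans ?_
  calc C * _ ≤ C * (ε / C) := by
        gcongr
        refine hF _ (fun i hi => ?_) fun i hi => ?_
        · simp only [b, if_pos hi]
          calc _ ≤ d.weight s i * (δ / d.weight s i) := by
                gcongr
                exact ha i
            _ ≤ δ := ENNReal.mul_div_le
        · simp only [b, if_neg hi, schwartzFunctional_zero, sub_zero, le_refl]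
    _ ≤ ε := ENNReal.mul_div_le

/-- The map `φ ↦ zOfTest φ` with values in the space `M^{s,α}_{p,q}(G)`. -/
def zTest (hα0 : 0 ≤ α) (hα1 : α ≤ 1) (s : ℝ) [Fact (1 ≤ p)] [Fact (1 ≤ q)] (hp : p ≠ ∞)
    (hq : q ≠ ∞) : Test n →ₗ[ℂ] AlphaModSpace d s p q :=
  (zOfTestₗ n).codRestrict (alphaModSubmodule d s p q) (d.zOfTest_mem hα0 hα1 s hp hq)

lemma enorm_eq (s : ℝ) [Fact (1 ≤ p)] [Fact (1 ≤ q)] (f : AlphaModSpace d s p q) :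
    ‖f‖ₑ = alphaModENorm d s p q f.1 := by
  rw [← ofReal_norm]
  exact ENNReal.ofReal_toReal (ne_of_lt f.2)

lemma denseRange_zTest (hα0 : 0 ≤ α) (hα1 : α ≤ 1) (s : ℝ) [Fact (1 ≤ p)] [Fact (1 ≤ q)]
    (hp : p ≠ ∞) (hq : q ≠ ∞) :
    DenseRange (d.zTest (p := p) (q := q) hα0 hα1 s hp hq) := by
  intro f
  rw [EMetric.mem_closure_iff]
  intro ε hε
  obtain ⟨δ, hδ0, hδ⟩ := exists_between hε
  obtain ⟨φ, hφ⟩ := d.exists_alphaModENorm_sub_zOfTest_le hα0 hα1 s hp hq (ne_of_lt f.2) hδ0.ne'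
  refine ⟨_, ⟨φ, rfl⟩, lt_of_le_of_lt ?_ hδ⟩
  rw [edist_eq_enorm_sub, enorm_eq]
  exact hφ

end AlphaModData

end Density

/-! ### Functionals on test functions -/

section Functionals

variable {n : ℕ} {p p' : ℝ≥0∞}

lemma conjTest_mulTest_fourierInv (ψ : 𝓓((⊤ : TopologicalSpace.Opens (E n)), ℝ))
    (g : 𝓢(E n, ℂ)) : conjTest (mulTest ψ (𝓕⁻ g)) = mulTest ψ (𝓕 (conjSchwartz g)) := by
  ext x
  rw [conjTest_apply, mulTest_apply, mulTest_apply, fourier_conjSchwartz, map_mul,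
    Complex.conj_ofReal]

/-- `conjTest` as a conjugate-linear map. -/
def conjTestₗ (n : ℕ) : Test n →ₗ⋆[ℂ] Test n where
  toFun := conjTest
  map_add' := conjTest_add
  map_smul' := conjTest_smul

lemma exists_zDual_fourier_eq (L : Test n →L[ℂ] ℂ) : ∃ f : ZDual n, ∀ φ, f.fourier φ = L φ := by
  set e : Test n ≃ₗ[ℂ] ZSpace n :=
    LinearEquiv.ofBijective (fourierZ n) ⟨fourierZ_injective n, fourierZ_surjective n⟩
  have he : ∀ φ, e.symm (fourierZ n φ) = φ := fun φ => e.symm_apply_apply φ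
  refine ⟨⟨L.toLinearMap ∘ₗ e.symm.toLinearMap, ?_⟩, fun φ => ?_⟩
  · refine continuous_coinduced_dom.2 (L.continuous.congr fun φ => ?_)
    exact (congrArg L (he φ)).symm
  · exact congrArg L (he φ)

/-- Smooth functions supported in a fixed compact set, as Schwartz functions. -/
def supportedInToSchwartz (K : TopologicalSpace.Compacts (E n)) :
    𝓓_{K}(E n, ℂ) →ₗ[ℂ] 𝓢(E n, ℂ) where
  toFun f := f.hasCompactSupport.toSchwartzMap f.contDiff
  map_add' _ _ := rfl
  map_smul' _ _ := rfl

lemma continuous_supportedInToSchwartz (K : TopologicalSpace.Compacts (E n)) :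
    Continuous (supportedInToSchwartz K) := by
  obtain ⟨R, hR⟩ := K.isCompact.isBounded.exists_norm_le
  refine WithSeminorms.continuous_of_isBounded
    (ContDiffMapSupportedIn.withSeminorms ℂ (E n) ℂ ⊤ K)
    (schwartz_withSeminorms ℂ (E n) ℂ) _ (.of_real fun km => ?_)
  refine ⟨{km.2}, |R| ^ km.1, fun f => ?_⟩
  refine SchwartzMap.seminorm_le_bound ℂ km.1 km.2 _ (by positivity) fun x => ?_
  rw [Finset.sup_singleton]
  by_cases hx : x ∈ K
  · refine mul_le_mul ?_ ?_ (norm_nonneg _) (by positivity)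
    · exact pow_le_pow_left₀ (norm_nonneg _) ((hR x hx).trans (le_abs_self R)) _
    · exact ContDiffMapSupportedIn.norm_iteratedFDeriv_apply_le_seminorm_top ℂ
  · have h0 : iteratedFDeriv ℝ km.2 (supportedInToSchwartz K f) x = 0 :=
      f.iteratedFDeriv_zero_on_compl hx
    rw [h0, norm_zero, mul_zero]
    positivity

/-- Continuity in the LF topology is tested on each space of functions supported in a fixed compact
set. There the map into Schwartz space, the Fourier transform and the inclusion into `L^p` are all
continuous, so the bound gives continuity at zero. -/
lemma continuous_test_of_enorm_le [hp1 : Fact (1 ≤ p)] (L : Test n →ₗ[ℂ] ℂ)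
    (h : ∀ K : Set (E n), IsCompact K → ∃ C : ℝ≥0∞, C ≠ ∞ ∧ ∀ φ : Test n,
      (∀ x, φ x ≠ 0 → x ∈ K) →
        ‖L φ‖ₑ ≤ C * eLpNorm (𝓕 (testToSchwartz n φ) : 𝓢(E n, ℂ)) p volume) : Continuous L := by
  refine (TestFunction.continuous_iff_continuous_comp L).2 fun K hK => ?_
  obtain ⟨C, hC, hL⟩ := h K K.isCompact
  set T : 𝓓_{K}(E n, ℂ) → Lp ℂ p (volume : Measure (E n)) := fun f =>
    SchwartzMap.toLpCLM ℂ ℂ p volume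
      (FourierTransform.fourierCLM ℂ 𝓢(E n, ℂ) (supportedInToSchwartz K f)) with hT
  have hTc : Continuous T := by
    exact (ContinuousLinearMap.continuous _).comp
      ((ContinuousLinearMap.continuous _).comp (continuous_supportedInToSchwartz K))
  set L' : 𝓓_{K}(E n, ℂ) →ₗ[ℂ] ℂ := L ∘ₗ (TestFunction.ofSupportedInCLM ℂ hK).toLinearMap
  change Continuous L'
  refine continuous_of_continuousAt_zero L' ?_
  have hb : ∀ f, ‖L' f‖ ≤ C.toReal * ‖T f‖ := by
    intro f
    have h1 := hL (TestFunction.ofSupportedIn hK f) fun x hx => f.support_subset hx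
    have h2 : ‖T f‖ₑ = eLpNorm (𝓕 (testToSchwartz n (TestFunction.ofSupportedIn hK f)) :
        𝓢(E n, ℂ)) p volume := by
      rw [Lp.enorm_def]
      exact eLpNorm_congr_ae (SchwartzMap.coeFn_toLp _ _ _)
    rw [← h2] at h1
    have h3 := ENNReal.toReal_mono (by finiteness) h1
    rwa [ENNReal.toReal_mul, toReal_enorm, toReal_enorm] at h3
  rw [ContinuousAt, map_zero]
  refine squeeze_zero_norm hb ?_
  have h4 : Tendsto (fun f => C.toReal * ‖T f‖) (𝓝 0) (𝓝 (C.toReal * ‖T 0‖)) :=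
    (continuous_const.mul hTc.norm).tendsto 0
  have h5 : T 0 = 0 := by simp only [hT, map_zero]
  rwa [h5, norm_zero, mul_zero] at h4

lemma enorm_nnreal_complex (r : NNReal) : ‖(r : ℂ)‖ₑ = r := by
  rw [enorm_eq_nnnorm, ENNReal.coe_inj]
  ext
  rw [coe_nnnorm, Complex.norm_real, Real.norm_of_nonneg (NNReal.coe_nonneg _)]

/-- The norm need not be attained, but half of it is exceeded by some `g`. Rescaling makes the value
exactly `N / 2`, real and nonnegative, so that the contributions of different blocks add without
cancellation. -/
lemma exists_eLpNorm_le_one_apply_eq [Fact (1 ≤ p)] [Fact (1 ≤ p')] [p.HolderConjugate p']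
    (hp : p ≠ ∞) {u : 𝓢(E n, ℂ) →ₗ[ℂ] ℂ} {N : NNReal} (hu : distLpENorm p' u = N) :
    ∃ g : 𝓢(E n, ℂ), eLpNorm g p volume ≤ 1 ∧ u g = ((N / 2 : NNReal) : ℂ) := by
  rcases eq_or_ne N 0 with rfl | hN
  · exact ⟨0, by simp, by simp⟩
  obtain ⟨g, hg⟩ : ∃ g : 𝓢(E n, ℂ), ((N / 2 : NNReal) : ℝ≥0∞) * eLpNorm g p volume < ‖u g‖ₑ := by
    by_contra! hcon
    have h1 := distLpENorm_le_of_forall_enorm_le (p' := p') hp ENNReal.coe_ne_top hcon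
    rw [hu, ENNReal.coe_le_coe] at h1
    exact absurd h1 (not_le.2 (NNReal.half_lt_self hN))
  have hug : u g ≠ 0 := by
    intro h0
    rw [h0, enorm_zero] at hg
    exact not_lt_zero hg
  refine ⟨(((N / 2 : NNReal) : ℂ) / u g) • g, ?_, ?_⟩
  · have h2 : eLpNorm ((((N / 2 : NNReal) : ℂ) / u g) • g : 𝓢(E n, ℂ)) p volume =
        ‖((N / 2 : NNReal) : ℂ) / u g‖ₑ * eLpNorm g p volume :=
      eLpNorm_const_smul (((N / 2 : NNReal) : ℂ) / u g) g p volume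
    have h4 : ‖((N / 2 : NNReal) : ℂ) / u g‖ₑ * ‖u g‖ₑ = ((N / 2 : NNReal) : ℝ≥0∞) := by
      rw [← enorm_mul, div_mul_cancel₀ _ hug, enorm_nnreal_complex]
    have hu0 : ‖u g‖ₑ ≠ 0 := by simpa using hug
    rw [h2, ← ENNReal.mul_le_mul_iff_left hu0 enorm_ne_top, one_mul, mul_right_comm, h4]
    exact hg.le
  · rw [map_smul, smul_eq_mul, div_mul_cancel₀ _ hug]

end Functionals

/-! ### Duality -/

section Duality

variable {n : ℕ} {𝔤 : Type*} [LieRing 𝔤] [LieAlgebra ℝ 𝔤]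
  {G : AdmissibleLieGroup n 𝔤} {α : ℝ} {I κ : Type*} {p p' q q' : ℝ≥0∞}

namespace AlphaModData

variable (d : AlphaModData G α I) (d' : AlphaModData G α κ)

/-- The pairing `φ ↦ conj (f (conj φ))` of `f` with test functions on the Fourier side. -/
def pairing (f : ZDual n) : Test n →ₗ[ℂ] ℂ where
  toFun φ := conj (f.fourier (conjTest φ))
  map_add' φ χ := by rw [conjTest_add, map_add, map_add]
  map_smul' c φ := by
    rw [conjTest_smul, map_smul, smul_eq_mul, map_mul, Complex.conj_conj, RingHom.id_apply,
      smul_eq_mul]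

variable (hα0 : 0 ≤ α) (hα1 : α ≤ 1) (s : ℝ) [hp1 : Fact (1 ≤ p)] [hq1 : Fact (1 ≤ q)]
  [hp1' : Fact (1 ≤ p')] (hp : p ≠ ∞) (hq : q ≠ ∞)

/-- On test functions supported in a fixed compact set the modulation norm is bounded by an `L^p`
norm, so a bounded functional restricts to a distribution. The two conjugations make it complex
linear. -/
lemma exists_fourier_eq_conj (ℓ : StrongDual ℂ (AlphaModSpace d s p q)) :
    ∃ f : ZDual n, ∀ φ, f.fourier φ = conj (ℓ (d.zTest hα0 hα1 s hp hq (conjTest φ))) := by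
  let L : Test n →ₗ[ℂ] ℂ :=
    { toFun := fun φ => conj (ℓ (d.zTest hα0 hα1 s hp hq (conjTest φ)))
      map_add' := fun φ χ => by rw [conjTest_add, map_add, map_add, map_add]
      map_smul' := fun c φ => by
        rw [conjTest_smul, map_smul, map_smul, smul_eq_mul, map_mul, Complex.conj_conj,
          RingHom.id_apply, smul_eq_mul] }
  have hL : Continuous L := by
    refine continuous_test_of_enorm_le (p := p) L fun K hK => ?_
    obtain ⟨C, hC, h⟩ := d.exists_alphaModENorm_zOfTest_le_of_isCompact (p := p) (q := q)
      hα0 hα1 s hp hq hK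
    refine ⟨‖ℓ‖ₑ * C, by finiteness, fun φ hφ => ?_⟩
    have h1 := h (conjTest φ) fun x hx => hφ x fun h0 => hx (by rw [conjTest_apply, h0, map_zero])
    rw [← eLpNorm_fourier_conjTest, conjTest_conjTest] at h1
    calc ‖L φ‖ₑ = ‖ℓ (d.zTest hα0 hα1 s hp hq (conjTest φ))‖ₑ := by
          change ‖conj (ℓ (d.zTest hα0 hα1 s hp hq (conjTest φ)))‖ₑ = _
          rw [← ofReal_norm, RCLike.norm_conj, ofReal_norm]
      _ ≤ ‖ℓ‖ₑ * ‖d.zTest hα0 hα1 s hp hq (conjTest φ)‖ₑ := ℓ.le_opENorm _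
      _ ≤ _ := by
          rw [mul_assoc, enorm_eq]
          exact mul_le_mul_right h1 _
  exact exists_zDual_fourier_eq ⟨L, hL⟩

/-- The norm of an element of the dual space is bounded by the norm of its functional. -/
lemma exists_alphaModENorm_le_opENorm [p.HolderConjugate p'] [q.HolderConjugate q'] :
    ∃ C : ℝ≥0∞, C ≠ ∞ ∧ ∀ (ℓ : StrongDual ℂ (AlphaModSpace d s p q)) (f : ZDual n),
      (∀ φ, f.fourier φ = conj (ℓ (d.zTest hα0 hα1 s hp hq (conjTest φ)))) →
        alphaModENorm d' (-s) p' q' f ≤ C * ‖ℓ‖ₑ := by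
  classical
  obtain ⟨C, hC, h⟩ := d.exists_alphaModENorm_zOfTest_le (p := p) (q := q) d' hα0 hα1 s hp hq
  refine ⟨2 * C, by finiteness, fun ℓ f hf => ?_⟩
  -- A finite sum of values of blocks of `f` is a single value of `f` on a synthesized function,
  -- hence the conjugate of a value of `ℓ`, and synthesis bounds the norm of that function.
  have key : ∀ (J : Finset κ) (g : κ → 𝓢(E n, ℂ)), (∀ j ∉ J, g j = 0) →
      ‖∑ j ∈ J, freqBlock (d'.ψ j) f (g j)‖ₑ ≤
        C * ‖ℓ‖ₑ * lqENorm q fun j => d'.weight s j * eLpNorm (g j) p volume := by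
    intro J g hg
    have h1 := h J (fun j => conjSchwartz (g j)) fun j hj => by rw [hg j hj, conjSchwartz_zero]
    simp only [eLpNorm_conjSchwartz] at h1
    have h2 : ∑ j ∈ J, mulTest (d'.ψ j) (𝓕 (conjSchwartz (g j))) =
        conjTest (∑ j ∈ J, mulTest (d'.ψ j) (𝓕⁻ (g j))) := by
      change _ = conjTestₗ n _
      rw [map_sum]
      exact Finset.sum_congr rfl fun j _ => (conjTest_mulTest_fourierInv _ _).symm
    rw [h2] at h1
    simp only [freqBlock_apply]
    rw [← map_sum, hf, ← ofReal_norm, RCLike.norm_conj, ofReal_norm]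
    refine (ℓ.le_opENorm _).trans ?_
    rw [enorm_eq, mul_comm C, mul_assoc]
    exact mul_le_mul_right h1 _
  -- The estimate for a single index shows that each block is bounded on `L^p`, hence lies in
  -- `L^{p'}`; this allows real-valued norms below.
  have hfin : ∀ j, distLpENorm p' (freqBlock (d'.ψ j) f) ≠ ∞ := by
    intro j
    have hCj : C * ‖ℓ‖ₑ * d'.weight s j ≠ ∞ :=
      ENNReal.mul_ne_top (by finiteness) (d'.weight_ne_top s j)
    refine ((distLpENorm_le_of_forall_enorm_le (p := p) hp hCj fun g => ?_).trans_lt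
      hCj.lt_top).ne
    have h1 := key {j} (Pi.single j g) fun i hi =>
      Pi.single_eq_of_ne (Finset.notMem_singleton.1 hi) _
    rw [Finset.sum_singleton, Pi.single_eq_same, lqENorm_eq_of_forall_ne hq1.out (j := j),
      Pi.single_eq_same, ← mul_assoc] at h1
    · exact h1
    · intro i hi
      rw [Pi.single_eq_of_ne hi, FunLike.coe_zero, eLpNorm_zero, mul_zero]
  lift (fun j => distLpENorm p' (freqBlock (d'.ψ j) f)) to κ → NNReal using hfin with N hN
  have hN' : ∀ j, distLpENorm p' (freqBlock (d'.ψ j) f) = N j := fun j => (congrFun hN j).symm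
  lift d'.weight (-s) to κ → NNReal using d'.weight_ne_top (-s) with w hw
  have hw' : ∀ j, d'.weight (-s) j = w j := fun j => (congrFun hw j).symm
  choose g hg1 hg using fun j => exists_eLpNorm_le_one_apply_eq hp (hN' j)
  have hmain : lqENorm q' (fun j => ((w j * N j : NNReal) : ℝ≥0∞)) ≤ 2 * C * ‖ℓ‖ₑ := by
    refine lqENorm_le_of_forall_sum_mul_le hq fun F c => ?_
    -- The factor `w j`, of order `-s`, cancels the weight of order `s` on the right and leaves `c
    -- j`. On the left it produces `∑ c j (w j N j) / 2`, whence the factor `2` in the constant.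
    have h1 := key F (fun j => if j ∈ F then ((c j * w j : NNReal) : ℂ) • g j else 0)
      fun j hj => if_neg hj
    have h2 : ∑ j ∈ F, freqBlock (d'.ψ j) f
        (if j ∈ F then ((c j * w j : NNReal) : ℂ) • g j else 0) =
        ((∑ j ∈ F, c j * (w j * N j) / 2 : NNReal) : ℂ) := by
      push_cast
      refine Finset.sum_congr rfl fun j hj => ?_
      rw [if_pos hj, map_smul, hg, smul_eq_mul]
      push_cast
      ring
    rw [h2, enorm_nnreal_complex] at h1
    have h3 : ∑ j ∈ F, (c j : ℝ≥0∞) * ((w j * N j : NNReal) : ℝ≥0∞) =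
        2 * ((∑ j ∈ F, c j * (w j * N j) / 2 : NNReal) : ℝ≥0∞) := by
      rw [← Finset.sum_div]
      norm_cast
      rw [mul_div_cancel₀ _ two_ne_zero]
    rw [h3, mul_assoc 2, mul_assoc 2]
    refine mul_le_mul_right (h1.trans (mul_le_mul_right (lqENorm_mono q fun j => ?_) _)) _
    by_cases hj : j ∈ F
    · rw [if_pos hj, Set.indicator_of_mem (Finset.mem_coe.2 hj)]
      have h4 : eLpNorm (((c j * w j : NNReal) : ℂ) • g j : 𝓢(E n, ℂ)) p volume =
          ‖((c j * w j : NNReal) : ℂ)‖ₑ * eLpNorm (g j) p volume :=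
        eLpNorm_const_smul ((c j * w j : NNReal) : ℂ) (g j) p volume
      rw [h4, enorm_nnreal_complex]
      calc d'.weight s j * (((c j * w j : NNReal) : ℝ≥0∞) * eLpNorm (g j) p volume)
          ≤ d'.weight s j * (((c j * w j : NNReal) : ℝ≥0∞) * 1) := by
            gcongr
            exact hg1 j
        _ = c j * (d'.weight s j * d'.weight (-s) j) := by
            rw [hw' j, ENNReal.coe_mul]
            ring
        _ = c j := by rw [d'.weight_mul_weight_neg, mul_one]
    · rw [if_neg hj, FunLike.coe_zero, eLpNorm_zero, mul_zero]
      exact zero_le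
  refine le_trans (le_of_eq ?_) hmain
  change lqENorm q' (fun j => d'.weight (-s) j * distLpENorm p' (freqBlock (d'.ψ j) f)) = _
  simp only [hN', hw', ENNReal.coe_mul]

lemma exists_norm_pairing_le [hq1' : Fact (1 ≤ q')] [p.HolderConjugate p']
    [q.HolderConjugate q'] :
    ∃ C : ℝ, 0 ≤ C ∧ ∀ (f : AlphaModSpace d' (-s) p' q') (φ : Test n),
      ‖pairing f.1 φ‖ ≤ C * ‖f‖ * ‖d.zTest hα0 hα1 s hp hq φ‖ := by
  obtain ⟨C, hC, h⟩ := d.exists_enorm_fourier_conjTest_le (p := p) (q := q) (p' := p') (q' := q')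
    d' hα0 hα1 s hq
  refine ⟨C.toReal, ENNReal.toReal_nonneg, fun f φ => ?_⟩
  have h1 : ‖f.1.fourier (conjTest φ)‖ₑ ≤ C * ‖f‖ₑ * ‖d.zTest hα0 hα1 s hp hq φ‖ₑ := by
    rw [enorm_eq, enorm_eq]
    exact h f.1 φ
  have h2 := ENNReal.toReal_mono (by finiteness) h1
  rw [ENNReal.toReal_mul, ENNReal.toReal_mul, toReal_enorm, toReal_enorm, toReal_enorm] at h2
  exact (RCLike.norm_conj (f.1.fourier (conjTest φ))).trans_le h2

lemma ext_zTest {ℓ ℓ' : StrongDual ℂ (AlphaModSpace d s p q)}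
    (h : ∀ φ, ℓ (d.zTest hα0 hα1 s hp hq φ) = ℓ' (d.zTest hα0 hα1 s hp hq φ)) : ℓ = ℓ' := by
  refine DFunLike.coe_injective ?_
  exact (d.denseRange_zTest hα0 hα1 s hp hq).equalizer ℓ.continuous ℓ'.continuous (funext h)

/-- Duality of the generalized `α`-modulation spaces. -/
theorem exists_dual_equiv [hq1' : Fact (1 ≤ q')] [p.HolderConjugate p'] [q.HolderConjugate q'] :
    ∃ Λ : AlphaModSpace d' (-s) p' q' ≃L⋆[ℂ] StrongDual ℂ (AlphaModSpace d s p q),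
      ∀ f φ, Λ f (d.zTest hα0 hα1 s hp hq φ) = pairing f.1 φ := by
  obtain ⟨C, hC0, hC⟩ := d.exists_norm_pairing_le d' (q' := q') (p' := p') hα0 hα1 s hp hq
  obtain ⟨C', hC', hinv⟩ := d.exists_alphaModENorm_le_opENorm d' (p' := p') (q' := q')
    hα0 hα1 s hp hq
  have hdense := d.denseRange_zTest (p := p) (q := q) hα0 hα1 s hp hq
  set z := d.zTest (p := p) (q := q) hα0 hα1 s hp hq
  -- The bound on the pairing lets it descend to the dense range of `z` and extend continuously to
  -- the whole space.
  have hext : ∀ (f : AlphaModSpace d' (-s) p' q') φ,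
      (pairing f.1).extendOfNorm z (z φ) = pairing f.1 φ := fun f φ =>
    LinearMap.extendOfNorm_eq hdense ⟨C * ‖f‖, hC f⟩ φ
  let Λ₀ : AlphaModSpace d' (-s) p' q' →ₗ⋆[ℂ] StrongDual ℂ (AlphaModSpace d s p q) :=
    { toFun := fun f => (pairing f.1).extendOfNorm z
      map_add' := fun f g => d.ext_zTest hα0 hα1 s hp hq fun φ => by
        change (pairing (f + g).1).extendOfNorm z (z φ) =
          (pairing f.1).extendOfNorm z (z φ) + (pairing g.1).extendOfNorm z (z φ)
        rw [hext, hext, hext]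
        exact map_add (starRingEnd ℂ) _ _
      map_smul' := fun c f => d.ext_zTest hα0 hα1 s hp hq fun φ => by
        change (pairing (c • f).1).extendOfNorm z (z φ) =
          conj c * (pairing f.1).extendOfNorm z (z φ)
        rw [hext, hext]
        exact map_mul (starRingEnd ℂ) _ _ }
  have hΛ : ∀ f φ, Λ₀ f (z φ) = pairing f.1 φ := hext
  have hbound : ∀ f, ‖Λ₀ f‖ ≤ C * ‖f‖ := fun f =>
    LinearMap.opNorm_extendOfNorm_le hdense (by positivity) (hC f)
  -- This lower bound gives injectivity and the continuity of the inverse at once; for an arbitrary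
  -- functional the same estimate shows that its distribution lies in the dual space, which gives
  -- surjectivity.
  have hbound' : ∀ f, ‖f‖ ≤ C'.toReal * ‖Λ₀ f‖ := by
    intro f
    have h1 : ‖f‖ₑ ≤ C' * ‖Λ₀ f‖ₑ := by
      rw [enorm_eq]
      refine hinv _ f.1 fun φ => ?_
      rw [hΛ]
      change _ = conj (conj (f.1.fourier (conjTest (conjTest φ))))
      rw [Complex.conj_conj, conjTest_conjTest]
    have h2 := ENNReal.toReal_mono (by finiteness) h1
    rwa [ENNReal.toReal_mul, toReal_enorm, toReal_enorm] at h2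
  have hinj : Function.Injective Λ₀ := by
    refine (injective_iff_map_eq_zero Λ₀).2 fun f hf => norm_le_zero_iff.1 ?_
    have h1 := hbound' f
    rwa [hf, norm_zero, mul_zero] at h1
  have hsurj : Function.Surjective Λ₀ := by
    intro ℓ
    obtain ⟨f, hf⟩ := d.exists_fourier_eq_conj hα0 hα1 s hp hq ℓ
    have hmem : f ∈ alphaModSubmodule d' (-s) p' q' :=
      (hinv ℓ f hf).trans_lt (by finiteness)
    refine ⟨⟨f, hmem⟩, d.ext_zTest hα0 hα1 s hp hq fun φ => ?_⟩
    refine (hΛ ⟨f, hmem⟩ φ).trans ?_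
    change conj (f.fourier (conjTest φ)) = _
    rw [hf, Complex.conj_conj, conjTest_conjTest]
  let e := LinearEquiv.ofBijective Λ₀ ⟨hinj, hsurj⟩
  refine ⟨e.toContinuousLinearEquivOfBounds C C'.toReal hbound fun ℓ => ?_, hΛ⟩
  have h1 := hbound' (e.symm ℓ)
  have h2 : Λ₀ (e.symm ℓ) = ℓ := e.apply_symm_apply ℓ
  rwa [h2] at h1

end AlphaModData

end Duality

end GenAlphaMod

end

/-- An element `g` of `Z` is parametrized by `φ = 𝓕g`, so that `zOfTest φ` is `g` acting by
integration. Since `conj (𝓕⁻¹φ) = 𝓕 (conj φ)`, the element `fourierZ n (conjTest φ)` is the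
conjugate of `g`. -/
theorem proposition4p4 {n : ℕ} {𝔤 : Type*} [LieRing 𝔤] [LieAlgebra ℝ 𝔤]
    (G : AdmissibleLieGroup n 𝔤) {α : ℝ} (hα0 : 0 ≤ α) (hα1 : α < 1) (s : ℝ)
    {p q p' q' : ℝ≥0∞} [Fact (1 ≤ p)] [Fact (1 ≤ q)] [Fact (1 ≤ p')] [Fact (1 ≤ q')]
    (hp : p < ∞) (hq : q < ∞) (hpp' : p.HolderConjugate p') (hqq' : q.HolderConjugate q')
    {I I' : Type*} (d : AlphaModData G α I) (d' : AlphaModData G α I') :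
    ∃ Λ : AlphaModSpace d' (-s) p' q' ≃L⋆[ℂ] StrongDual ℂ (AlphaModSpace d s p q),
      ∀ (f : AlphaModSpace d' (-s) p' q') (φ : Test n),
        ∃ hφ : zOfTest φ ∈ alphaModSubmodule d s p q,
          Λ f ⟨zOfTest φ, hφ⟩ = conj (f.1 (fourierZ n (conjTest φ))) := by
  obtain ⟨Λ, hΛ⟩ := d.exists_dual_equiv d' (p' := p') (q' := q') hα0 hα1.le s hp.ne hq.ne
  exact ⟨Λ, fun f φ => ⟨d.zOfTest_mem hα0 hα1.le s hp.ne hq.ne φ, hΛ f φ⟩⟩
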